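/- Let $n,m\ge 1$ be integers, let $a_1,\dots,a_m>1$ be real constants and put $a=\sum_{i=1}^m a_i$. For a real exponent $\alpha>1$ consider functions $u=u(x,y)\ge 0$, of class $C^2$ on the closed region $\mathbb R^n\times[0,\infty)^m$ (up to the boundary), that satisfy $$\sum_{i=1}^m y_i\,u_{y_iy_i}+\sum_{i=1}^m a_i\,u_{y_i}+\Delta_x u+u^\alpha=0\qquad\text{in }\mathbb R^n\times(0,\infty)^m .$$ No boundary condition is imposed. (1) If $1<\alpha<\dfrac{n+2a+2}{n+2a-2}$, then every such solution vanishes identically. (2) If $\alpha=\dfrac{n+2a+2}{n+2a-2}$, then such solutions are precisely the functions $$u_{t,x_0}(x,y)=\left(\frac{t\sqrt{(n+2a)(n+2a-2)}}{t^2+4\sum_{i=1}^m y_i+|x-x_0|^2}\right)^{\frac{n+2a-2}{2}},\qquad x_0\in\mathbb R^n,\ t\ge 0,$$ where $u_{0,x_0}$ is understood as the zero function. -/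

import Mathlib

/-- The open region `ℝⁿ × (0,∞)ᵐ`, with points `(x, y)`. -/
def openRegion (n m : ℕ) : Set (EuclideanSpace ℝ (Fin n) × (Fin m → ℝ)) :=
  {p | ∀ i, 0 < p.2 i}

/-- Its closure `ℝⁿ × [0,∞)ᵐ`. -/
def closedRegion (n m : ℕ) : Set (EuclideanSpace ℝ (Fin n) × (Fin m → ℝ)) :=
  {p | ∀ i, 0 ≤ p.2 i}

/-- The partial derivative `∂u/∂yᵢ`. -/
noncomputable def partialY {n m : ℕ} (u : EuclideanSpace ℝ (Fin n) × (Fin m → ℝ) → ℝ)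
    (i : Fin m) (p : EuclideanSpace ℝ (Fin n) × (Fin m → ℝ)) : ℝ :=
  deriv (fun s : ℝ => u (p.1, Function.update p.2 i s)) (p.2 i)

/-- The second partial derivative `∂²u/∂yᵢ²`. -/
noncomputable def partialYY {n m : ℕ} (u : EuclideanSpace ℝ (Fin n) × (Fin m → ℝ) → ℝ)
    (i : Fin m) (p : EuclideanSpace ℝ (Fin n) × (Fin m → ℝ)) : ℝ :=
  iteratedDeriv 2 (fun s : ℝ => u (p.1, Function.update p.2 i s)) (p.2 i)

/-- The Laplacian `Δₓ u` in the `x` variables. -/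
noncomputable def laplacianX {n m : ℕ} (u : EuclideanSpace ℝ (Fin n) × (Fin m → ℝ) → ℝ)
    (p : EuclideanSpace ℝ (Fin n) × (Fin m → ℝ)) : ℝ :=
  Laplacian.laplacian (fun x : EuclideanSpace ℝ (Fin n) => u (x, p.2)) p.1

/-- `u` is a nonnegative solution, of class `C²` up to the boundary, of
`∑ᵢ yᵢ u_{yᵢyᵢ} + ∑ᵢ aᵢ u_{yᵢ} + Δₓ u + u ^ α = 0` in `ℝⁿ × (0,∞)ᵐ`.
Only the values of `u` on the closed region matter. -/
structure IsNonnegSolution {n m : ℕ} (a : Fin m → ℝ) (α : ℝ)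
    (u : EuclideanSpace ℝ (Fin n) × (Fin m → ℝ) → ℝ) : Prop where
  contDiffOn : ContDiffOn ℝ 2 u (closedRegion n m)
  nonneg : ∀ p ∈ openRegion n m, 0 ≤ u p
  equation : ∀ p ∈ openRegion n m,
    (∑ i, p.2 i * partialYY u i p) + (∑ i, a i * partialY u i p) + laplacianX u p + u p ^ α = 0

/-- The critical exponent `(n + 2a + 2) / (n + 2a - 2)` with `a = ∑ᵢ aᵢ`. -/
noncomputable def criticalExponent (n : ℕ) {m : ℕ} (a : Fin m → ℝ) : ℝ :=
  ((n : ℝ) + 2 * (∑ i, a i) + 2) / ((n : ℝ) + 2 * (∑ i, a i) - 2)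

/-- The bubble with parameters `t` and `x₀`. For `t = 0` it is the zero function. -/
noncomputable def bubble {n m : ℕ} (a : Fin m → ℝ) (t : ℝ) (x₀ : EuclideanSpace ℝ (Fin n))
    (p : EuclideanSpace ℝ (Fin n) × (Fin m → ℝ)) : ℝ :=
  (t * Real.sqrt (((n : ℝ) + 2 * (∑ i, a i)) * ((n : ℝ) + 2 * (∑ i, a i) - 2)) /
      (t ^ 2 + 4 * (∑ i, p.2 i) + ‖p.1 - x₀‖ ^ 2)) ^ (((n : ℝ) + 2 * (∑ i, a i) - 2) / 2)

/-! Put y_i = ξ_i²/4. Then y_i ∂²/∂y_i² + a_i ∂/∂y_i becomes ∂²/∂ξ_i² + b_i ξ_i⁻¹ ∂/∂ξ_i with b_i =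
2a_i − 1 > 1, and U(x, ξ) = u(x, ξ²/4) is of class C² on the whole space and even in every ξ_i.
Regularity of u up to the boundary thus takes the place of a boundary condition. The operator `Lop`
behaves like the Laplacian in the homogeneous dimension N = `hdim b` = n + 2a. With p = (N − 2)/2,
the function |ξ|^(−2p) is harmonic away from the origin, Kelvin transforms centred at points of
x-space are available, and the critical exponent is given by pα = p + 2. A solution is zero or
positive everywhere (`WSol.eq_zero_or_pos`).

A positive solution is compared with its Kelvin transforms in growing spheres about a fixed centre
(`moving_spheres`). Either U dominates its transform outside every sphere, or the comparison stops
at some sphere. In the second case the strong maximum principle and the Hopf lemma show that U is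
invariant under that inversion, which forces pα = p + 2.

For subcritical α only the first case remains, and it gives U ≥ c|ξ|^(−p) at infinity. On the other
hand the minimum of U over a ball of radius r is at most C r^(−2/(α−1)) (`exists_min_bound`). As p(α
− 1) < 2, the two bounds contradict each other for large r.

For critical α, suppose that no centre in x-space gives an inversion symmetry. Sending the centre to
infinity in the comparison shows that U does not depend on x. It then solves the same equation in a
smaller homogeneous dimension, where α is subcritical, so it vanishes. Hence a positive U has an
inversion symmetry (`exists_inversion_symmetry`), and f = U^(−1/p), recentred, has quadratic growth
with a gradient of linear growth.

Classification follows Obata. With P = (|∇f|² + k)/f the equation reads Lf = (N/2)P. An integral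
identity with density ∏ ξ_i^(b_i) · f^(1−N) equates the integral of a cutoff times the squared trace
free Hessian (`qfun`) with a flux through the gradient of the cutoff (`obata_identity`). The flux
disappears in the limit: at infinity by the growth of f, at the hyperplanes ξ_i = 0 because b_i > 1.
So the Hessian of f is (P/2) times the identity, P is constant, and f is a paraboloid centred in
x-space (`eq_paraboloid_of_qfun_eq_zero`), that is, U is a bubble. The identity formally involves
third derivatives while f is only C²; `weak_curl` supplies their symmetry in weak form.

Throughout, L and `nsq` are squared radii, so |ξ|^(−2p) is `nsq ξ ^ (-p)`. -/

namespace WeightedLaplacian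

open Set Filter Topology Function MeasureTheory

set_option linter.unusedSectionVars false

/-! ### Coordinate calculus, the weighted Laplacian and the weak maximum principle. -/

section

variable {ι : Type*} [Fintype ι] [DecidableEq ι]

/-- The squared Euclidean norm. -/
def nsq (ξ : ι → ℝ) : ℝ := ∑ i, ξ i ^ 2

/-- The partial derivative in the `i`-th coordinate. -/
noncomputable def pd (i : ι) (g : (ι → ℝ) → ℝ) (ξ : ι → ℝ) : ℝ :=
  deriv (fun s : ℝ => g (update ξ i s)) (ξ i)

/-- The quotient `∂ᵢg / ξᵢ`, replaced by `∂ᵢ∂ᵢg` on the hyperplane `ξᵢ = 0`. -/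
noncomputable def radQ (i : ι) (g : (ι → ℝ) → ℝ) (ξ : ι → ℝ) : ℝ :=
  if ξ i = 0 then pd i (pd i g) ξ else pd i g ξ / ξ i

/-- The weighted Laplacian `∑ᵢ (∂ᵢ² + bᵢ ξᵢ⁻¹ ∂ᵢ)`. -/
noncomputable def Lop (b : ι → ℝ) (g : (ι → ℝ) → ℝ) (ξ : ι → ℝ) : ℝ :=
  ∑ i, (pd i (pd i g) ξ + b i * radQ i g ξ)

/-- The homogeneous dimension of the weighted Laplacian. -/
def hdim (b : ι → ℝ) : ℝ := ∑ i, (1 + b i)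

lemma nsq_nonneg (ξ : ι → ℝ) : 0 ≤ nsq ξ := Finset.sum_nonneg fun _ _ => sq_nonneg _

lemma nsq_smul (s : ℝ) (ξ : ι → ℝ) : nsq (s • ξ) = s ^ 2 * nsq ξ := by
  simp [nsq, Finset.mul_sum, mul_pow]

lemma nsq_eq_zero {ξ : ι → ℝ} : nsq ξ = 0 ↔ ξ = 0 := by
  rw [nsq, Finset.sum_eq_zero_iff_of_nonneg (fun _ _ => sq_nonneg _)]
  simp [funext_iff]

lemma nsq_pos {ξ : ι → ℝ} (h : ξ ≠ 0) : 0 < nsq ξ :=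
  (nsq_nonneg ξ).lt_of_ne fun h' => h (nsq_eq_zero.1 h'.symm)

lemma nsq_zero : nsq (0 : ι → ℝ) = 0 := nsq_eq_zero.2 rfl

lemma contDiff_nsq {n : WithTop ℕ∞} : ContDiff ℝ n (nsq : (ι → ℝ) → ℝ) := by
  unfold nsq; fun_prop

lemma continuous_nsq : Continuous (nsq : (ι → ℝ) → ℝ) := contDiff_nsq (n := 0).continuous

lemma sq_le_nsq (ξ : ι → ℝ) (i : ι) : ξ i ^ 2 ≤ nsq ξ :=
  Finset.single_le_sum (f := fun i => ξ i ^ 2) (fun _ _ => sq_nonneg _) (Finset.mem_univ i)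

lemma nsq_update (ξ : ι → ℝ) (i : ι) (s : ℝ) :
    nsq (update ξ i s) = nsq ξ - ξ i ^ 2 + s ^ 2 := by
  unfold nsq
  rw [← Finset.add_sum_erase _ _ (Finset.mem_univ i),
    ← Finset.add_sum_erase _ (fun j => ξ j ^ 2) (Finset.mem_univ i),
    Finset.sum_congr rfl (g := fun j => ξ j ^ 2) fun j hj => by
      rw [update_of_ne (Finset.ne_of_mem_erase hj)]]
  simp; ring

lemma isCompact_nsq_le (R : ℝ) : IsCompact {ξ : ι → ℝ | nsq ξ ≤ R} := by
  refine (isCompact_Icc (a := fun _ : ι => -(R + 1)) (b := fun _ => R + 1)).of_isClosed_subset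
    (isClosed_le continuous_nsq continuous_const) fun ξ hξ => ?_
  have h : ∀ i, -(R + 1) ≤ ξ i ∧ ξ i ≤ R + 1 := fun i => by
    have := (sq_le_nsq ξ i).trans hξ
    constructor <;> nlinarith
  exact ⟨fun i => (h i).1, fun i => (h i).2⟩

lemma isCompact_annulus (r R : ℝ) : IsCompact {ξ : ι → ℝ | r ≤ nsq ξ ∧ nsq ξ ≤ R} :=
  (isCompact_nsq_le R).of_isClosed_subset
    ((isClosed_le continuous_const continuous_nsq).inter
      (isClosed_le continuous_nsq continuous_const)) fun _ h => h.2

lemma pd_update (i : ι) (g : (ι → ℝ) → ℝ) (ξ : ι → ℝ) (s : ℝ) :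
    pd i g (update ξ i s) = deriv (fun s : ℝ => g (update ξ i s)) s := by
  simp [pd]

lemma pd_pd (i : ι) (g : (ι → ℝ) → ℝ) (ξ : ι → ℝ) :
    pd i (pd i g) ξ = deriv (deriv fun s : ℝ => g (update ξ i s)) (ξ i) := by
  conv_lhs => rw [pd]
  simp only [pd_update]

lemma update_line (ξ : ι → ℝ) (i : ι) (s : ℝ) :
    update ξ i s = ξ + (s - ξ i) • Pi.single i 1 := by
  ext j
  by_cases h : j = i
  · subst h; simp
  · simp [h]

lemma contDiffAt_line {g : (ι → ℝ) → ℝ} {ξ : ι → ℝ} {n : WithTop ℕ∞} (i : ι)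
    (h : ContDiffAt ℝ n g ξ) : ContDiffAt ℝ n (fun s : ℝ => g (update ξ i s)) (ξ i) :=
  ContDiffAt.comp (ξ i) (by simpa using h) (contDiff_update n ξ i).contDiffAt

lemma hasDerivAt_pd {g : (ι → ℝ) → ℝ} {ξ : ι → ℝ} (i : ι) (h : DifferentiableAt ℝ g ξ) :
    HasDerivAt (fun s : ℝ => g (update ξ i s)) (pd i g ξ) (ξ i) := by
  have : DifferentiableAt ℝ (fun s : ℝ => g (update ξ i s)) (ξ i) :=
    DifferentiableAt.comp (ξ i) (by simpa using h) (hasDerivAt_update ξ i (ξ i)).differentiableAt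
  exact this.hasDerivAt

lemma pd_eq_fderiv {g : (ι → ℝ) → ℝ} {ξ : ι → ℝ} (i : ι) (h : DifferentiableAt ℝ g ξ) :
    pd i g ξ = fderiv ℝ g ξ (Pi.single i 1) := by
  have h1 : HasFDerivAt g (fderiv ℝ g ξ) (update ξ i (ξ i)) := by simpa using h.hasFDerivAt
  exact (h1.comp_hasDerivAt (ξ i) (hasDerivAt_update ξ i (ξ i))).deriv

lemma contDiff_pd {g : (ι → ℝ) → ℝ} {n m : WithTop ℕ∞} (i : ι) (h : ContDiff ℝ n g)
    (hn : m + 1 ≤ n) : ContDiff ℝ m (pd i g) := by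
  have h0 : Differentiable ℝ g := h.differentiable (by
    rintro rfl
    simp at hn)
  have : pd i g = fun ξ => fderiv ℝ g ξ (Pi.single i 1) := by
    ext ξ; exact pd_eq_fderiv i (h0 ξ)
  rw [this]
  exact (h.fderiv_right hn).clm_apply contDiff_const

lemma sum_smul_single (ξ : ι → ℝ) :
    ∑ i, ξ i • (Pi.single i (1 : ℝ) : ι → ℝ) = ξ := by
  ext j
  simp [Finset.sum_apply, Pi.single_apply]

lemma fderiv_apply_eq_sum_pd {g : (ι → ℝ) → ℝ} {ξ : ι → ℝ} (h : DifferentiableAt ℝ g ξ)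
    (v : ι → ℝ) : fderiv ℝ g ξ v = ∑ i, v i * pd i g ξ := by
  conv_lhs => rw [← sum_smul_single v]
  simp [pd_eq_fderiv _ h]

/-- A negative second derivative at a critical point would make x a local maximum as well, so f
would be locally constant and its second derivative zero. -/
lemma second_deriv_nonneg_of_isLocalMin {f : ℝ → ℝ} {x : ℝ} (h : IsLocalMin f x)
    (hc : ContinuousAt f x) : 0 ≤ deriv (deriv f) x := by
  by_contra! hneg
  have hmax := isLocalMax_of_deriv_deriv_neg hneg h.deriv_eq_zero hc
  have heq : f =ᶠ[𝓝 x] fun _ => f x := by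
    filter_upwards [h, hmax] with y h1 h2 using le_antisymm h2 h1
  have h2 : deriv (deriv f) x = deriv (deriv fun _ => f x) x := heq.deriv.deriv_eq
  simp at h2
  linarith

lemma isLocalMin_line {g : (ι → ℝ) → ℝ} {ξ : ι → ℝ} (i : ι) (h : IsLocalMin g ξ) :
    IsLocalMin (fun s : ℝ => g (update ξ i s)) (ξ i) := by
  have hc : ContinuousAt (fun s : ℝ => update ξ i s) (ξ i) :=
    (contDiff_update (𝕜 := ℝ) 0 ξ i).continuous.continuousAt
  have h' : ∀ᶠ η in 𝓝 (update ξ i (ξ i)), g ξ ≤ g η := by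
    rw [update_eq_self]; exact h
  filter_upwards [hc.eventually h'] with s hs
  simpa using hs

/-- At a minimum the first derivatives vanish, so `radQ` is zero off the hyperplane and a
nonnegative second derivative on it. The singular term therefore needs no separate treatment in the
maximum principle. -/
lemma Lop_nonneg_of_isLocalMin {b : ι → ℝ} (hb : ∀ i, 0 ≤ b i) {g : (ι → ℝ) → ℝ} {ξ : ι → ℝ}
    (h : IsLocalMin g ξ) (hc : ContinuousAt g ξ) : 0 ≤ Lop b g ξ := by
  have hline : ∀ i, 0 ≤ pd i (pd i g) ξ := fun i => by
    rw [pd_pd]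
    refine second_deriv_nonneg_of_isLocalMin (isLocalMin_line i h) ?_
    exact ContinuousAt.comp (by simpa using hc)
      (contDiff_update (𝕜 := ℝ) 0 ξ i).continuous.continuousAt
  refine Finset.sum_nonneg fun i _ => add_nonneg (hline i) (mul_nonneg (hb i) ?_)
  unfold radQ
  split_ifs
  · exact hline i
  · rw [pd, (isLocalMin_line i h).deriv_eq_zero]; simp

lemma deriv_eventually {f : ℝ → ℝ} {x : ℝ} (h : ContDiffAt ℝ 2 f x) :
    (∀ᶠ t in 𝓝 x, DifferentiableAt ℝ f t) ∧ DifferentiableAt ℝ (deriv f) x := by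
  constructor
  · filter_upwards [h.eventually (by simp)] with t ht using ht.differentiableAt (by simp)
  · have h1 : ContDiffAt ℝ 1 (fderiv ℝ f) x := h.fderiv_right (by norm_num)
    exact (h1.differentiableAt (by simp)).clm_apply (differentiableAt_const _)

lemma pd_pd_lin (i : ι) {g h : (ι → ℝ) → ℝ} {ξ : ι → ℝ} (hg : ContDiffAt ℝ 2 g ξ)
    (hh : ContDiffAt ℝ 2 h ξ) (c k : ℝ) :
    pd i (fun η => g η + c * h η + k) ξ = pd i g ξ + c * pd i h ξ ∧
    pd i (pd i fun η => g η + c * h η + k) ξ = pd i (pd i g) ξ + c * pd i (pd i h) ξ := by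
  obtain ⟨g1, g2⟩ := deriv_eventually (contDiffAt_line i hg)
  obtain ⟨h1, h2⟩ := deriv_eventually (contDiffAt_line i hh)
  have key : deriv (fun s : ℝ => g (update ξ i s) + c * h (update ξ i s) + k) =ᶠ[𝓝 (ξ i)]
      fun s => deriv (fun s : ℝ => g (update ξ i s)) s +
        c * deriv (fun s : ℝ => h (update ξ i s)) s := by
    filter_upwards [g1, h1] with s hs hs'
    exact ((hs.hasDerivAt.add (hs'.hasDerivAt.const_mul c)).add_const k).deriv
  refine ⟨key.eq_of_nhds, ?_⟩
  rw [pd_pd, pd_pd, pd_pd, key.deriv_eq]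
  exact (g2.hasDerivAt.add (h2.hasDerivAt.const_mul c)).deriv

lemma Lop_lin (b : ι → ℝ) {g h : (ι → ℝ) → ℝ} {ξ : ι → ℝ} (hg : ContDiffAt ℝ 2 g ξ)
    (hh : ContDiffAt ℝ 2 h ξ) (c k : ℝ) :
    Lop b (fun η => g η + c * h η + k) ξ = Lop b g ξ + c * Lop b h ξ := by
  unfold Lop
  rw [Finset.mul_sum, ← Finset.sum_add_distrib]
  refine Finset.sum_congr rfl fun i _ => ?_
  obtain ⟨h1, h2⟩ := pd_pd_lin i hg hh c k
  unfold radQ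
  rw [h2, h1]
  split_ifs <;> ring

lemma Lop_congr (b : ι → ℝ) {g h : (ι → ℝ) → ℝ} {ξ : ι → ℝ} (hgh : g =ᶠ[𝓝 ξ] h) :
    Lop b g ξ = Lop b h ξ := by
  have hl : ∀ i, (fun s : ℝ => g (update ξ i s)) =ᶠ[𝓝 (ξ i)] fun s => h (update ξ i s) :=
    fun i => by
      have hc : ContinuousAt (fun s : ℝ => update ξ i s) (ξ i) :=
        (contDiff_update (𝕜 := ℝ) 0 ξ i).continuous.continuousAt
      have h' : ∀ᶠ η in 𝓝 (update ξ i (ξ i)), g η = h η := by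
        rw [update_eq_self]; exact hgh
      exact hc.eventually h'
  refine Finset.sum_congr rfl fun i _ => ?_
  have h2 : pd i (pd i g) ξ = pd i (pd i h) ξ := by
    rw [pd_pd, pd_pd, (hl i).deriv.deriv_eq]
  have h1 : pd i g ξ = pd i h ξ := (hl i).deriv_eq
  unfold radQ
  rw [h2, h1]

/-- Partial derivatives of a function of `nsq`. -/
lemma pd_radial (i : ι) {φ φ' : ℝ → ℝ} {φ'' : ℝ} {ξ : ι → ℝ}
    (h1 : ∀ᶠ t in 𝓝 (nsq ξ), HasDerivAt φ (φ' t) t) (h2 : HasDerivAt φ' φ'' (nsq ξ)) :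
    pd i (fun η => φ (nsq η)) ξ = 2 * ξ i * φ' (nsq ξ) ∧
    pd i (pd i fun η => φ (nsq η)) ξ = 2 * φ' (nsq ξ) + 4 * ξ i ^ 2 * φ'' := by
  have hq : ∀ s : ℝ, HasDerivAt (fun s : ℝ => nsq ξ - ξ i ^ 2 + s ^ 2) (2 * s) s := fun s => by
    simpa using (hasDerivAt_pow 2 s).const_add (nsq ξ - ξ i ^ 2)
  have hx : nsq ξ - ξ i ^ 2 + ξ i ^ 2 = nsq ξ := by ring
  have key : deriv (fun s : ℝ => φ (nsq (update ξ i s))) =ᶠ[𝓝 (ξ i)]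
      fun s => φ' (nsq ξ - ξ i ^ 2 + s ^ 2) * (2 * s) := by
    have hc := (hq (ξ i)).continuousAt
    have h1' : ∀ᶠ t in 𝓝 (nsq ξ - ξ i ^ 2 + ξ i ^ 2), HasDerivAt φ (φ' t) t := by rwa [hx]
    filter_upwards [hc.eventually h1'] with s hs
    simp only [nsq_update]
    exact (hs.comp s (hq s)).deriv
  refine ⟨?_, ?_⟩
  · rw [pd, key.eq_of_nhds, hx]; ring
  · rw [pd_pd, key.deriv_eq]
    have h2' : HasDerivAt φ' φ'' (nsq ξ - ξ i ^ 2 + ξ i ^ 2) := by rwa [hx]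
    have h3 : HasDerivAt (fun s : ℝ => 2 * s) 2 (ξ i) := by
      simpa using (hasDerivAt_id (ξ i)).const_mul 2
    have h4 := ((h2'.comp (ξ i) (hq (ξ i))).mul h3).deriv
    simp only [comp, hx] at h4
    refine Eq.trans h4 ?_
    ring

/-- Each ∂_i of a function of `nsq` is divisible by ξ_i, so both branches of `radQ` give 2φ' and the
weights enter only through `hdim b`. -/
lemma Lop_radial (b : ι → ℝ) {φ φ' : ℝ → ℝ} {φ'' : ℝ} {ξ : ι → ℝ}
    (h1 : ∀ᶠ t in 𝓝 (nsq ξ), HasDerivAt φ (φ' t) t) (h2 : HasDerivAt φ' φ'' (nsq ξ)) :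
    Lop b (fun η => φ (nsq η)) ξ = 4 * nsq ξ * φ'' + 2 * hdim b * φ' (nsq ξ) := by
  have : ∀ i, pd i (pd i fun η => φ (nsq η)) ξ + b i * radQ i (fun η => φ (nsq η)) ξ =
      4 * φ'' * ξ i ^ 2 + 2 * φ' (nsq ξ) * (1 + b i) := fun i => by
    obtain ⟨e1, e2⟩ := pd_radial i h1 h2
    unfold radQ
    rw [e1, e2]
    split_ifs with h0
    · rw [h0]; ring
    · field_simp; ring
  unfold Lop
  rw [Finset.sum_congr rfl fun i _ => this i, Finset.sum_add_distrib, ← Finset.mul_sum,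
    ← Finset.mul_sum]
  unfold hdim nsq; ring

lemma Lop_nsq (b : ι → ℝ) (ξ : ι → ℝ) : Lop b nsq ξ = 2 * hdim b := by
  have := Lop_radial b (φ := fun t => t) (φ' := fun _ => 1) (φ'' := 0) (ξ := ξ)
    (Eventually.of_forall fun t => hasDerivAt_id t) (hasDerivAt_const _ _)
  simpa using this

lemma contDiffAt_nsq_rpow {ξ : ι → ℝ} (h : ξ ≠ 0) (q : ℝ) {n : WithTop ℕ∞} :
    ContDiffAt ℝ n (fun η : ι → ℝ => nsq η ^ q) ξ :=
  contDiff_nsq.contDiffAt.rpow_const_of_ne (nsq_pos h).ne'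

lemma Lop_nsq_rpow (b : ι → ℝ) {ξ : ι → ℝ} (h : ξ ≠ 0) (q : ℝ) :
    Lop b (fun η => nsq η ^ q) ξ = 2 * q * (2 * (q - 1) + hdim b) * nsq ξ ^ (q - 1) := by
  have hp := nsq_pos h
  have := Lop_radial b (φ := fun t => t ^ q) (φ' := fun t => q * t ^ (q - 1))
    (φ'' := q * ((q - 1) * nsq ξ ^ (q - 1 - 1))) (ξ := ξ)
    ((lt_mem_nhds hp).mono fun t ht => Real.hasDerivAt_rpow_const (Or.inl ht.ne'))
    ((Real.hasDerivAt_rpow_const (Or.inl hp.ne')).const_mul q)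
  rw [this]
  have h2 : nsq ξ ^ (q - 1) = nsq ξ * nsq ξ ^ (q - 1 - 1) := by
    rw [Real.rpow_sub_one hp.ne' (q - 1)]; field_simp
  rw [h2]; ring

/-- The weak maximum principle. -/
lemma weak_max {b : ι → ℝ} (hb : ∀ i, 0 ≤ b i) (hN : 0 < hdim b) {K B : Set (ι → ℝ)}
    (hK : IsCompact K) {g : (ι → ℝ) → ℝ} (hg : ContinuousOn g K) (hB : ∀ ξ ∈ B, 0 ≤ g ξ)
    (hint : ∀ ξ ∈ K, ξ ∉ B → K ∈ 𝓝 ξ) (hC : ∀ ξ ∈ K, ξ ∉ B → ContDiffAt ℝ 2 g ξ)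
    (hL : ∀ ξ ∈ K, ξ ∉ B → Lop b g ξ ≤ 0) : ∀ ξ ∈ K, 0 ≤ g ξ := by
  obtain ⟨R, hR⟩ : ∃ R, ∀ ξ ∈ K, nsq ξ ≤ R := by
    obtain ⟨R, hR⟩ := (hK.image continuous_nsq).bddAbove
    exact ⟨R, fun ξ h => hR ⟨ξ, h, rfl⟩⟩
  intro ζ hζ
  refine le_of_forall_pos_lt_add fun ε hε => ?_
  -- Subtracting δ·`nsq` makes the supersolution strict, and adding δR keeps it nonnegative on B.
  -- The denominator R + 1 gives δR < ε, also when R = 0.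
  set δ := ε / (R + 1) with hδ
  have hR0 : 0 ≤ R := (nsq_nonneg ζ).trans (hR ζ hζ)
  have hδ0 : 0 < δ := by positivity
  set h : (ι → ℝ) → ℝ := fun η => g η + (-δ) * nsq η + δ * R with hh
  have hcont : ContinuousOn h K :=
    (hg.add (continuousOn_const.mul continuous_nsq.continuousOn)).add continuousOn_const
  obtain ⟨ξ, hξ, hmin⟩ := hK.exists_isMinOn ⟨ζ, hζ⟩ hcont
  have hpos : 0 ≤ h ξ := by
    by_contra! hneg
    have hB' : ξ ∉ B := fun hb => by
      have := hB ξ hb; have := hR ξ hξ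
      simp only [hh] at hneg
      nlinarith
    have hloc : IsLocalMin h ξ := by
      filter_upwards [hint ξ hξ hB'] with η hη using hmin hη
    have h1 := Lop_nonneg_of_isLocalMin hb hloc (hcont.continuousAt (hint ξ hξ hB'))
    rw [hh, Lop_lin b (hC ξ hξ hB') contDiff_nsq.contDiffAt, Lop_nsq] at h1
    have := hL ξ hξ hB'
    nlinarith
  have h2 : h ξ ≤ h ζ := hmin hζ
  simp only [hh] at h2 hpos
  have h3 : δ * R < ε := by
    rw [hδ, div_mul_eq_mul_div, div_lt_iff₀ (by positivity)]; nlinarith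
  nlinarith [nsq_nonneg ζ]

end

/-! ### Inversion and the Kelvin transform. -/

section

variable {ι : Type*} [Fintype ι] [DecidableEq ι]

lemma pd_pd_eq_fderiv {g : (ι → ℝ) → ℝ} {ξ : ι → ℝ} (i : ι) (h : ContDiffAt ℝ 2 g ξ) :
    pd i (pd i g) ξ = fderiv ℝ (fderiv ℝ g) ξ (Pi.single i 1) (Pi.single i 1) := by
  have hc : ContinuousAt (fun s : ℝ => update ξ i s) (ξ i) :=
    (contDiff_update (𝕜 := ℝ) 0 ξ i).continuous.continuousAt
  have h1 : ContDiffAt ℝ 1 (fderiv ℝ g) ξ := h.fderiv_right (by norm_num)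
  have hev : ∀ᶠ η in 𝓝 ξ, pd i g η = fderiv ℝ g η (Pi.single i 1) := by
    filter_upwards [h.eventually (by simp)] with η hη
    exact pd_eq_fderiv i (hη.differentiableAt (by simp))
  have hev' : (fun s : ℝ => pd i g (update ξ i s)) =ᶠ[𝓝 (ξ i)]
      fun s => fderiv ℝ g (update ξ i s) (Pi.single i 1) := by
    have : ∀ᶠ η in 𝓝 (update ξ i (ξ i)), pd i g η = fderiv ℝ g η (Pi.single i 1) := by
      rwa [update_eq_self]
    exact hc.eventually this
  conv_lhs => rw [pd]
  rw [hev'.deriv_eq]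
  have h2 : HasFDerivAt (fderiv ℝ g) (fderiv ℝ (fderiv ℝ g) ξ) (update ξ i (ξ i)) := by
    rw [update_eq_self]; exact (h1.differentiableAt (by simp)).hasFDerivAt
  have h3 := (h2.comp_hasDerivAt (ξ i) (hasDerivAt_update ξ i (ξ i))).clm_apply
    (hasDerivAt_const (ξ i) (Pi.single i (1 : ℝ) : ι → ℝ))
  simpa using h3.deriv

lemma sum_mul_clm_single (G : (ι → ℝ) →L[ℝ] ℝ) (ξ : ι → ℝ) :
    ∑ i, ξ i * G (Pi.single i 1) = G ξ := by
  conv_rhs => rw [← sum_smul_single ξ]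
  simp only [map_sum, map_smul, smul_eq_mul]

lemma pd_mul (i : ι) {g h : (ι → ℝ) → ℝ} {ξ : ι → ℝ} (hg : DifferentiableAt ℝ g ξ)
    (hh : DifferentiableAt ℝ h ξ) :
    pd i (fun η => g η * h η) ξ = pd i g ξ * h ξ + g ξ * pd i h ξ := by
  have := ((hasDerivAt_pd i hg).mul (hasDerivAt_pd i hh)).deriv
  simp only [update_eq_self] at this
  exact this

lemma pd_pd_mul (i : ι) {g h : (ι → ℝ) → ℝ} {ξ : ι → ℝ} (hg : ContDiffAt ℝ 2 g ξ)
    (hh : ContDiffAt ℝ 2 h ξ) :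
    pd i (pd i fun η => g η * h η) ξ =
      pd i (pd i g) ξ * h ξ + 2 * pd i g ξ * pd i h ξ + g ξ * pd i (pd i h) ξ := by
  obtain ⟨g1, g2⟩ := deriv_eventually (contDiffAt_line i hg)
  obtain ⟨h1, h2⟩ := deriv_eventually (contDiffAt_line i hh)
  have key : deriv (fun s : ℝ => g (update ξ i s) * h (update ξ i s)) =ᶠ[𝓝 (ξ i)]
      fun s => deriv (fun s : ℝ => g (update ξ i s)) s * h (update ξ i s) +
        g (update ξ i s) * deriv (fun s : ℝ => h (update ξ i s)) s := by
    filter_upwards [g1, h1] with s hs hs'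
    exact (hs.hasDerivAt.mul hs'.hasDerivAt).deriv
  rw [pd_pd, key.deriv_eq, pd_pd, pd_pd]
  have h3 := ((g2.hasDerivAt.mul h1.self_of_nhds.hasDerivAt).add
    (g1.self_of_nhds.hasDerivAt.mul h2.hasDerivAt)).deriv
  refine Eq.trans h3 ?_
  simp only [update_eq_self, pd]
  ring

/-- On ξ_i = 0 the value of `radQ` is a second derivative, whose product rule has a cross term
carrying the factor b_i; `h0` removes it. -/
lemma Lop_mul (b : ι → ℝ) {g h : (ι → ℝ) → ℝ} {ξ : ι → ℝ} (hg : ContDiffAt ℝ 2 g ξ)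
    (hh : ContDiffAt ℝ 2 h ξ) (h0 : ∀ i, ξ i = 0 → pd i g ξ * pd i h ξ = 0) :
    Lop b (fun η => g η * h η) ξ =
      Lop b g ξ * h ξ + 2 * ∑ i, pd i g ξ * pd i h ξ + g ξ * Lop b h ξ := by
  unfold Lop
  rw [Finset.sum_mul, Finset.mul_sum, Finset.mul_sum, ← Finset.sum_add_distrib,
    ← Finset.sum_add_distrib]
  refine Finset.sum_congr rfl fun i _ => ?_
  have e1 := pd_mul i (hg.differentiableAt (by simp)) (hh.differentiableAt (by simp))
  have e2 := pd_pd_mul i hg hh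
  unfold radQ
  rw [e2, e1]
  split_ifs with hi
  · linear_combination (2 * b i) * h0 i hi
  · field_simp; ring

/-- Inversion in the sphere `nsq = L`. -/
noncomputable def star (L : ℝ) (ξ : ι → ℝ) : ι → ℝ := (L / nsq ξ) • ξ

/-- The Kelvin transform with respect to the sphere `nsq = L`. -/
noncomputable def kelvin (p L : ℝ) (U : (ι → ℝ) → ℝ) (ξ : ι → ℝ) : ℝ :=
  (L / nsq ξ) ^ p * U (star L ξ)

lemma nsq_star {L : ℝ} {ξ : ι → ℝ} (h : ξ ≠ 0) : nsq (star L ξ) = L ^ 2 / nsq ξ := by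
  have := (nsq_pos h).ne'
  rw [star, nsq_smul]; field_simp

lemma contDiffAt_star {L : ℝ} {ξ : ι → ℝ} (h : ξ ≠ 0) {n : WithTop ℕ∞} :
    ContDiffAt ℝ n (star L) ξ :=
  (contDiffAt_const.div contDiff_nsq.contDiffAt (nsq_pos h).ne').smul contDiffAt_id

lemma contDiffAt_kelvin {p L : ℝ} (hL : 0 < L) {U : (ι → ℝ) → ℝ} (hU : ContDiff ℝ 2 U)
    {ξ : ι → ℝ} (h : ξ ≠ 0) : ContDiffAt ℝ 2 (kelvin p L U) ξ :=
  ((contDiffAt_const.div contDiff_nsq.contDiffAt (nsq_pos h).ne').rpow_const_of_ne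
    (div_pos hL (nsq_pos h)).ne').mul (hU.contDiffAt.comp ξ (contDiffAt_star h))

/-- The two vectors are the first and second i-derivatives of the inversion; the formulas are the
chain rule along a coordinate line. -/
lemma pd_comp_star {L : ℝ} {U : (ι → ℝ) → ℝ} (hU : ContDiff ℝ 2 U) {ξ : ι → ℝ} (h : ξ ≠ 0)
    (i : ι) :
    pd i (fun η => U (star L η)) ξ =
      fderiv ℝ U (star L ξ) ((-(2 * (L / nsq ξ) * ξ i / nsq ξ)) • ξ +
        (L / nsq ξ) • Pi.single i 1) ∧
    pd i (pd i fun η => U (star L η)) ξ =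
      fderiv ℝ (fderiv ℝ U) (star L ξ) ((-(2 * (L / nsq ξ) * ξ i / nsq ξ)) • ξ +
        (L / nsq ξ) • Pi.single i 1) ((-(2 * (L / nsq ξ) * ξ i / nsq ξ)) • ξ +
        (L / nsq ξ) • Pi.single i 1) +
      fderiv ℝ U (star L ξ) ((L / nsq ξ / nsq ξ * (-2 + 8 * ξ i ^ 2 / nsq ξ)) • ξ +
        (-(4 * (L / nsq ξ) * ξ i / nsq ξ)) • Pi.single i 1) := by
  have hp := nsq_pos h
  set e : ι → ℝ := Pi.single i 1 with he
  set q : ℝ → ℝ := fun s => nsq (update ξ i s) with hq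
  have hq0 : q (ξ i) = nsq ξ := by simp [hq]
  have hqd : ∀ s : ℝ, HasDerivAt q (2 * s) s := fun s => by
    simp only [hq, nsq_update]
    simpa using (hasDerivAt_pow 2 s).const_add (nsq ξ - ξ i ^ 2)
  have hev : ∀ᶠ s in 𝓝 (ξ i), q s ≠ 0 :=
    (hqd (ξ i)).continuousAt.eventually_ne (by rw [hq0]; exact hp.ne')
  have hc : ∀ s, HasDerivAt (fun s => update ξ i s) e s := fun s => hasDerivAt_update ξ i s
  set A : ℝ → (ι → ℝ) := fun s => (-(2 * L * s / q s ^ 2)) • update ξ i s + (L / q s) • e with hA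
  have hγ : ∀ᶠ s in 𝓝 (ξ i), HasDerivAt (fun s => star L (update ξ i s)) (A s) s := by
    filter_upwards [hev] with s hs
    have h1 := (((hqd s).inv hs).const_mul L).smul (hc s)
    refine h1.congr_deriv ?_
    simp only [hA, div_eq_mul_inv, Pi.inv_apply]
    rw [add_comm]
    congr 2
    field_simp
  have hA0 : A (ξ i) = (-(2 * (L / nsq ξ) * ξ i / nsq ξ)) • ξ + (L / nsq ξ) • e := by
    simp only [hA, hq0, update_eq_self]
    congr 2
    field_simp
  have hU1 : ∀ η, HasFDerivAt U (fderiv ℝ U η) η := fun η =>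
    (hU.differentiable (by simp) η).hasFDerivAt
  have hU2 : ContDiff ℝ 1 (fderiv ℝ U) := hU.fderiv_right (by norm_num)
  have hU2' : ∀ η, HasFDerivAt (fderiv ℝ U) (fderiv ℝ (fderiv ℝ U) η) η := fun η =>
    (hU2.differentiable (by simp) η).hasFDerivAt
  have key : deriv (fun s => U (star L (update ξ i s))) =ᶠ[𝓝 (ξ i)]
      fun s => fderiv ℝ U (star L (update ξ i s)) (A s) := by
    filter_upwards [hγ] with s hs
    exact ((hU1 _).comp_hasDerivAt s hs).deriv
  constructor
  · rw [pd, key.eq_of_nhds, hA0, update_eq_self]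
  · rw [pd_pd, key.deriv_eq]
    have hA' : HasDerivAt A ((L / nsq ξ / nsq ξ * (-2 + 8 * ξ i ^ 2 / nsq ξ)) • ξ +
        (-(4 * (L / nsq ξ) * ξ i / nsq ξ)) • e) (ξ i) := by
      have hs := hev.self_of_nhds
      have f1 : HasDerivAt (fun s => -(2 * L * s / q s ^ 2))
          (L / nsq ξ / nsq ξ * (-2 + 8 * ξ i ^ 2 / nsq ξ)) (ξ i) := by
        have := (((hasDerivAt_id (ξ i)).const_mul (2 * L)).div
          ((hqd (ξ i)).pow 2) (pow_ne_zero 2 hs)).neg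
        refine this.congr_deriv ?_
        simp only [id, hq0, Pi.pow_apply]
        field_simp
        ring
      have f2 : HasDerivAt (fun s => L / q s) (-(2 * (L / nsq ξ) * ξ i / nsq ξ)) (ξ i) := by
        have := (hasDerivAt_const (ξ i) L).div (hqd (ξ i)) hs
        refine this.congr_deriv ?_
        simp only [hq0]
        field_simp
        ring
      have h1 := (f1.smul (hc (ξ i))).add (f2.smul_const e)
      refine h1.congr_deriv ?_
      simp only [hq0, update_eq_self]
      rw [add_right_comm, ← add_smul, add_comm]
      congr 2
      field_simp
      ring
    have hγ0 : HasDerivAt (fun s => star L (update ξ i s)) (A (ξ i)) (ξ i) := hγ.self_of_nhds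
    have h21 : HasDerivAt (fun s => fderiv ℝ U (star L (update ξ i s)))
        (fderiv ℝ (fderiv ℝ U) (star L (update ξ i (ξ i))) (A (ξ i))) (ξ i) :=
      (hU2' (star L (update ξ i (ξ i)))).comp_hasDerivAt (ξ i) hγ0
    have h2 := h21.clm_apply hA'
    rw [hA0] at h2
    simp only [update_eq_self] at h2
    exact h2.deriv

/-- The inversion is conformal with factor `L / nsq ξ`, so the second order part is merely rescaled.
Of the first order terms only a radial one survives, and the power of `nsq` in the Kelvin transform
is there to cancel it. -/
lemma Lop_comp_star (b : ι → ℝ) {L : ℝ} (hL : 0 < L) {U : (ι → ℝ) → ℝ} (hU : ContDiff ℝ 2 U)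
    {ξ : ι → ℝ} (h : ξ ≠ 0) :
    Lop b (fun η => U (star L η)) ξ = (L / nsq ξ) ^ 2 * Lop b U (star L ξ) +
      (L / nsq ξ / nsq ξ) * (4 - 2 * hdim b) * fderiv ℝ U (star L ξ) ξ := by
  have hp := nsq_pos h
  have ht : 0 < L / nsq ξ := div_pos hL hp
  set t := L / nsq ξ with htd
  set G := fderiv ℝ U (star L ξ) with hG
  set H := fderiv ℝ (fderiv ℝ U) (star L ξ) with hH
  have hUd := hU.differentiable (by simp)
  have key : ∀ i, pd i (pd i fun η => U (star L η)) ξ +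
      b i * radQ i (fun η => U (star L η)) ξ =
      t ^ 2 * (pd i (pd i U) (star L ξ) + b i * radQ i U (star L ξ)) +
      (4 * t ^ 2 / nsq ξ ^ 2 * H ξ ξ + 8 * t / nsq ξ ^ 2 * G ξ) * ξ i ^ 2
      - 2 * t ^ 2 / nsq ξ * (ξ i * H ξ (Pi.single i 1))
      - 2 * t ^ 2 / nsq ξ * (ξ i * H (Pi.single i 1) ξ)
      - 4 * t / nsq ξ * (ξ i * G (Pi.single i 1)) - 2 * t / nsq ξ * G ξ * (1 + b i) := fun i => by
    obtain ⟨e1, e2⟩ := pd_comp_star (L := L) hU h i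
    have e3 := pd_eq_fderiv i (hUd (star L ξ))
    have e4 := pd_pd_eq_fderiv i (hU.contDiffAt (x := star L ξ))
    rw [← htd, ← hG] at e1
    rw [← htd, ← hG, ← hH] at e2
    rw [← hG] at e3
    rw [← hH] at e4
    have hsi : star L ξ i = t * ξ i := by simp [star, htd]
    have e5 : radQ i (fun η => U (star L η)) ξ =
        t ^ 2 * radQ i U (star L ξ) - 2 * t / nsq ξ * G ξ := by
      unfold radQ
      -- The inversion preserves the hyperplane ξ_i = 0, so both values of `radQ` fall in the same
      -- branch.
      by_cases hi : ξ i = 0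
      · rw [if_pos hi, if_pos (by rw [hsi, hi, mul_zero]), e2, e4, hi]
        simp only [mul_zero, zero_div, neg_zero, zero_smul, zero_add, map_smul, smul_eq_mul,
          smul_apply, add_zero]
        ring_nf
      · rw [if_neg hi, if_neg (by rw [hsi]; exact mul_ne_zero ht.ne' hi), e1, e3, hsi]
        simp only [map_add, map_smul, smul_eq_mul]
        field_simp
        ring
    rw [e5, e2, e4]
    simp only [map_add, map_smul, smul_eq_mul, add_apply,
      smul_apply]
    ring
  have s1 : ∑ i, ξ i * H ξ (Pi.single i 1) = H ξ ξ := sum_mul_clm_single (H ξ) ξ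
  have s2 : ∑ i, ξ i * H (Pi.single i 1) ξ = H ξ ξ := sum_mul_clm_single (H.flip ξ) ξ
  have s3 : ∑ i, ξ i * G (Pi.single i 1) = G ξ := sum_mul_clm_single G ξ
  have s4 : ∑ i, ξ i ^ 2 = nsq ξ := rfl
  have s5 : ∑ i, (1 + b i) = hdim b := rfl
  unfold Lop
  rw [Finset.sum_congr rfl fun i _ => key i, Finset.sum_sub_distrib, Finset.sum_sub_distrib,
    Finset.sum_sub_distrib, Finset.sum_sub_distrib, Finset.sum_add_distrib]
  simp only [← Finset.mul_sum]
  rw [s1, s2, s3, s4, s5]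
  field_simp
  ring

/-- In the product rule for `nsq ^ (-p)` times `U ∘ star L`, the first factor is harmonic because 2p
= N − 2, and the gradient cross term cancels the radial term of `Lop_comp_star` for the same reason.
-/
lemma Lop_kelvin {b : ι → ℝ} {p L : ℝ} (hp2 : 2 * p = hdim b - 2) (hL : 0 < L)
    {U : (ι → ℝ) → ℝ} (hU : ContDiff ℝ 2 U) {ξ : ι → ℝ} (h : ξ ≠ 0) :
    Lop b (kelvin p L U) ξ = (L / nsq ξ) ^ (p + 2) * Lop b U (star L ξ) := by
  have hp := nsq_pos h
  have ht : 0 < L / nsq ξ := div_pos hL hp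
  have hcong : kelvin p L U =ᶠ[𝓝 ξ]
      fun η => 0 + L ^ p * (nsq η ^ (-p) * U (star L η)) + 0 := by
    filter_upwards [continuous_nsq.continuousAt.eventually (lt_mem_nhds hp)] with η hη
    rw [kelvin, Real.div_rpow hL.le hη.le, Real.rpow_neg hη.le]
    ring
  have c1 : ContDiffAt ℝ 2 (fun η : ι → ℝ => nsq η ^ (-p)) ξ := contDiffAt_nsq_rpow h _
  have c2 : ContDiffAt ℝ 2 (fun η => U (star L η)) ξ :=
    hU.contDiffAt.comp ξ (contDiffAt_star h)
  have d1 : ∀ i, pd i (fun η : ι → ℝ => nsq η ^ (-p)) ξ =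
      2 * ξ i * (-p * nsq ξ ^ (-p - 1)) := fun i =>
    (pd_radial i (φ := fun t => t ^ (-p)) (φ' := fun t => -p * t ^ (-p - 1))
      (φ'' := -p * ((-p - 1) * nsq ξ ^ (-p - 1 - 1))) (ξ := ξ)
      ((lt_mem_nhds hp).mono fun t ht => Real.hasDerivAt_rpow_const (Or.inl ht.ne'))
      ((Real.hasDerivAt_rpow_const (Or.inl hp.ne')).const_mul _)).1
  have hsum : ∑ i, pd i (fun η : ι → ℝ => nsq η ^ (-p)) ξ * pd i (fun η => U (star L η)) ξ =
      2 * p * nsq ξ ^ (-p - 1) * (L / nsq ξ) * fderiv ℝ U (star L ξ) ξ := by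
    have : ∀ i, pd i (fun η : ι → ℝ => nsq η ^ (-p)) ξ * pd i (fun η => U (star L η)) ξ =
        4 * p * nsq ξ ^ (-p - 1) * (L / nsq ξ) / nsq ξ * fderiv ℝ U (star L ξ) ξ * ξ i ^ 2 -
        2 * p * nsq ξ ^ (-p - 1) * (L / nsq ξ) *
          (ξ i * fderiv ℝ U (star L ξ) (Pi.single i 1)) := fun i => by
      rw [d1, (pd_comp_star hU h i).1]
      simp only [map_add, map_smul, smul_eq_mul]
      ring
    have s3 : ∑ i, ξ i * fderiv ℝ U (star L ξ) (Pi.single i 1) = fderiv ℝ U (star L ξ) ξ :=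
      sum_mul_clm_single _ ξ
    have s4 : ∑ i, ξ i ^ 2 = nsq ξ := rfl
    rw [Finset.sum_congr rfl fun i _ => this i, Finset.sum_sub_distrib, ← Finset.mul_sum,
      ← Finset.mul_sum, s3, s4]
    field_simp
    ring
  rw [Lop_congr b hcong, Lop_lin b contDiffAt_const (c1.mul c2),
    Lop_mul b c1 c2 fun i hi => by rw [d1, hi]; ring, hsum, Lop_nsq_rpow b h,
    Lop_comp_star b hL hU h]
  have hz : Lop b (fun _ => (0 : ℝ)) ξ = 0 := by simp [Lop, radQ, pd]
  have e1 : nsq ξ ^ (-p - 1) = nsq ξ ^ (-p) / nsq ξ := Real.rpow_sub_one hp.ne' _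
  have e2 : (L / nsq ξ) ^ (p + 2) = L ^ p * nsq ξ ^ (-p) * (L / nsq ξ) ^ 2 := by
    rw [Real.rpow_add ht, Real.div_rpow hL.le hp.le, Real.rpow_neg hp.le]
    rw [Real.rpow_two]
    ring
  rw [hz, e1, e2]
  have hN : hdim b = 2 * p + 2 := by linarith
  rw [hN]
  field_simp
  ring

end

/-! ### The Hopf lemma and the strong maximum principle in the orthant. -/

section

variable {ι : Type*} [Fintype ι] [DecidableEq ι]

/-- The closed orthant in the weighted coordinates. -/
def orth (b : ι → ℝ) : Set (ι → ℝ) := {ξ | ∀ i, b i ≠ 0 → 0 ≤ ξ i}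

/-- Evenness in the weighted coordinates. -/
def EvenIn (b : ι → ℝ) (U : (ι → ℝ) → ℝ) : Prop :=
  ∀ i, b i ≠ 0 → ∀ ξ, U (update ξ i (-ξ i)) = U ξ

lemma isClosed_orth (b : ι → ℝ) : IsClosed (orth b) := by
  have : orth b = ⋂ i, ⋂ (_ : b i ≠ 0), {ξ : ι → ℝ | 0 ≤ ξ i} := by
    ext; simp [orth]
  rw [this]
  exact isClosed_iInter fun i => isClosed_iInter fun _ =>
    isClosed_le continuous_const (continuous_apply i)

lemma orth_segment {b : ι → ℝ} {ξ η : ι → ℝ} (hξ : ξ ∈ orth b) (hη : η ∈ orth b) {t : ℝ}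
    (h0 : 0 ≤ t) (h1 : t ≤ 1) : ξ + t • (η - ξ) ∈ orth b := fun i hi => by
  have := hξ i hi; have := hη i hi
  simp only [Pi.add_apply, Pi.smul_apply, Pi.sub_apply, smul_eq_mul]
  nlinarith

/-- Reflecting one coordinate at a time, by induction on the set of coordinates already reflected,
carries any point into the orthant, so that values of U there determine U everywhere. -/
lemma EvenIn.exists_orth {b : ι → ℝ} {U : (ι → ℝ) → ℝ} (h : EvenIn b U) (ξ : ι → ℝ) :
    U (fun i => if b i ≠ 0 then |ξ i| else ξ i) = U ξ := by
  have key : ∀ S : Finset ι, U (fun i => if i ∈ S ∧ b i ≠ 0 then |ξ i| else ξ i) = U ξ := by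
    intro S
    induction S using Finset.induction_on with
    | empty => simp
    | insert a S ha ih =>
      rw [← ih]
      set η : ι → ℝ := fun i => if i ∈ S ∧ b i ≠ 0 then |ξ i| else ξ i with hη
      by_cases hb : b a ≠ 0
      · have hηa : η a = ξ a := by simp [hη, ha]
        by_cases hs : 0 ≤ ξ a
        · congr 1
          ext i
          by_cases hi : i = a
          · subst hi; simp [hη, ha, abs_of_nonneg hs]
          · simp [hη, hi]
        · rw [← h a hb η]
          congr 1
          ext i
          by_cases hi : i = a
          · subst hi; simp [hηa, hb, abs_of_neg (not_le.1 hs)]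
          · simp [hη, hi]
      · congr 1
        ext i
        by_cases hi : i = a
        · subst hi; simp [hη, hb]
        · simp [hη, hi]
  simpa using key Finset.univ

lemma pd_eq_zero_of_even {g : (ι → ℝ) → ℝ} {ξ : ι → ℝ} {i : ι} (hi : ξ i = 0)
    (he : ∀ s : ℝ, g (update ξ i (-s)) = g (update ξ i s)) : pd i g ξ = 0 := by
  have h1 := deriv_comp_neg (fun s : ℝ => g (update ξ i s)) 0
  simp only [he, neg_zero] at h1
  rw [pd, hi]
  linarith

lemma EvenIn.pd_eq_zero {b : ι → ℝ} {U : (ι → ℝ) → ℝ} (h : EvenIn b U) {i : ι} (hb : b i ≠ 0)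
    {ξ : ι → ℝ} (hi : ξ i = 0) : pd i U ξ = 0 :=
  pd_eq_zero_of_even hi fun s => by
    have := h i hb (update ξ i s)
    simpa using this

lemma pd_comp_sub (i : ι) (g : (ι → ℝ) → ℝ) (c ξ : ι → ℝ) :
    pd i (fun η => g (η - c)) ξ = pd i g (ξ - c) := by
  have : ∀ s, update ξ i s - c = update (ξ - c) i (s - c i) := fun s => by
    ext j
    by_cases hj : j = i
    · subst hj; simp
    · simp [hj]
  unfold pd
  simp only [this]
  exact deriv_comp_sub_const (f := fun s => g (update (ξ - c) i s)) (c i) (ξ i)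

lemma pd_pd_comp_sub (i : ι) (g : (ι → ℝ) → ℝ) (c ξ : ι → ℝ) :
    pd i (pd i fun η => g (η - c)) ξ = pd i (pd i g) (ξ - c) := by
  have : (pd i fun η => g (η - c)) = fun η => pd i g (η - c) := by
    ext η; exact pd_comp_sub i g c η
  rw [this, pd_comp_sub]

lemma deriv_nonneg_of_right_min {f : ℝ → ℝ} {f' x : ℝ} (h : HasDerivAt f f' x)
    (hm : ∀ᶠ s in 𝓝[>] x, f x ≤ f s) : 0 ≤ f' := by
  have h1 := (hasDerivWithinAt_iff_tendsto_slope' (s := Ioi x) (by simp)).1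
    (h.hasDerivWithinAt (s := Ioi x))
  refine ge_of_tendsto h1 ?_
  filter_upwards [hm, self_mem_nhdsWithin] with s hs hx
  rw [slope_def_field]
  exact div_nonneg (sub_nonneg.2 hs) (sub_nonneg.2 (le_of_lt hx))

lemma exists_nsq_ball {O : Set (ι → ℝ)} {z : ι → ℝ} (h : O ∈ 𝓝 z) :
    ∃ ε > 0, ∀ ζ, nsq (ζ - z) < ε → ζ ∈ O := by
  obtain ⟨ε, hε, hεO⟩ := Metric.mem_nhds_iff.1 h
  refine ⟨ε ^ 2, by positivity, fun ζ hζ => hεO ?_⟩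
  rw [Metric.mem_ball, dist_pi_lt_iff hε]
  intro i
  have h1 := (sq_le_nsq (ζ - z) i).trans_lt hζ
  rw [Real.dist_eq]
  exact abs_lt_of_sq_lt_sq h1 hε.le

/-- The hypotheses under which the strong maximum principle is applied on `O`. -/
structure SuperOn (b : ι → ℝ) (O : Set (ι → ℝ)) (w : (ι → ℝ) → ℝ) : Prop where
  isOpen : IsOpen O
  smooth : ∀ ξ ∈ O, ContDiffAt ℝ 2 w ξ
  nonneg : ∀ ξ ∈ O, 0 ≤ w ξ
  super : ∀ ξ ∈ O, Lop b w ξ ≤ 0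
  pd_zero : ∀ ξ ∈ O, ∀ i, b i ≠ 0 → ξ i = 0 → pd i w ξ = 0

lemma fderiv_eq_zero_of_zero {b : ι → ℝ} {O : Set (ι → ℝ)} {w : (ι → ℝ) → ℝ}
    (hw : SuperOn b O w) {z : ι → ℝ} (hz : z ∈ O) (h0 : w z = 0) : fderiv ℝ w z = 0 := by
  have : IsLocalMin w z := by
    filter_upwards [hw.isOpen.mem_nhds hz] with η hη
    rw [h0]; exact hw.nonneg η hη
  exact this.fderiv_eq_zero

/-- The usual Hopf exponential stays a strict subsolution for the weighted operator: its singular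
term differs from the unweighted one by 2β E c_i/p_i, which has the favourable sign because c and p
both lie in the open orthant. -/
lemma hopf_barrier {b : ι → ℝ} (hb : ∀ i, 0 ≤ b i) {c : ι → ℝ} (hc : ∀ i, b i ≠ 0 → 0 < c i)
    {r : ℝ} (hr : 0 < r) {p : ι → ℝ} (hp : ∀ i, b i ≠ 0 → 0 < p i)
    (hpr : r / 4 < nsq (p - c)) :
    0 < Lop b (fun η => Real.exp (-((2 * hdim b + 1) / r) * nsq (η - c))) p := by
  set β := (2 * hdim b + 1) / r with hβ
  have hN : 0 ≤ hdim b := Finset.sum_nonneg fun i _ => add_nonneg zero_le_one (hb i)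
  have hβ0 : 0 < β := by positivity
  set E := Real.exp (-β * nsq (p - c)) with hE
  have hE0 : 0 < E := Real.exp_pos _
  have hd : ∀ t, HasDerivAt (fun t => Real.exp (-β * t)) (-β * Real.exp (-β * t)) t := fun t => by
    have := (((hasDerivAt_id t).const_mul (-β))).exp
    simpa [mul_comm] using this
  have hrad := fun i => pd_radial i (φ := fun t => Real.exp (-β * t))
    (φ' := fun t => -β * Real.exp (-β * t)) (φ'' := -β * (-β * E)) (ξ := p - c)
    (Eventually.of_forall hd) ((hd _).const_mul (-β))
  have hterm : ∀ i, E * (4 * β ^ 2 * (p - c) i ^ 2 - 2 * β * (1 + b i)) ≤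
      pd i (pd i fun η => Real.exp (-β * nsq (η - c))) p +
        b i * radQ i (fun η => Real.exp (-β * nsq (η - c))) p := fun i => by
    have e1 := pd_comp_sub i (fun η => Real.exp (-β * nsq η)) c p
    have e2 := pd_pd_comp_sub i (fun η => Real.exp (-β * nsq η)) c p
    rw [(hrad i).1, ← hE] at e1
    rw [(hrad i).2, ← hE] at e2
    rw [e2]
    by_cases hi : b i = 0
    · rw [hi]; apply le_of_eq; ring
    · have hpi := hp i hi
      have hci := hc i hi
      rw [radQ, if_neg hpi.ne', e1, Pi.sub_apply]
      have : 2 * (p i - c i) * (-β * E) / p i = -2 * β * E + 2 * β * E * c i / p i := by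
        field_simp; ring
      rw [this]
      have h2 : 0 ≤ b i * (2 * β * E * c i / p i) := mul_nonneg (hb i) (by positivity)
      nlinarith
  refine lt_of_lt_of_le ?_ (Finset.sum_le_sum fun i _ => hterm i)
  rw [← Finset.mul_sum, Finset.sum_sub_distrib, ← Finset.mul_sum, ← Finset.mul_sum]
  refine mul_pos hE0 ?_
  have s1 : ∑ i, (p - c) i ^ 2 = nsq (p - c) := rfl
  have s2 : ∑ i, (1 + b i) = hdim b := rfl
  rw [s1, s2]
  have h3 : β * r = 2 * hdim b + 1 := by rw [hβ]; field_simp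
  -- As βr = 2N + 1, this yields 4β² |p − c|² > β(2N + 1), which beats the lower order term 2βN.
  have h4 : β * (β * r) < β * (4 * β * nsq (p - c)) :=
    mul_lt_mul_of_pos_left (by nlinarith) hβ0
  rw [h3] at h4
  nlinarith

/-- Hopf's argument, carried out in the part of an annulus inside the orthant, since the barrier has
the right sign only for positive weighted coordinates. At the zero nearest to c the barrier forces a
positive inward slope of w, whereas the gradient of w vanishes at a zero, being an interior minimum.
-/
lemma hopf_interior {b : ι → ℝ} (hb : ∀ i, 0 ≤ b i) {O : Set (ι → ℝ)} {w : (ι → ℝ) → ℝ}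
    (hw : SuperOn b O w) {c z : ι → ℝ} (hc : ∀ i, b i ≠ 0 → 0 < c i) (hwc : 0 < w c)
    (hz : z ∈ orth b) (hwz : w z = 0) (hball : ∀ ξ, nsq (ξ - c) ≤ nsq (z - c) → ξ ∈ O) :
    False := by
  have hdc : Continuous fun ξ : ι → ℝ => nsq (ξ - c) := continuous_nsq.comp (by fun_prop)
  have hcb : ∀ R, IsCompact {ξ : ι → ℝ | nsq (ξ - c) ≤ R} := fun R => by
    have : {ξ : ι → ℝ | nsq (ξ - c) ≤ R} = (fun ξ => ξ + c) '' {ξ | nsq ξ ≤ R} := by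
      ext ξ; constructor
      · intro h; exact ⟨ξ - c, h, by simp⟩
      · rintro ⟨η, h, rfl⟩; simpa using h
    rw [this]
    exact (isCompact_nsq_le R).image (by fun_prop)
  have hcw : ContinuousOn w {ξ : ι → ℝ | nsq (ξ - c) ≤ nsq (z - c)} := fun ξ hξ =>
    (hw.smooth ξ (hball ξ hξ)).continuousAt.continuousWithinAt
  have hZ : IsCompact ({ξ : ι → ℝ | nsq (ξ - c) ≤ nsq (z - c)} ∩ w ⁻¹' {0} ∩ orth b) := by
    refine IsCompact.inter_right ?_ (isClosed_orth b)
    exact (hcb _).of_isClosed_subset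
      (hcw.preimage_isClosed_of_isClosed (isClosed_le hdc continuous_const) isClosed_singleton)
      inter_subset_left
  -- The zero in the orthant nearest to c; w is positive at all closer points of the orthant.
  obtain ⟨y, ⟨⟨hyball, hwy⟩, hyo⟩, hymin⟩ :=
    hZ.exists_isMinOn ⟨z, ⟨le_refl (nsq (z - c)), hwz⟩, hz⟩ hdc.continuousOn
  replace hwy : w y = 0 := hwy
  set r := nsq (y - c) with hr
  have hyO : y ∈ O := hball y hyball
  have hr0 : 0 < r := nsq_pos fun h => by
    rw [sub_eq_zero] at h; rw [h] at hwy; linarith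
  have hpos : ∀ ξ ∈ orth b, nsq (ξ - c) < r → 0 < w ξ := fun ξ ho hξ => by
    have hξz : nsq (ξ - c) ≤ nsq (z - c) := hξ.le.trans hyball
    refine (hw.nonneg ξ (hball ξ hξz)).lt_of_ne fun h => ?_
    have : r ≤ nsq (ξ - c) := hymin ⟨⟨hξz, h.symm⟩, ho⟩
    linarith
  have hI : IsCompact ({ξ : ι → ℝ | nsq (ξ - c) ≤ r / 4} ∩ orth b) :=
    (hcb _).inter_right (isClosed_orth b)
  have hcw' : ContinuousOn w {ξ : ι → ℝ | nsq (ξ - c) ≤ r} :=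
    hcw.mono fun ξ (hξ : nsq (ξ - c) ≤ r) => show nsq (ξ - c) ≤ _ from hξ.trans hyball
  have hco : c ∈ orth b := fun i hi => (hc i hi).le
  obtain ⟨q, ⟨hq1, hq2⟩, hqmin⟩ := hI.exists_isMinOn
    ⟨c, by simp only [mem_ofPred_eq, sub_self, nsq_zero]; positivity, hco⟩
    (hcw'.mono fun ξ hξ => show nsq (ξ - c) ≤ r from
      le_trans (show nsq (ξ - c) ≤ r / 4 from hξ.1) (by linarith))
  set δ := w q with hδ
  have hδ0 : 0 < δ := hpos q hq2 (lt_of_le_of_lt (show nsq (q - c) ≤ r / 4 from hq1) (by linarith))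
  set β := (2 * hdim b + 1) / r with hβ
  have hN : 0 ≤ hdim b := Finset.sum_nonneg fun i _ => add_nonneg zero_le_one (hb i)
  have hβ0 : 0 < β := by positivity
  set E : (ι → ℝ) → ℝ := fun η => Real.exp (-β * nsq (η - c)) with hE
  have hEs : ContDiff ℝ 2 E :=
    (contDiff_const.mul (contDiff_nsq.comp (contDiff_id.sub contDiff_const))).exp
  set g : (ι → ℝ) → ℝ := fun η => w η + (-δ) * E η + δ * Real.exp (-β * r) with hg
  have hgO : ∀ ξ ∈ O, ContDiffAt ℝ 2 g ξ := fun ξ hξ =>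
    ((hw.smooth ξ hξ).add (contDiffAt_const.mul hEs.contDiffAt)).add contDiffAt_const
  set A : Set (ι → ℝ) := {ξ | nsq (ξ - c) ≤ r} ∩ {ξ | r / 4 ≤ nsq (ξ - c)} ∩ orth b with hA
  have hAc : IsCompact A :=
    ((hcb r).inter_right (isClosed_le continuous_const hdc)).inter_right (isClosed_orth b)
  have hAO : ∀ ξ ∈ A, ξ ∈ O := fun ξ hξ => hball ξ (le_trans hξ.1.1 hyball)
  -- A negative minimum of g is excluded on the outer sphere by w ≥ 0, on the inner one by w ≥ δ, on
  -- the faces of the orthant by a slope, and in the interior by the barrier.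
  have hgA : ∀ ξ ∈ A, 0 ≤ g ξ := by
    obtain ⟨p, hpA, hpmin⟩ := hAc.exists_isMinOn ⟨y, ⟨le_refl r, by
      show r / 4 ≤ r; linarith⟩, hyo⟩
      fun ξ hξ => (hgO ξ (hAO ξ hξ)).continuousAt.continuousWithinAt
    suffices 0 ≤ g p from fun ξ hξ => this.trans (hpmin hξ)
    by_contra! hneg
    have hpO := hAO p hpA
    have hp1 : nsq (p - c) < r := by
      refine lt_of_le_of_ne hpA.1.1 fun h => ?_
      have := hw.nonneg p hpO
      simp only [hg, hE, h] at hneg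
      linarith
    have hp2 : r / 4 < nsq (p - c) := by
      refine lt_of_le_of_ne hpA.1.2 fun h => ?_
      have h1 : δ ≤ w p := hqmin ⟨h.symm.le, hpA.2⟩
      have h2 : E p ≤ 1 := Real.exp_le_one_iff.2 (by
        have := nsq_nonneg (p - c)
        nlinarith)
      have h3 : 0 < Real.exp (-β * r) := Real.exp_pos _
      simp only [hg] at hneg
      nlinarith
    have hopen : ∀ᶠ η in 𝓝 p, nsq (η - c) < r ∧ r / 4 < nsq (η - c) :=
      (hdc.continuousAt.eventually (gt_mem_nhds hp1)).and
        (hdc.continuousAt.eventually (lt_mem_nhds hp2))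
    -- On a face ξ_i = 0 the derivative of w vanishes while that of E is 2β c_i E > 0. So g strictly
    -- decreases into the orthant, and p is no minimum.
    have hpp : ∀ i, b i ≠ 0 → 0 < p i := fun i hi => by
      refine (hpA.2 i hi).lt_of_ne fun h => ?_
      have hd := hasDerivAt_pd i ((hgO p hpO).differentiableAt (by simp))
      have hE' : pd i E p = 2 * β * c i * E p := by
        have hdd : ∀ t, HasDerivAt (fun t => Real.exp (-β * t)) (-β * Real.exp (-β * t)) t :=
          fun t => by
            have := (((hasDerivAt_id t).const_mul (-β))).exp
            simpa [mul_comm] using this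
        have e1 := pd_comp_sub i (fun η => Real.exp (-β * nsq η)) c p
        rw [(pd_radial i (φ := fun t => Real.exp (-β * t))
          (φ' := fun t => -β * Real.exp (-β * t)) (ξ := p - c)
          (Eventually.of_forall hdd) ((hdd _).const_mul (-β))).1, Pi.sub_apply, ← h] at e1
        refine Eq.trans e1 ?_
        simp only [hE]; ring
      have hval : pd i g p = -(δ * (2 * β * c i * E p)) := by
        rw [hg, (pd_pd_lin i (hw.smooth p hpO) hEs.contDiffAt _ _).1,
          hw.pd_zero p hpO i hi h.symm, hE']
        ring
      have hge : 0 ≤ pd i g p := by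
        refine deriv_nonneg_of_right_min hd ?_
        have hcont : ContinuousAt (fun s : ℝ => update p i s) (p i) :=
          (contDiff_update (𝕜 := ℝ) 0 p i).continuous.continuousAt
        have hopen' : ∀ᶠ η in 𝓝 (update p i (p i)), nsq (η - c) < r ∧ r / 4 < nsq (η - c) := by
          rwa [update_eq_self]
        filter_upwards [nhdsWithin_le_nhds (hcont.eventually hopen'), self_mem_nhdsWithin]
          with s hs hs0
        rw [update_eq_self]
        refine hpmin ⟨⟨hs.1.le, hs.2.le⟩, fun j hj => ?_⟩
        by_cases hji : j = i
        · subst hji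
          rw [update_self]
          rw [← h] at hs0
          exact le_of_lt hs0
        · rw [update_of_ne hji]; exact hpA.2 j hj
      have : 0 < E p := Real.exp_pos _
      have := hc i hi
      rw [hval] at hge
      have : 0 < δ * (2 * β * c i * E p) := by positivity
      linarith
    have hpos' : ∀ᶠ η in 𝓝 p, ∀ i, b i ≠ 0 → 0 < η i := by
      rw [eventually_all]
      intro i
      by_cases hi : b i = 0
      · simp [hi]
      · filter_upwards [(continuous_apply i).continuousAt.eventually (lt_mem_nhds (hpp i hi))]
          with η hη _ using hη
    have hloc : IsLocalMin g p := by
      filter_upwards [hopen, hpos'] with η h1 h2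
      exact hpmin ⟨⟨h1.1.le, h1.2.le⟩, fun i hi => (h2 i hi).le⟩
    have h1 := Lop_nonneg_of_isLocalMin hb hloc (hgO p hpO).continuousAt
    rw [hg, Lop_lin b (hw.smooth p hpO) hEs.contDiffAt] at h1
    have h2 := hw.super p hpO
    have h3 : 0 < Lop b E p := hopf_barrier hb hc hr0 hpp hp2
    nlinarith
  have hnsq : ∀ t : ℝ, nsq (y + t • (c - y) - c) = (1 - t) ^ 2 * r := fun t => by
    rw [hr, ← nsq_smul]
    congr 1
    ext i
    simp only [Pi.add_apply, Pi.smul_apply, Pi.sub_apply, smul_eq_mul]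
    ring
  have hlin : ∀ t : ℝ, HasDerivAt (fun t : ℝ => y + t • (c - y)) (c - y) t := fun t => by
    simpa using ((hasDerivAt_id t).smul_const (c - y)).const_add y
  have hy0 : y + (0 : ℝ) • (c - y) = y := by simp
  have hwl : HasDerivAt (fun t : ℝ => w (y + t • (c - y))) 0 0 := by
    have h1 : HasFDerivAt w (fderiv ℝ w y) (y + (0 : ℝ) • (c - y)) := by
      rw [hy0]; exact ((hw.smooth y hyO).differentiableAt (by simp)).hasFDerivAt
    have h2 := h1.comp_hasDerivAt 0 (hlin 0)
    rw [fderiv_eq_zero_of_zero hw hyO hwy] at h2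
    exact h2
  have hEl : HasDerivAt (fun t : ℝ => E (y + t • (c - y))) (2 * β * r * Real.exp (-β * r)) 0 := by
    simp only [hE, hnsq]
    have h1 : HasDerivAt (fun t : ℝ => -β * ((1 - t) ^ 2 * r)) (2 * β * r) 0 := by
      have := ((((hasDerivAt_id (0 : ℝ)).const_sub 1).pow 2).mul_const r).const_mul (-β)
      refine this.congr_deriv ?_
      simp; ring
    refine h1.exp.congr_deriv ?_
    simp; ring
  have hgl : HasDerivAt (fun t : ℝ => g (y + t • (c - y)))
      (0 + (-δ) * (2 * β * r * Real.exp (-β * r))) 0 :=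
    (hwl.add (hEl.const_mul (-δ))).add_const _
  have hge := deriv_nonneg_of_right_min hgl (by
    -- For t < 1/2 the squared distance (1 − t)² r to c stays above r/4, so the segment from y
    -- towards c remains in A.
    have : Ioo (0 : ℝ) (1 / 2) ∈ 𝓝[>] (0 : ℝ) := Ioo_mem_nhdsGT (by norm_num)
    filter_upwards [this] with t ht
    have hgy : g (y + (0 : ℝ) • (c - y)) = 0 := by
      rw [hy0]; simp only [hg, hE, hwy, ← hr]; ring
    rw [hgy]
    refine hgA _ ⟨⟨?_, ?_⟩, orth_segment hyo hco ht.1.le (by linarith [ht.2])⟩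
    · show nsq _ ≤ r
      rw [hnsq]
      have h1 := ht.1; have h2 := ht.2
      have : (1 - t) ^ 2 ≤ 1 := by nlinarith
      nlinarith
    · show r / 4 ≤ nsq _
      rw [hnsq]
      have h1 := ht.1; have h2 := ht.2
      have : 1 / 4 ≤ (1 - t) ^ 2 := by nlinarith
      nlinarith)
  have : 0 < δ * (2 * β * r * Real.exp (-β * r)) := by positivity
  linarith

/-- The strong maximum principle along a segment. -/
lemma strong_max_segment {b : ι → ℝ} (hb : ∀ i, 0 ≤ b i) {O : Set (ι → ℝ)} {w : (ι → ℝ) → ℝ}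
    (hw : SuperOn b O w) {ξ η : ι → ℝ} (hξ : ξ ∈ orth b) (hη : η ∈ orth b)
    (hseg : ∀ t : ℝ, 0 ≤ t → t ≤ 1 → ξ + t • (η - ξ) ∈ O) (h0 : w ξ = 0) : w η = 0 := by
  by_contra hne
  set γ : ℝ → ι → ℝ := fun t => ξ + t • (η - ξ) with hγ
  have hγc : Continuous γ := by fun_prop
  have hwγ : ContinuousOn (fun t => w (γ t)) (Icc 0 1) := fun t ht =>
    (ContinuousAt.comp (g := w) (f := γ) (hw.smooth _ (hseg t ht.1 ht.2)).continuousAt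
      hγc.continuousAt).continuousWithinAt
  have hT : IsCompact (Icc (0 : ℝ) 1 ∩ (fun t => w (γ t)) ⁻¹' {0}) :=
    isCompact_Icc.of_isClosed_subset
      (hwγ.preimage_isClosed_of_isClosed isClosed_Icc isClosed_singleton) inter_subset_left
  -- The last zero along the segment; positive values occur arbitrarily close after it.
  obtain ⟨τ, ⟨hτ, hwτ⟩, hmax⟩ := hT.exists_isMaxOn
    ⟨0, by simp, by simp [hγ, h0]⟩ continuousOn_id
  replace hwτ : w (γ τ) = 0 := hwτ
  have hτ1 : τ < 1 := lt_of_le_of_ne hτ.2 fun h => hne (by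
    rw [h] at hwτ; simpa [hγ] using hwτ)
  set z := γ τ with hz
  have hzO : z ∈ O := hseg τ hτ.1 hτ.2
  obtain ⟨ε, hε, hO⟩ := exists_nsq_ball (hw.isOpen.mem_nhds hzO)
  have hd : Continuous fun ζ : ι → ℝ => nsq (ζ - z) := continuous_nsq.comp (by fun_prop)
  have hnb : ∀ᶠ ζ in 𝓝 z, nsq (ζ - z) < ε / 4 :=
    hd.continuousAt.eventually (gt_mem_nhds (by simp only [sub_self, nsq_zero]; positivity))
  have ht : ∀ᶠ t in 𝓝[>] τ, nsq (γ t - z) < ε / 4 ∧ 0 < w (γ t) ∧ t < 1 ∧ τ < t := by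
    have h1 : Ioo τ 1 ∈ 𝓝[>] τ := Ioo_mem_nhdsGT hτ1
    filter_upwards [nhdsWithin_le_nhds (hγc.continuousAt.eventually hnb), h1] with t h2 h3
    have h4 : t ∈ Icc (0 : ℝ) 1 := ⟨hτ.1.trans h3.1.le, h3.2.le⟩
    refine ⟨h2, (hw.nonneg _ (hseg t h4.1 h4.2)).lt_of_ne fun h => ?_, h3.2, h3.1⟩
    have h5 : t ≤ τ := hmax ⟨h4, h.symm⟩
    linarith [h3.1]
  obtain ⟨t, ht1, ht2, ht3, ht4⟩ := ht.exists
  have hto : γ t ∈ orth b := orth_segment hξ hη (hτ.1.trans ht4.le) ht3.le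
  have htO : γ t ∈ O := hseg t (hτ.1.trans ht4.le) ht3.le
  -- The segment may run inside a face; a small push along (1, …, 1) moves the centre into the open
  -- orthant, as `hopf_interior` requires. Distances below ε/4 keep the ball about c through z
  -- inside O by |u + v|² ≤ 2|u|² + 2|v|².
  set c : ℝ → ι → ℝ := fun s => γ t + s • (fun _ => (1 : ℝ)) with hcd
  have hcc : Continuous c := by fun_prop
  have hc0 : c 0 = γ t := by simp [hcd]
  have hev : ∀ᶠ s in 𝓝[>] (0 : ℝ), nsq (c s - z) < ε / 4 ∧ 0 < w (c s) := by
    have hct : ContinuousAt (fun s => w (c s)) 0 := by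
      refine ContinuousAt.comp ?_ hcc.continuousAt
      rw [hc0]; exact (hw.smooth _ htO).continuousAt
    have hct' : ContinuousAt (fun s => nsq (c s - z)) 0 := (hd.comp hcc).continuousAt
    have k1 : nsq (c 0 - z) < ε / 4 := by rwa [hc0]
    have k2 : 0 < w (c 0) := by rwa [hc0]
    exact nhdsWithin_le_nhds ((hct'.eventually (gt_mem_nhds k1)).and
      (hct.eventually (lt_mem_nhds k2)))
  obtain ⟨s, ⟨hs1, hs2⟩, hs0⟩ := (hev.and self_mem_nhdsWithin).exists
  refine hopf_interior hb hw (c := c s) (z := z) (fun i hi => ?_) hs2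
    (orth_segment hξ hη hτ.1 hτ.2) hwτ fun ζ hζ => hO ζ ?_
  · have := hto i hi
    have h2 : (0 : ℝ) < s := hs0
    simp only [hcd, Pi.add_apply, Pi.smul_apply, smul_eq_mul, mul_one]
    linarith
  · have hsym : nsq (z - c s) = nsq (c s - z) := by
      rw [show z - c s = (-1 : ℝ) • (c s - z) by simp, nsq_smul]; ring
    have htri : nsq (ζ - z) ≤ 2 * nsq (ζ - c s) + 2 * nsq (c s - z) := by
      unfold nsq
      rw [Finset.mul_sum, Finset.mul_sum, ← Finset.sum_add_distrib]
      refine Finset.sum_le_sum fun i _ => ?_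
      simp only [Pi.sub_apply]
      nlinarith [sq_nonneg ((ζ i - c s i) - (c s i - z i))]
    rw [hsym] at hζ
    linarith

lemma nsq_add_smul (ξ η : ι → ℝ) (t : ℝ) (h : 0 ≤ ∑ i, ξ i * η i) (h0 : 0 ≤ t) (h1 : t ≤ 1) :
    (1 - t) ^ 2 * nsq ξ + t ^ 2 * nsq η ≤ nsq (ξ + t • (η - ξ)) := by
  have : nsq (ξ + t • (η - ξ)) = (1 - t) ^ 2 * nsq ξ + t ^ 2 * nsq η +
      2 * (t * (1 - t)) * ∑ i, ξ i * η i := by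
    unfold nsq
    rw [Finset.mul_sum, Finset.mul_sum, Finset.mul_sum, ← Finset.sum_add_distrib,
      ← Finset.sum_add_distrib]
    refine Finset.sum_congr rfl fun i _ => ?_
    simp only [Pi.add_apply, Pi.smul_apply, Pi.sub_apply, smul_eq_mul]
    ring
  rw [this]
  have : 0 ≤ t * (1 - t) * ∑ i, ξ i * η i := mul_nonneg (mul_nonneg h0 (by linarith)) h
  linarith

/-- The strong maximum principle in the exterior of a ball. -/
lemma strong_max_exterior {b : ι → ℝ} (hb : ∀ i, 0 ≤ b i) {i₀ : ι} (hi₀ : b i₀ ≠ 0) {L : ℝ}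
    (hL : 0 < L) {w : (ι → ℝ) → ℝ} (hw : SuperOn b {ξ | L < nsq ξ} w) {ξ η : ι → ℝ}
    (hξ : ξ ∈ orth b) (hη : η ∈ orth b) (hξL : L < nsq ξ) (hηL : L < nsq η) (h0 : w ξ = 0) :
    w η = 0 := by
  -- The path ξ, 2ξ, 2|ξ|e, 2|η|e, 2η, η consists of segments that avoid the ball. As e points in a
  -- weighted direction, its inner product with points of the orthant is nonnegative, so a chord
  -- between 2ζ and 2|ζ|e keeps squared distance at least 2|ζ|² from the origin.
  set e : ι → ℝ := Pi.single i₀ 1 with he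
  have hen : nsq e = 1 := by simp [nsq, he, Pi.single_apply]
  have heo : ∀ K : ℝ, 0 ≤ K → K • e ∈ orth b := fun K hK i _ => by
    simp only [he, Pi.smul_apply, smul_eq_mul, Pi.single_apply]
    split_ifs <;> simp [hK]
  have h2o : ∀ ζ ∈ orth b, (2 : ℝ) • ζ ∈ orth b := fun ζ hζ i hi => by
    have := hζ i hi
    simp only [Pi.smul_apply, smul_eq_mul]; linarith
  have hradial : ∀ ζ : ι → ℝ, L < nsq ζ → ∀ t : ℝ, 0 ≤ t → t ≤ 1 →
      L < nsq (ζ + t • ((2 : ℝ) • ζ - ζ)) := fun ζ hζ t h0 h1 => by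
    have : ζ + t • ((2 : ℝ) • ζ - ζ) = (1 + t) • ζ := by
      ext i; simp only [Pi.add_apply, Pi.smul_apply, Pi.sub_apply, smul_eq_mul]; ring
    rw [this, nsq_smul]
    have : 1 ≤ (1 + t) ^ 2 := by nlinarith
    nlinarith
  have hang : ∀ ζ ∈ orth b, L < nsq ζ → ∀ t : ℝ, 0 ≤ t → t ≤ 1 →
      L < nsq ((2 : ℝ) • ζ + t • ((2 * √(nsq ζ)) • e - (2 : ℝ) • ζ)) := fun ζ hζ hζL t h0 h1 => by
    have hn : (0 : ℝ) ≤ nsq ζ := nsq_nonneg ζ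
    have hs := Real.sq_sqrt hn
    refine lt_of_lt_of_le ?_ (nsq_add_smul _ _ t ?_ h0 h1)
    · rw [nsq_smul, nsq_smul, hen, mul_pow, hs]
      nlinarith [sq_nonneg (2 * t - 1)]
    · refine Finset.sum_nonneg fun i _ => ?_
      simp only [he, Pi.smul_apply, smul_eq_mul, Pi.single_apply]
      split_ifs with hi
      · subst hi
        have := hζ i hi₀
        positivity
      · simp
  have hrev : ∀ {ζ θ : ι → ℝ}, (∀ t : ℝ, 0 ≤ t → t ≤ 1 → L < nsq (ζ + t • (θ - ζ))) →
      ∀ t : ℝ, 0 ≤ t → t ≤ 1 → L < nsq (θ + t • (ζ - θ)) := fun {ζ θ} h t h0 h1 => by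
    have := h (1 - t) (by linarith) (by linarith)
    rwa [show ζ + (1 - t) • (θ - ζ) = θ + t • (ζ - θ) by
      ext i; simp only [Pi.add_apply, Pi.smul_apply, Pi.sub_apply, smul_eq_mul]; ring] at this
  have s1 := strong_max_segment hb hw hξ (h2o ξ hξ) (hradial ξ hξL) h0
  have s2 := strong_max_segment hb hw (h2o ξ hξ) (heo (2 * √(nsq ξ)) (by positivity))
    (hang ξ hξ hξL) s1
  have s3 := strong_max_segment hb hw (heo (2 * √(nsq ξ)) (by positivity))
    (heo (2 * √(nsq η)) (by positivity)) (fun t h0 h1 => by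
      have e1 : (2 * √(nsq ξ)) • e + t • ((2 * √(nsq η)) • e - (2 * √(nsq ξ)) • e) =
          (2 * ((1 - t) * √(nsq ξ) + t * √(nsq η))) • e := by
        ext i; simp only [Pi.add_apply, Pi.smul_apply, Pi.sub_apply, smul_eq_mul]; ring
      show L < _
      rw [e1, nsq_smul, hen, mul_one]
      have hl : 0 < √L := Real.sqrt_pos.2 hL
      have a1 := Real.sqrt_lt_sqrt hL.le hξL
      have a2 := Real.sqrt_lt_sqrt hL.le hηL
      have a3 := Real.sq_sqrt hL.le
      have a4 : √L ≤ (1 - t) * √(nsq ξ) + t * √(nsq η) := by nlinarith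
      nlinarith) s2
  have s4 := strong_max_segment hb hw (heo (2 * √(nsq η)) (by positivity)) (h2o η hη)
    (hrev (hang η hη hηL)) s3
  exact strong_max_segment hb hw (h2o η hη) hη (hrev (hradial η hηL)) s4

end

/-! ### Weighted solutions, comparison in annuli and decay. -/

section

variable {ι : Type*} [Fintype ι] [DecidableEq ι]

/-- Nonnegative `C²` solutions, even in the weighted variables, of `L U + U ^ α = 0`. -/
structure WSol (b : ι → ℝ) (α : ℝ) (U : (ι → ℝ) → ℝ) : Prop where
  smooth : ContDiff ℝ 2 U
  even : EvenIn b U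
  nonneg : ∀ ξ, 0 ≤ U ξ
  eq : ∀ ξ, Lop b U ξ = -U ξ ^ α

/-- As −U^α ≤ 0, U is a nonnegative supersolution: one zero spreads over the orthant along segments,
and then by evenness to all points. -/
lemma WSol.eq_zero_or_pos {b : ι → ℝ} (hb : ∀ i, 0 ≤ b i) {α : ℝ} {U : (ι → ℝ) → ℝ}
    (h : WSol b α U) : (∀ ξ, U ξ = 0) ∨ ∀ ξ, 0 < U ξ := by
  by_cases hz : ∃ ξ, U ξ = 0
  · left
    have hs : SuperOn b univ U := ⟨isOpen_univ, fun ξ _ => h.smooth.contDiffAt,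
      fun ξ _ => h.nonneg ξ, fun ξ _ => by
        rw [h.eq, neg_nonpos]; exact Real.rpow_nonneg (h.nonneg ξ) _,
      fun ξ _ i hi h0 => h.even.pd_eq_zero hi h0⟩
    obtain ⟨ξ, hξ⟩ := hz
    intro η
    rw [← h.even.exists_orth] at hξ ⊢
    have ho : ∀ ζ : ι → ℝ, (fun i => if b i ≠ 0 then |ζ i| else ζ i) ∈ orth b :=
      fun ζ i hi => by
        simp only [hi, ne_eq, not_false_eq_true, if_true]; exact abs_nonneg _
    exact strong_max_segment hb hs (ho ξ) (ho η) (fun _ _ _ => mem_univ _) hξ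
  · right
    intro ξ
    exact (h.nonneg ξ).lt_of_ne fun h' => hz ⟨ξ, h'.symm⟩

lemma exists_pos_lower {X : Type*} [TopologicalSpace X] {K : Set X} (hK : IsCompact K)
    {f : X → ℝ} (hf : ContinuousOn f K) (hpos : ∀ x ∈ K, 0 < f x) :
    ∃ m > 0, ∀ x ∈ K, m ≤ f x := by
  rcases K.eq_empty_or_nonempty with rfl | hne
  · exact ⟨1, one_pos, by simp⟩
  · obtain ⟨x, hx, hmin⟩ := hK.exists_isMinOn hne hf
    exact ⟨f x, hpos x hx, fun y hy => hmin hy⟩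

lemma ne_zero_of_nsq {L : ℝ} (hL : 0 < L) {ξ : ι → ℝ} (h : L ≤ nsq ξ) : ξ ≠ 0 := by
  rintro rfl
  rw [nsq_zero] at h
  linarith

/-- An open annulus is a neighbourhood of its points. -/
lemma annulus_mem_nhds {r R : ℝ} {ξ : ι → ℝ} (h1 : r < nsq ξ) (h2 : nsq ξ < R) :
    {ξ : ι → ℝ | r ≤ nsq ξ ∧ nsq ξ ≤ R} ∈ 𝓝 ξ := by
  filter_upwards [continuous_nsq.continuousAt.eventually (lt_mem_nhds h1),
    continuous_nsq.continuousAt.eventually (gt_mem_nhds h2)] with η h1 h2 using ⟨h1.le, h2.le⟩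

/-- Weak maximum principle in an annulus. -/
lemma weak_max_annulus {b : ι → ℝ} (hb : ∀ i, 0 ≤ b i) (hN : 0 < hdim b) {r R : ℝ}
    {g : (ι → ℝ) → ℝ} (hg : ContinuousOn g {ξ | r ≤ nsq ξ ∧ nsq ξ ≤ R})
    (h1 : ∀ ξ, nsq ξ = r → 0 ≤ g ξ) (h2 : ∀ ξ, nsq ξ = R → 0 ≤ g ξ)
    (hC : ∀ ξ, r < nsq ξ → nsq ξ < R → ContDiffAt ℝ 2 g ξ)
    (hL : ∀ ξ, r < nsq ξ → nsq ξ < R → Lop b g ξ ≤ 0) :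
    ∀ ξ, r ≤ nsq ξ → nsq ξ ≤ R → 0 ≤ g ξ := by
  have hin : ∀ ξ : ι → ℝ, ξ ∈ {ξ : ι → ℝ | r ≤ nsq ξ ∧ nsq ξ ≤ R} →
      ξ ∉ {ξ : ι → ℝ | nsq ξ = r ∨ nsq ξ = R} → r < nsq ξ ∧ nsq ξ < R := fun ξ h h' => by
    rw [mem_ofPred_eq, not_or] at h'
    exact ⟨lt_of_le_of_ne h.1 (Ne.symm h'.1), lt_of_le_of_ne h.2 h'.2⟩
  intro ξ hr hR
  refine weak_max hb hN (isCompact_annulus r R) (B := {ξ | nsq ξ = r ∨ nsq ξ = R}) hg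
    (fun ξ h => h.elim (h1 ξ) (h2 ξ)) (fun ξ h h' => ?_) (fun ξ h h' => ?_)
    (fun ξ h h' => ?_) ξ ⟨hr, hR⟩
  · exact annulus_mem_nhds (hin ξ h h').1 (hin ξ h h').2
  · exact hC ξ (hin ξ h h').1 (hin ξ h h').2
  · exact hL ξ (hin ξ h h').1 (hin ξ h h').2

lemma Lop_fundamental {b : ι → ℝ} {p : ℝ} (hp2 : 2 * p = hdim b - 2) {ξ : ι → ℝ} (h : ξ ≠ 0) :
    Lop b (fun η => nsq η ^ (-p)) ξ = 0 := by
  rw [Lop_nsq_rpow b h, show 2 * (-p - 1) + hdim b = 0 by linarith]; ring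

/-- Superharmonic functions in an exterior domain decay at most like the fundamental solution. -/
lemma decay {b : ι → ℝ} (hb : ∀ i, 0 ≤ b i) {p : ℝ} (hp : 0 < p) (hp2 : 2 * p = hdim b - 2)
    {W : (ι → ℝ) → ℝ} {L c : ℝ} (hL : 0 < L) (hc : 0 ≤ c)
    (hs : ∀ ξ, L ≤ nsq ξ → ContDiffAt ℝ 2 W ξ) (hsup : ∀ ξ, L < nsq ξ → Lop b W ξ ≤ 0)
    (hnn : ∀ ξ, L ≤ nsq ξ → 0 ≤ W ξ) (hcW : ∀ ξ, nsq ξ = L → c * nsq ξ ^ (-p) ≤ W ξ) :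
    ∀ ξ, L ≤ nsq ξ → c * nsq ξ ^ (-p) ≤ W ξ := by
  intro ξ hξ
  -- Comparison in an annulus with the fundamental solution lowered by its value on the outer
  -- sphere, so that W ≥ 0 suffices there; then R tends to infinity.
  have key : ∀ R, nsq ξ < R → c * nsq ξ ^ (-p) ≤ W ξ + c * R ^ (-p) := fun R hR => by
    have hC : ∀ η : ι → ℝ, L ≤ nsq η →
        ContDiffAt ℝ 2 (fun η => W η + (-c) * nsq η ^ (-p) + c * R ^ (-p)) η := fun η h1 =>
      ((hs η h1).add (contDiffAt_const.mul (contDiffAt_nsq_rpow (ne_zero_of_nsq hL h1) _))).add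
        contDiffAt_const
    have := weak_max_annulus hb (by linarith) (r := L) (R := R)
      (g := fun η => W η + (-c) * nsq η ^ (-p) + c * R ^ (-p))
      (fun η hη => (hC η hη.1).continuousAt.continuousWithinAt)
      (fun η hη => by
        have h1 := hcW η hη
        have h2 : 0 ≤ c * R ^ (-p) :=
          mul_nonneg hc (Real.rpow_nonneg (by linarith [nsq_nonneg ξ]) _)
        linarith)
      (fun η hη => by
        have h1 := hnn η (by rw [hη]; linarith)
        simp only [hη]
        linarith)
      (fun η h1 _ => hC η h1.le)
      (fun η h1 h2 => by
        rw [Lop_lin b (hs η h1.le) (contDiffAt_nsq_rpow (ne_zero_of_nsq hL h1.le) _),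
          Lop_fundamental hp2 (ne_zero_of_nsq hL h1.le)]
        linarith [hsup η h1]) ξ hξ hR.le
    linarith
  have hlim : Tendsto (fun R : ℝ => W ξ + c * R ^ (-p)) atTop (𝓝 (W ξ + c * 0)) :=
    ((tendsto_rpow_neg_atTop hp).const_mul c).const_add (W ξ)
  rw [mul_zero, add_zero] at hlim
  refine ge_of_tendsto hlim ?_
  filter_upwards [eventually_gt_atTop (nsq ξ)] with R hR using key R hR

lemma nsq_update_neg (ξ : ι → ℝ) (i : ι) : nsq (update ξ i (-ξ i)) = nsq ξ := by
  rw [nsq_update]; ring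

lemma EvenIn.kelvin {b : ι → ℝ} {U : (ι → ℝ) → ℝ} (h : EvenIn b U) (p L : ℝ) :
    EvenIn b (kelvin p L U) := fun i hi ξ => by
  unfold WeightedLaplacian.kelvin
  rw [nsq_update_neg, ← h i hi (star L ξ)]
  congr 2
  unfold star
  rw [nsq_update_neg]
  ext j
  by_cases hj : j = i
  · subst hj; simp
  · simp [hj]

/-! ### The method of moving spheres. -/

section MovingSpheres

variable {b : ι → ℝ} {p α : ℝ} {U : (ι → ℝ) → ℝ}

/-- The difference between a function and its Kelvin transform. -/
noncomputable def kdiff (p L : ℝ) (U : (ι → ℝ) → ℝ) (ξ : ι → ℝ) : ℝ :=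
  U ξ + (-1) * kelvin p L U ξ + 0

lemma contDiffAt_kdiff (hU : ContDiff ℝ 2 U) {L : ℝ} (hL : 0 < L) {ξ : ι → ℝ} (h : ξ ≠ 0) :
    ContDiffAt ℝ 2 (kdiff p L U) ξ :=
  (hU.contDiffAt.add (contDiffAt_const.mul (contDiffAt_kelvin hL hU h))).add contDiffAt_const

lemma kelvin_rpow {L : ℝ} (hL : 0 < L) (hpos : ∀ ξ, 0 < U ξ) {ξ : ι → ℝ} (h : ξ ≠ 0) :
    kelvin p L U ξ ^ α = (L / nsq ξ) ^ (p * α) * U (star L ξ) ^ α := by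
  have ht : 0 < L / nsq ξ := div_pos hL (nsq_pos h)
  rw [kelvin, Real.mul_rpow (Real.rpow_nonneg ht.le _) (hpos _).le, ← Real.rpow_mul ht.le]

lemma Lop_kdiff (hp2 : 2 * p = hdim b - 2) (hU : WSol b α U) {L : ℝ} (hL : 0 < L) {ξ : ι → ℝ}
    (h : ξ ≠ 0) :
    Lop b (kdiff p L U) ξ = -U ξ ^ α + (L / nsq ξ) ^ (p + 2) * U (star L ξ) ^ α := by
  unfold kdiff
  rw [Lop_lin b hU.smooth.contDiffAt (contDiffAt_kelvin hL hU.smooth h),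
    Lop_kelvin hp2 hL hU.smooth h, hU.eq, hU.eq]
  ring

/-- With t = L/|ξ|² ≤ 1, comparison bounds U^α below by t^(pα) U(ξ*)^α, while the Kelvin transform
contributes t^(p+2) U(ξ*)^α. For critical or subcritical α one has t^(p+2) ≤ t^(pα). -/
lemma superOn_kdiff (hp2 : 2 * p = hdim b - 2) (hα : 0 < α)
    (hcrit : p * α ≤ p + 2) (hU : WSol b α U) (hpos : ∀ ξ, 0 < U ξ) {L : ℝ} (hL : 0 < L)
    (hS : ∀ ξ, L ≤ nsq ξ → kelvin p L U ξ ≤ U ξ) : SuperOn b {ξ | L < nsq ξ} (kdiff p L U) where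
  isOpen := isOpen_lt continuous_const continuous_nsq
  smooth ξ hξ := contDiffAt_kdiff hU.smooth hL (ne_zero_of_nsq hL (le_of_lt hξ))
  nonneg ξ hξ := by
    have := hS ξ (le_of_lt hξ)
    unfold kdiff; linarith
  super ξ hξ := by
    have h0 := ne_zero_of_nsq hL (le_of_lt hξ)
    have hq := nsq_pos h0
    have ht : 0 < L / nsq ξ := div_pos hL hq
    have ht1 : L / nsq ξ ≤ 1 := (div_le_one hq).2 (le_of_lt hξ)
    rw [Lop_kdiff hp2 hU hL h0]
    have hk0 : 0 ≤ kelvin p L U ξ := mul_nonneg (Real.rpow_nonneg ht.le _) (hpos _).le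
    have h1 : kelvin p L U ξ ^ α ≤ U ξ ^ α := Real.rpow_le_rpow hk0 (hS ξ (le_of_lt hξ)) hα.le
    rw [kelvin_rpow hL hpos h0] at h1
    have h2 : (L / nsq ξ) ^ (p + 2) ≤ (L / nsq ξ) ^ (p * α) :=
      Real.rpow_le_rpow_of_exponent_ge ht ht1 hcrit
    have h3 := mul_le_mul_of_nonneg_right h2 (Real.rpow_nonneg (hpos (star L ξ)).le α)
    linarith
  pd_zero ξ _ i hi h0 := by
    have he : EvenIn b (kdiff p L U) := fun i hi ξ => by
      unfold kdiff; rw [hU.even i hi, hU.even.kelvin p L i hi]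
    exact he.pd_eq_zero hi h0

/-- `p U + ξ · ∇U`. -/
noncomputable def euler (p : ℝ) (U : (ι → ℝ) → ℝ) (ξ : ι → ℝ) : ℝ := p * U ξ + fderiv ℝ U ξ ξ

lemma continuous_euler (hU : ContDiff ℝ 2 U) : Continuous (euler p U) := by
  have := hU.continuous
  have h2 := hU.continuous_fderiv (by simp)
  unfold euler
  fun_prop

lemma hasDerivAt_ray (hU : ContDiff ℝ 2 U) (ξ : ι → ℝ) (s : ℝ) :
    HasDerivAt (fun s : ℝ => U (s • ξ)) (fderiv ℝ U (s • ξ) ξ) s := by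
  have h1 : HasFDerivAt U (fderiv ℝ U (s • ξ)) (s • ξ) :=
    (hU.differentiable (by simp) _).hasFDerivAt
  have h2 : HasDerivAt (fun s : ℝ => s • ξ) ξ s := by
    simpa using (hasDerivAt_id s).smul_const ξ
  exact h1.comp_hasDerivAt s h2

/-- The derivative of s^p U(sξ) is s^(p−1) `euler p U (s • ξ)`. For s₀ = L/|ξ|² the left side is the
Kelvin transform at ξ, so positivity of `euler` between ξ and its inverse point gives the
comparison. -/
lemma ray_mono (hU : ContDiff ℝ 2 U) {ξ : ι → ℝ} {s₀ : ℝ} (h0 : 0 < s₀) (h1 : s₀ ≤ 1)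
    (hE : ∀ s, s₀ ≤ s → s ≤ 1 → 0 < euler p U (s • ξ)) : s₀ ^ p * U (s₀ • ξ) ≤ U ξ := by
  have hd : ∀ s, 0 < s → HasDerivAt (fun s : ℝ => s ^ p * U (s • ξ))
      (s ^ (p - 1) * euler p U (s • ξ)) s := fun s hs => by
    refine ((Real.hasDerivAt_rpow_const (Or.inl hs.ne')).mul
      (hasDerivAt_ray hU ξ s)).congr_deriv ?_
    have : s ^ p = s ^ (p - 1) * s := by rw [Real.rpow_sub_one hs.ne']; field_simp
    simp only [euler, map_smul, smul_eq_mul]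
    rw [this]; ring
  have hm : MonotoneOn (fun s : ℝ => s ^ p * U (s • ξ)) (Icc s₀ 1) := by
    refine monotoneOn_of_deriv_nonneg (convex_Icc _ _)
      (fun s hs => (hd s (h0.trans_le hs.1)).continuousAt.continuousWithinAt)
      (fun s hs => ?_) fun s hs => ?_
    · rw [interior_Icc] at hs
      exact (hd s (h0.trans hs.1)).differentiableAt.differentiableWithinAt
    · rw [interior_Icc] at hs
      rw [(hd s (h0.trans hs.1)).deriv]
      exact mul_nonneg (Real.rpow_nonneg (h0.trans hs.1).le _) (hE s hs.1.le hs.2.le).le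
  have := hm (left_mem_Icc.2 h1) (right_mem_Icc.2 h1) h1
  simpa using this

lemma exists_lower_bound (hb : ∀ i, 0 ≤ b i) (hp : 0 < p) (hp2 : 2 * p = hdim b - 2)
    (hU : WSol b α U) (hpos : ∀ ξ, 0 < U ξ) {ε : ℝ} (hε : 0 < ε) :
    ∃ m > 0, (∀ ξ, nsq ξ ≤ ε → m ≤ U ξ) ∧ ∀ ξ, ε ≤ nsq ξ → m * ε ^ p * nsq ξ ^ (-p) ≤ U ξ := by
  obtain ⟨m, hm, hmU⟩ := exists_pos_lower (isCompact_nsq_le (ι := ι) ε)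
    hU.smooth.continuous.continuousOn fun ξ _ => hpos ξ
  refine ⟨m, hm, hmU, decay hb hp hp2 hε (by positivity) (fun ξ _ => hU.smooth.contDiffAt)
    (fun ξ _ => ?_) (fun ξ _ => (hpos ξ).le) fun ξ hξ => ?_⟩
  · rw [hU.eq, neg_nonpos]; exact Real.rpow_nonneg (hpos ξ).le _
  · have := hmU ξ (le_of_eq hξ)
    rw [hξ, Real.rpow_neg hε.le, mul_assoc, mul_inv_cancel₀ (by positivity)]
    linarith

/-- Near the origin `euler` is close to pU(0) > 0 and `ray_mono` applies. Farther out U decays no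
faster than the fundamental solution, while the Kelvin transform is at most a small multiple of it.
-/
lemma moving_start (hb : ∀ i, 0 ≤ b i) (hp : 0 < p) (hp2 : 2 * p = hdim b - 2)
    (hU : WSol b α U) (hpos : ∀ ξ, 0 < U ξ) :
    ∃ L₀ > 0, ∀ L, 0 < L → L ≤ L₀ → ∀ ξ, L ≤ nsq ξ → kelvin p L U ξ ≤ U ξ := by
  have hE0 : 0 < euler p U 0 := by
    simp only [euler, map_zero, add_zero]
    exact mul_pos hp (hpos 0)
  obtain ⟨ε, hε, hεE⟩ := exists_nsq_ball
    ((continuous_euler (p := p) hU.smooth).continuousAt.eventually (lt_mem_nhds hE0))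
  simp only [sub_zero] at hεE
  obtain ⟨m, hm, hmU, hdec⟩ := exists_lower_bound hb hp hp2 hU hpos hε
  obtain ⟨M', hM'⟩ := ((isCompact_nsq_le (ι := ι) ε).image hU.smooth.continuous).bddAbove
  have hM : ∀ ξ, nsq ξ ≤ ε → U ξ ≤ M' := fun ξ hξ => hM' ⟨ξ, hξ, rfl⟩
  have hmM : m ≤ M' := (hmU 0 (by rw [nsq_zero]; exact hε.le)).trans
    (hM 0 (by rw [nsq_zero]; exact hε.le))
  have hM0 : 0 < M' := hm.trans_le hmM
  have hr1 : m / M' ≤ 1 := (div_le_one hM0).2 hmM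
  have hr0 : 0 < m / M' := div_pos hm hM0
  -- Chosen so that L^p M' ≤ m ε^p, which compares the coefficients of `nsq ξ ^ (-p)` in the two far
  -- field bounds.
  refine ⟨ε * (m / M') ^ (1 / p), by positivity, fun L hL hLε ξ hξ => ?_⟩
  have hξ0 := ne_zero_of_nsq hL hξ
  have hq := nsq_pos hξ0
  have hLε' : L ≤ ε := hLε.trans (mul_le_of_le_one_right hε.le
    (Real.rpow_le_one hr0.le hr1 (by positivity)))
  by_cases hlt : nsq ξ < ε
  · refine ray_mono hU.smooth (div_pos hL hq) ((div_le_one hq).2 hξ) fun s hs hs1 =>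
      hεE (s • ξ) ?_
    rw [nsq_smul]
    have h0 : 0 < s := (div_pos hL hq).trans_le hs
    have : s ^ 2 ≤ 1 := by nlinarith
    nlinarith
  · push Not at hlt
    refine le_trans ?_ (hdec ξ hlt)
    have h1 : U (star L ξ) ≤ M' := hM _ (by
      rw [nsq_star hξ0, div_le_iff₀ hq]
      nlinarith)
    have h2 : L ^ p * M' ≤ m * ε ^ p := by
      have h3 : L ^ p ≤ (ε * (m / M') ^ (1 / p)) ^ p := Real.rpow_le_rpow hL.le hLε hp.le
      rw [Real.mul_rpow hε.le (by positivity), ← Real.rpow_mul hr0.le,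
        one_div_mul_cancel hp.ne', Real.rpow_one] at h3
      calc L ^ p * M' ≤ ε ^ p * (m / M') * M' := by gcongr
        _ = m * ε ^ p := by field_simp
    unfold kelvin
    rw [Real.div_rpow hL.le hq.le, Real.rpow_neg hq.le]
    calc L ^ p / nsq ξ ^ p * U (star L ξ) ≤ L ^ p / nsq ξ ^ p * M' := by gcongr
      _ = (L ^ p * M') * (nsq ξ ^ p)⁻¹ := by ring
      _ ≤ _ := by gcongr

/-- The Hopf lemma on the sphere of inversion. -/
lemma euler_pos_of_sphere (hb : ∀ i, 0 ≤ b i) (hp : 0 < p) (hp2 : 2 * p = hdim b - 2)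
    (hU : WSol b α U) {L : ℝ} (hL : 0 < L) (hs : SuperOn b {ξ | L < nsq ξ} (kdiff p L U))
    (hwpos : ∀ ξ, L < nsq ξ → 0 < kdiff p L U ξ) {ξ : ι → ℝ} (hξ : nsq ξ = L) :
    0 < euler p U ξ := by
  have hC : ∀ η : ι → ℝ, L ≤ nsq η → ContDiffAt ℝ 2 (kdiff p L U) η := fun η h =>
    contDiffAt_kdiff hU.smooth hL (ne_zero_of_nsq hL h)
  have hkey0 : ∀ η : ι → ℝ, nsq η = L → kdiff p L U η = 0 := fun η h => by
    simp [kdiff, kelvin, star, h, hL.ne']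
  obtain ⟨m, hm, hmw⟩ := exists_pos_lower (isCompact_annulus (ι := ι) (4 * L) (4 * L))
    (f := kdiff p L U)
    (fun η hη => (hC η (by linarith [hη.1])).continuousAt.continuousWithinAt)
    (fun η hη => hwpos η (by linarith [hη.1]))
  set ε := m * L ^ p with hε
  have hLp : 0 < L ^ p := Real.rpow_pos_of_pos hL p
  have hε0 : 0 < ε := by positivity
  have hLp' : L ^ (-p) = (L ^ p)⁻¹ := Real.rpow_neg hL.le p
  -- This is the difference minus m(1 − (L/|η|²)^p): zero on the sphere of inversion, nonnegative on
  -- the sphere of squared radius 4L, and superharmonic between them.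
  set g : (ι → ℝ) → ℝ := fun η => kdiff p L U η + ε * nsq η ^ (-p) + (-m) with hg
  have hgC : ∀ η : ι → ℝ, L ≤ nsq η → ContDiffAt ℝ 2 g η := fun η h =>
    ((hC η h).add (contDiffAt_const.mul
      (contDiffAt_nsq_rpow (ne_zero_of_nsq hL h) _))).add contDiffAt_const
  have hεL : ε * L ^ (-p) = m := by rw [hε, hLp']; field_simp
  have hg0 : ∀ η : ι → ℝ, nsq η = L → g η = 0 := fun η h => by
    simp only [hg, hkey0 η h, h, hεL]; ring
  have hgpos := weak_max_annulus hb (by linarith) (r := L) (R := 4 * L) (g := g)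
    (fun η hη => (hgC η hη.1).continuousAt.continuousWithinAt)
    (fun η hη => (hg0 η hη).ge)
    (fun η hη => by
      have h1 := hmw η ⟨hη.ge, hη.le⟩
      have h2 : 0 ≤ ε * nsq η ^ (-p) := mul_nonneg hε0.le (Real.rpow_nonneg (nsq_nonneg η) _)
      simp only [hg]; linarith)
    (fun η h1 _ => hgC η h1.le)
    (fun η h1 _ => by
      have h0 := ne_zero_of_nsq hL h1.le
      rw [hg, Lop_lin b (hC η h1.le) (contDiffAt_nsq_rpow h0 _), Lop_fundamental hp2 h0]
      linarith [hs.super η h1])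
  have hray : (fun s : ℝ => g (s • ξ)) =ᶠ[𝓝 1] fun s =>
      U (s • ξ) - s ^ (-2 * p) * U (s⁻¹ • ξ) + m * s ^ (-2 * p) - m := by
    filter_upwards [lt_mem_nhds (zero_lt_one (α := ℝ))] with s hs0
    have e1 : L / nsq (s • ξ) = s ^ (-2 : ℝ) := by
      rw [nsq_smul, hξ, Real.rpow_neg hs0.le, Real.rpow_two]
      field_simp
    have e2 : star L (s • ξ) = s⁻¹ • ξ := by
      rw [star, nsq_smul, hξ, smul_smul]
      congr 1
      field_simp
    have e3 : nsq (s • ξ) ^ (-p) = L ^ (-p) * s ^ (-2 * p) := by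
      rw [nsq_smul, hξ, Real.mul_rpow (by positivity) hL.le, ← Real.rpow_natCast,
        ← Real.rpow_mul hs0.le]
      push_cast
      rw [show (2 : ℝ) * -p = -2 * p by ring]; ring
    simp only [hg, kdiff, kelvin, e1, e2, e3]
    rw [← Real.rpow_mul hs0.le, ← mul_assoc ε, hεL]
    ring
  -- Along the ray the difference is U(sξ) − s^(−2p) U(ξ/s), with slope 2 `euler` at s = 1. A
  -- nonnegative slope of g then gives `euler p U ξ` ≥ pm > 0.
  have hderiv : HasDerivAt (fun s : ℝ => g (s • ξ)) (2 * euler p U ξ - 2 * p * m) 1 := by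
    refine HasDerivAt.congr_of_eventuallyEq ?_ hray
    have d1 := hasDerivAt_ray hU.smooth ξ 1
    have d2 : HasDerivAt (fun s : ℝ => s ^ (-2 * p)) (-2 * p) 1 := by
      simpa using Real.hasDerivAt_rpow_const (x := 1) (p := -2 * p) (Or.inl one_ne_zero)
    have d3 : HasDerivAt (fun s : ℝ => U (s⁻¹ • ξ)) (-fderiv ℝ U ξ ξ) 1 := by
      have h1 : HasDerivAt (fun s : ℝ => U (s • ξ)) (fderiv ℝ U ξ ξ) ((1 : ℝ)⁻¹) := by
        simpa using hasDerivAt_ray hU.smooth ξ ((1 : ℝ)⁻¹)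
      have h2 := h1.comp (1 : ℝ) (hasDerivAt_inv one_ne_zero)
      refine h2.congr_deriv ?_
      simp
    refine (((d1.sub (d2.mul d3)).add (d2.const_mul m)).sub_const m).congr_deriv ?_
    simp [euler]
    ring
  have hge := deriv_nonneg_of_right_min hderiv (by
    have : Ioo (1 : ℝ) 2 ∈ 𝓝[>] (1 : ℝ) := Ioo_mem_nhdsGT (by norm_num)
    filter_upwards [this] with s hs
    rw [one_smul, hg0 ξ hξ]
    have h1 := hs.1; have h2 := hs.2
    have h3 : 1 ≤ s ^ 2 := by nlinarith
    have h4 : s ^ 2 ≤ 4 := by nlinarith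
    refine hgpos _ ?_ ?_ <;> rw [nsq_smul, hξ] <;> nlinarith)
  have : 0 < 2 * p * m := by positivity
  linarith

lemma kelvin_eq {L : ℝ} (hL : 0 < L) {ξ : ι → ℝ} (h : ξ ≠ 0) :
    kelvin p L U ξ = nsq ξ ^ (-p) * (L ^ p * U (L • ((nsq ξ)⁻¹ • ξ))) := by
  have hq := nsq_pos h
  rw [kelvin, star, Real.div_rpow hL.le hq.le, Real.rpow_neg hq.le, smul_smul,
    div_eq_mul_inv, div_eq_mul_inv]
  ring

/-- A strict inequality outside the sphere leaves room to enlarge it. Near the sphere `euler` is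
positive by the Hopf lemma and `ray_mono` applies. Beyond a shell the difference is at least
c|ξ|^(−2p), and changing L to M alters the transform by less: by `kelvin_eq` it is |ξ|^(−2p) times a
function of M and ξ/|ξ|², the latter ranging over a compact set. -/
lemma moving_extend (hb : ∀ i, 0 ≤ b i) (hp : 0 < p) (hp2 : 2 * p = hdim b - 2)
    (hU : WSol b α U) {L : ℝ} (hL : 0 < L)
    (hs : SuperOn b {ξ | L < nsq ξ} (kdiff p L U))
    (hwpos : ∀ ξ, L < nsq ξ → 0 < kdiff p L U ξ) :
    ∃ L₁ > L, ∀ M, L ≤ M → M ≤ L₁ → ∀ ξ, M ≤ nsq ξ → kelvin p M U ξ ≤ U ξ := by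
  have hEc := continuous_euler (p := p) hU.smooth
  have hK : IsCompact ({ξ : ι → ℝ | L / 4 ≤ nsq ξ ∧ nsq ξ ≤ 4 * L} ∩ {ξ | euler p U ξ ≤ 0}) :=
    (isCompact_annulus _ _).inter_right (isClosed_le hEc continuous_const)
  obtain ⟨δ₀, hδ₀, hδE⟩ := exists_pos_lower hK (f := fun ξ => |nsq ξ - L|)
    (continuous_nsq.sub continuous_const).abs.continuousOn (fun ξ hξ => by
      refine abs_pos.2 (sub_ne_zero.2 fun h => ?_)
      have h1 := euler_pos_of_sphere hb hp hp2 hU hL hs hwpos h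
      have h2 : euler p U ξ ≤ 0 := hξ.2
      linarith)
  -- δ₀ separates the compact set where `euler` ≤ 0 from the sphere; the bound L/2 keeps the shell
  -- inside the annulus in which that set was taken.
  set δ := min δ₀ (L / 2) with hδ
  have hδ0 : 0 < δ := lt_min hδ₀ (by linarith)
  have hδL : δ ≤ L / 2 := min_le_right _ _
  have hE : ∀ ξ : ι → ℝ, L - δ < nsq ξ → nsq ξ < L + δ → 0 < euler p U ξ := fun ξ h1 h2 => by
    by_contra! hneg
    have h3 : δ₀ ≤ |nsq ξ - L| := hδE ξ ⟨⟨by linarith, by linarith⟩, hneg⟩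
    have h4 : |nsq ξ - L| < δ := abs_lt.2 ⟨by linarith, by linarith⟩
    linarith [min_le_left δ₀ (L / 2)]
  set L₂ := L + δ / 2 with hL₂
  have hL₂0 : 0 < L₂ := by linarith
  obtain ⟨m, hm, hmw⟩ := exists_pos_lower (isCompact_annulus (ι := ι) L₂ L₂)
    (f := kdiff p L U)
    (fun η hη => (contDiffAt_kdiff hU.smooth hL
      (ne_zero_of_nsq hL₂0 hη.1)).continuousAt.continuousWithinAt)
    (fun η hη => hwpos η (by linarith [hη.1]))
  have hLp : 0 < L₂ ^ p := Real.rpow_pos_of_pos hL₂0 p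
  set c := m * L₂ ^ p with hc
  have hc0 : 0 < c := by positivity
  have hdec := decay hb hp hp2 (W := kdiff p L U) hL₂0 hc0.le
    (fun η hη => contDiffAt_kdiff hU.smooth hL (ne_zero_of_nsq hL₂0 hη))
    (fun η hη => hs.super η (show L < nsq η by linarith))
    (fun η hη => (hwpos η (by linarith)).le)
    (fun η hη => by
      have := hmw η ⟨hη.ge, hη.le⟩
      rw [hη, hc, Real.rpow_neg hL₂0.le, mul_assoc, mul_inv_cancel₀ hLp.ne', mul_one]
      exact this)
  have hΦ : ∀ᶠ M in 𝓝 L, ∀ η ∈ {η : ι → ℝ | nsq η ≤ 1 / L},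
      M ^ p * U (M • η) - L ^ p * U (L • η) < c := by
    refine (isCompact_nsq_le (ι := ι) (1 / L)).eventually_forall_of_forall_eventually
      (x₀ := L) (P := fun M η => M ^ p * U (M • η) - L ^ p * U (L • η) < c) fun η _ => ?_
    have hcont : ContinuousAt (fun z : ℝ × (ι → ℝ) =>
        z.1 ^ p * U (z.1 • z.2) - L ^ p * U (L • z.2)) (L, η) := by
      have hUc := hU.smooth.continuous
      refine ContinuousAt.sub (ContinuousAt.mul ?_ ?_) ?_
      · exact ContinuousAt.rpow_const (f := fun z : ℝ × (ι → ℝ) => z.1) continuousAt_fst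
          (Or.inr hp.le)
      · exact (hUc.comp (g := U) (f := fun z : ℝ × (ι → ℝ) => z.1 • z.2)
          (continuous_fst.smul continuous_snd)).continuousAt
      · exact (continuous_const.mul
          (hUc.comp (g := U) (f := fun z : ℝ × (ι → ℝ) => L • z.2)
            (by fun_prop))).continuousAt
    exact hcont.eventually (gt_mem_nhds (by simpa using hc0))
  obtain ⟨ε, hε, hεΦ⟩ := Metric.eventually_nhds_iff.1 hΦ
  refine ⟨L + min (ε / 2) (δ / 2), by
    have : 0 < min (ε / 2) (δ / 2) := lt_min (by linarith) (by linarith)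
    linarith, fun M hLM hM ξ hξ => ?_⟩
  have hM1 : M ≤ L + ε / 2 := hM.trans (by linarith [min_le_left (ε / 2) (δ / 2)])
  have hM0 : 0 < M := hL.trans_le hLM
  have hξ0 := ne_zero_of_nsq hM0 hξ
  have hq := nsq_pos hξ0
  by_cases hlt : nsq ξ < L₂
  · refine ray_mono hU.smooth (div_pos hM0 hq) ((div_le_one hq).2 hξ) fun s hs hs1 =>
      hE _ ?_ ?_ <;> rw [nsq_smul]
    · have h1 : M ^ 2 / nsq ξ ≤ s ^ 2 * nsq ξ := by
        have h5 : M ≤ s * nsq ξ := (div_le_iff₀ hq).1 hs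
        rw [div_le_iff₀ hq]
        nlinarith
      refine lt_of_lt_of_le ?_ h1
      rw [lt_div_iff₀ hq]
      have h6 : L ^ 2 ≤ M ^ 2 := by nlinarith
      have h7 : (L - δ) * nsq ξ ≤ (L - δ) * L₂ := mul_le_mul_of_nonneg_left hlt.le (by linarith)
      have h8 : (L - δ) * L₂ < L ^ 2 := by rw [hL₂]; nlinarith
      linarith
    · have h0 : 0 < s := (div_pos hM0 hq).trans_le hs
      have h1 : s ^ 2 ≤ 1 := by nlinarith
      nlinarith
  · push Not at hlt
    have h1 := hdec ξ hlt
    have h2 := hεΦ (y := M) (by rw [Real.dist_eq, abs_of_nonneg (by linarith)]; linarith)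
      ((nsq ξ)⁻¹ • ξ) (by
        show nsq _ ≤ _
        rw [nsq_smul]
        have : (nsq ξ)⁻¹ ^ 2 * nsq ξ = 1 / nsq ξ := by field_simp
        rw [this]
        exact one_div_le_one_div_of_le hL (by linarith))
    have h3 : 0 < nsq ξ ^ (-p) := Real.rpow_pos_of_pos hq _
    rw [kdiff, kelvin_eq hL hξ0] at h1
    rw [kelvin_eq hM0 hξ0]
    nlinarith

/-- The method of moving spheres, centred at the origin. -/
theorem moving_spheres (hb : ∀ i, 0 ≤ b i) {i₀ : ι} (hi₀ : b i₀ ≠ 0) (hp : 0 < p)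
    (hp2 : 2 * p = hdim b - 2) (hα : 0 < α) (hcrit : p * α ≤ p + 2) (hU : WSol b α U)
    (hpos : ∀ ξ, 0 < U ξ) :
    (∀ L, 0 < L → ∀ ξ, L ≤ nsq ξ → kelvin p L U ξ ≤ U ξ) ∨
    (p * α = p + 2 ∧ ∃ L, 0 < L ∧ ∀ ξ, ξ ≠ 0 → U ξ = kelvin p L U ξ) := by
  by_contra! hcon
  obtain ⟨⟨L₁, hL₁, ξ₁, hξ₁, hlt₁⟩, hne⟩ := hcon
  obtain ⟨L₀, hL₀, hstart⟩ := moving_start hb hp hp2 hU hpos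
  -- All smaller spheres are included, so that the comparison holds below sup A and, by continuity,
  -- at sup A itself.
  set A : Set ℝ := {L | 0 < L ∧ ∀ M, 0 < M → M ≤ L → ∀ ξ, M ≤ nsq ξ → kelvin p M U ξ ≤ U ξ}
    with hA
  have hA0 : L₀ ∈ A := ⟨hL₀, hstart⟩
  have hAb : BddAbove A := ⟨L₁, fun L hL => by
    by_contra! h
    exact absurd (hL.2 L₁ hL₁ h.le ξ₁ hξ₁) (not_le.2 hlt₁)⟩
  set L := sSup A with hLd
  have hL : 0 < L := hL₀.trans_le (le_csSup hAb hA0)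
  have hbelow : ∀ M, 0 < M → M < L → ∀ ξ, M ≤ nsq ξ → kelvin p M U ξ ≤ U ξ :=
    fun M hM hML => by
      obtain ⟨L', hL', hlt⟩ := exists_lt_of_lt_csSup ⟨L₀, hA0⟩ hML
      exact hL'.2 M hM hlt.le
  have hSL : ∀ ξ, L ≤ nsq ξ → kelvin p L U ξ ≤ U ξ := fun ξ hξ => by
    have hq := nsq_pos (ne_zero_of_nsq hL hξ)
    have hcont : ContinuousAt (fun M : ℝ => kelvin p M U ξ) L := by
      have hUc := hU.smooth.continuous
      unfold kelvin star
      refine ContinuousAt.mul ?_ ?_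
      · exact (continuousAt_id.div_const _).rpow_const (Or.inr hp.le)
      · exact (hUc.comp ((continuous_id.div_const _).smul continuous_const)).continuousAt
    refine le_of_tendsto (hcont.tendsto.mono_left (nhdsWithin_le_nhds (s := Iio L))) ?_
    filter_upwards [Ioo_mem_nhdsLT hL] with M hM
    exact hbelow M hM.1 hM.2 ξ (hM.2.le.trans hξ)
  have hs := superOn_kdiff hp2 hα hcrit hU hpos hL hSL
  have hev : EvenIn b (kdiff p L U) := fun i hi ξ => by
    unfold kdiff; rw [hU.even i hi, hU.even.kelvin p L i hi]
  have hko : ∀ ξ : ι → ℝ, ∃ η ∈ orth b, nsq η = nsq ξ ∧ kdiff p L U η = kdiff p L U ξ :=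
    fun ξ => ⟨_, fun i hi => by
      simp only [hi, ne_eq, not_false_eq_true, if_true]; exact abs_nonneg _, by
      unfold nsq
      refine Finset.sum_congr rfl fun i _ => ?_
      beta_reduce
      split_ifs <;> simp, hev.exists_orth ξ⟩
  by_cases hz : ∃ ξ, L < nsq ξ ∧ kdiff p L U ξ = 0
  · obtain ⟨ξ, hξL, hξ0⟩ := hz
    obtain ⟨ξ', hξo, hξn, hξk⟩ := hko ξ
    -- The strong maximum principle works in the orthant; `hko` moves arbitrary points there without
    -- changing `nsq` or `kdiff`.
    have hzero : ∀ η, L < nsq η → kdiff p L U η = 0 := fun η hη => by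
      obtain ⟨η', hηo, hηn, hηk⟩ := hko η
      rw [← hηk]
      exact strong_max_exterior hb hi₀ hL hs hξo hηo (by rwa [hξn]) (by rwa [hηn])
        (by rw [hξk, hξ0])
    have heq : ∀ η, L < nsq η → U η = kelvin p L U η := fun η hη => by
      have := hzero η hη
      unfold kdiff at this; linarith
    -- Applying `Lop` to the vanishing difference gives t^(pα) = t^(p+2) with 0 < t < 1, hence
    -- equality of the exponents.
    have hcr : p * α = p + 2 := by
      have h0 := ne_zero_of_nsq hL hξL.le
      have hq := nsq_pos h0
      have hloc : kdiff p L U =ᶠ[𝓝 ξ] fun _ => 0 := by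
        filter_upwards [continuous_nsq.continuousAt.eventually (lt_mem_nhds hξL)] with η hη
          using hzero η hη
      have h1 := Lop_kdiff hp2 hU hL h0
      rw [Lop_congr b hloc] at h1
      have hz0 : Lop b (fun _ : ι → ℝ => (0 : ℝ)) ξ = 0 := by simp [Lop, radQ, pd]
      rw [hz0, heq ξ hξL, kelvin_rpow hL hpos h0] at h1
      have hU0 : 0 < U (star L ξ) ^ α := Real.rpow_pos_of_pos (hpos _) _
      have h2 : (L / nsq ξ) ^ (p * α) = (L / nsq ξ) ^ (p + 2) := by
        have : ((L / nsq ξ) ^ (p * α) - (L / nsq ξ) ^ (p + 2)) * U (star L ξ) ^ α = 0 := by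
          linarith
        rcases mul_eq_zero.1 this with h | h
        · linarith
        · exact absurd h hU0.ne'
      have ht : 0 < L / nsq ξ := div_pos hL hq
      have ht1 : L / nsq ξ < 1 := (div_lt_one hq).2 hξL
      by_contra hne'
      have := Real.rpow_lt_rpow_of_exponent_gt ht ht1 (lt_of_le_of_ne hcrit hne')
      linarith
    obtain ⟨η, hη0, hηne⟩ := hne hcr L hL
    refine hηne ?_
    have hq := nsq_pos hη0
    rcases lt_trichotomy L (nsq η) with h | h | h
    · exact heq η h
    · simp [kelvin, star, ← h, hL.ne']
    -- Inside the sphere the identity is transported from the inverse point, the inversion being an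
    -- involution.
    · have hst : L < nsq (star L η) := by
        rw [nsq_star hη0, lt_div_iff₀ hq]
        nlinarith
      have h1 := heq _ hst
      have hss : star L (star L η) = η := by
        have : nsq (star L η) = L ^ 2 / nsq η := nsq_star hη0
        rw [star, this]
        unfold star
        rw [smul_smul]
        have : L / (L ^ 2 / nsq η) * (L / nsq η) = 1 := by field_simp
        rw [this, one_smul]
      have ht : 0 < L / nsq η := div_pos hL hq
      have hinv : L / nsq (star L η) = (L / nsq η)⁻¹ := by
        rw [nsq_star hη0]; field_simp
      have h2 : kelvin p L U (star L η) = ((L / nsq η) ^ p)⁻¹ * U η := by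
        rw [kelvin, hss, hinv, Real.inv_rpow ht.le]
      rw [kelvin, h1, h2]
      have := (Real.rpow_pos_of_pos ht p).ne'
      field_simp
  · push Not at hz
    have hwpos : ∀ ξ, L < nsq ξ → 0 < kdiff p L U ξ := fun ξ hξ =>
      (hs.nonneg ξ hξ).lt_of_ne (Ne.symm (hz ξ hξ))
    obtain ⟨L', hL', hext⟩ := moving_extend hb hp hp2 hU hL hs hwpos
    have hmem : L' ∈ A := ⟨hL.trans hL', fun M hM hML ξ hξ => by
      rcases lt_or_ge M L with h | h
      · exact hbelow M hM h ξ hξ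
      · exact hext M h hML ξ hξ⟩
    exact absurd (le_csSup hAb hmem) (not_le.2 hL')

end MovingSpheres

end

/-! ### The subcritical Liouville theorem and inversion symmetry at the critical exponent. -/

section

variable {ι : Type*} [Fintype ι] [DecidableEq ι] {b : ι → ℝ} {p α : ℝ} {U : (ι → ℝ) → ℝ}

/-- An a priori bound for the minimum over balls of a positive solution. -/
lemma exists_min_bound (hb : ∀ i, 0 ≤ b i) (hp : 0 < p) (hp2 : 2 * p = hdim b - 2) (hα : 1 < α)
    (hU : WSol b α U) (hpos : ∀ ξ, 0 < U ξ) {Q : ℝ} (hQ : 0 < Q) :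
    ∃ ξ, nsq ξ ≤ Q ∧ U ξ ^ (α - 1) * Q * (3 / (8 * hdim b) * (4 ^ p)⁻¹) ≤ 1 := by
  have hN : 0 < hdim b := by linarith
  obtain ⟨ξ, hξ, hmin⟩ := (isCompact_nsq_le (ι := ι) Q).exists_isMinOn
    ⟨0, by show nsq 0 ≤ Q; rw [nsq_zero]; exact hQ.le⟩ hU.smooth.continuous.continuousOn
  set μ := U ξ with hμ
  have hμ0 : 0 < μ := hpos ξ
  have hmin' : ∀ η, nsq η ≤ Q → μ ≤ U η := fun η hη => hmin hη
  have hμα : 0 < μ ^ α := Real.rpow_pos_of_pos hμ0 _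
  -- In the ball LU ≤ −μ^α, so U dominates the torsion function μ^α (Q − |η|²)/(2N).
  have hball : ∀ η ∈ {η : ι → ℝ | nsq η ≤ Q},
      0 ≤ U η + μ ^ α / (2 * hdim b) * nsq η + (-(μ ^ α / (2 * hdim b) * Q)) := by
    refine weak_max hb hN (isCompact_nsq_le Q) (B := {η | nsq η = Q}) ?_ ?_ ?_ ?_ ?_
    · exact ((hU.smooth.continuous.add (continuous_const.mul continuous_nsq)).add
        continuous_const).continuousOn
    · intro η hη
      rw [show nsq η = Q from hη]
      linarith [hpos η]
    · intro η hη hη'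
      have hlt : nsq η < Q := lt_of_le_of_ne hη hη'
      filter_upwards [continuous_nsq.continuousAt.eventually (gt_mem_nhds hlt)] with ζ hζ
        using le_of_lt hζ
    · intro η _ _
      exact (hU.smooth.contDiffAt.add
        (contDiffAt_const.mul contDiff_nsq.contDiffAt)).add contDiffAt_const
    · intro η hη _
      rw [Lop_lin b hU.smooth.contDiffAt contDiff_nsq.contDiffAt, Lop_nsq, hU.eq]
      have h1 : μ ^ α ≤ U η ^ α := Real.rpow_le_rpow hμ0.le (hmin' η hη) (by linarith)
      have h2 : μ ^ α / (2 * hdim b) * (2 * hdim b) = μ ^ α := by field_simp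
      rw [h2]; linarith
  -- The value of that torsion function at |η|² = Q/4.
  set m := μ ^ α * (3 / (8 * hdim b)) * Q with hm
  have hm0 : 0 < m := by positivity
  have hinner : ∀ η, nsq η ≤ Q / 4 → m ≤ U η := fun η hη => by
    have h1 := hball η (show nsq η ≤ Q by linarith)
    have h2 : μ ^ α / (2 * hdim b) * nsq η ≤ μ ^ α / (2 * hdim b) * (Q / 4) := by gcongr
    have h3 : μ ^ α / (2 * hdim b) * Q - μ ^ α / (2 * hdim b) * (Q / 4) = m := by
      rw [hm]; field_simp; ring
    linarith
  have hQ4 : 0 < Q / 4 := by linarith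
  have hdec := decay hb hp hp2 (W := U) (L := Q / 4) (c := m * (Q / 4) ^ p) hQ4 (by positivity)
    (fun η _ => hU.smooth.contDiffAt)
    (fun η _ => by rw [hU.eq, neg_nonpos]; exact Real.rpow_nonneg (hpos η).le _)
    (fun η _ => (hpos η).le)
    (fun η hη => by
      have := hinner η hη.le
      have hq : 0 < (Q / 4) ^ p := Real.rpow_pos_of_pos hQ4 _
      rw [hη, Real.rpow_neg hQ4.le, mul_assoc, mul_inv_cancel₀ hq.ne', mul_one]
      exact this)
  have h4 : (0 : ℝ) < 4 ^ p := by positivity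
  -- Decay from squared radius Q/4 out to Q costs a factor of at most 4^p, so the minimum is bounded
  -- below by its own power μ^α times a multiple of Q; dividing by μ gives the bound.
  have hfin : m * (4 ^ p)⁻¹ ≤ μ := by
    rcases le_total (nsq ξ) (Q / 4) with h | h
    · have h1 : ((4 : ℝ) ^ p)⁻¹ ≤ 1 := inv_le_one_of_one_le₀
        (Real.one_le_rpow (by norm_num) hp.le)
      have := hinner ξ h
      nlinarith
    · have h1 := hdec ξ h
      have h2 : Q ^ (-p) ≤ nsq ξ ^ (-p) :=
        Real.rpow_le_rpow_of_nonpos (hQ4.trans_le h) hξ (by linarith)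
      have h3 : (Q / 4) ^ p * Q ^ (-p) = (4 ^ p)⁻¹ := by
        rw [Real.div_rpow hQ.le (by norm_num), Real.rpow_neg hQ.le]
        have : 0 < Q ^ p := Real.rpow_pos_of_pos hQ _
        field_simp
      calc m * (4 ^ p)⁻¹ = m * (Q / 4) ^ p * Q ^ (-p) := by rw [← h3]; ring
        _ ≤ m * (Q / 4) ^ p * nsq ξ ^ (-p) := by gcongr
        _ ≤ μ := h1
  refine ⟨ξ, hξ, ?_⟩
  have h5 : μ ^ α = μ ^ (α - 1) * μ := by
    rw [Real.rpow_sub_one hμ0.ne']; field_simp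
  have h6 : μ * (μ ^ (α - 1) * Q * (3 / (8 * hdim b) * (4 ^ p)⁻¹)) ≤ μ * 1 := by
    calc μ * (μ ^ (α - 1) * Q * (3 / (8 * hdim b) * (4 ^ p)⁻¹)) = m * (4 ^ p)⁻¹ := by
          rw [hm, h5]; ring
      _ ≤ μ * 1 := by linarith
  exact le_of_mul_le_mul_left h6 hμ0

/-- A positive solution with the full moving sphere inequality is critical or supercritical. -/
lemma not_subcritical_of_moving (hb : ∀ i, 0 ≤ b i) (hp : 0 < p) (hp2 : 2 * p = hdim b - 2)
    (hα : 1 < α) (hcrit : p * α < p + 2) (hU : WSol b α U) (hpos : ∀ ξ, 0 < U ξ)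
    (hS : ∀ L, 0 < L → ∀ ξ, L ≤ nsq ξ → kelvin p L U ξ ≤ U ξ) : False := by
  obtain ⟨m, hm, hmU⟩ := exists_pos_lower (isCompact_nsq_le (ι := ι) 1)
    hU.smooth.continuous.continuousOn fun ξ _ => hpos ξ
  have hlow : ∀ Q : ℝ, 1 ≤ Q → ∀ ξ, nsq ξ ≤ Q → m * Q ^ (-(p / 2)) ≤ U ξ := fun Q hQ ξ hξ => by
    have hQ0 : 0 < Q := by linarith
    rcases le_total (nsq ξ) 1 with h | h
    · have h1 := hmU ξ h
      have h2 : Q ^ (-(p / 2)) ≤ 1 := Real.rpow_le_one_of_one_le_of_nonpos hQ (by linarith)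
      nlinarith
    · have hq : 0 < nsq ξ := by linarith
      have hξ0 := ne_zero_of_nsq one_pos h
      have hs : √(nsq ξ) ≤ nsq ξ := by
        rw [Real.sqrt_le_left hq.le]; nlinarith
      -- The sphere that sends ξ to the unit sphere, where U ≥ m; the Kelvin factor is then
      -- |ξ|^(−p).
      have h1 := hS (√(nsq ξ)) (Real.sqrt_pos.2 hq) ξ hs
      have h2 : m ≤ U (star (√(nsq ξ)) ξ) := hmU _ (by
        show nsq _ ≤ 1
        rw [nsq_star hξ0, Real.sq_sqrt hq.le, div_self hq.ne'])
      have h3 : (√(nsq ξ) / nsq ξ) ^ p = nsq ξ ^ (-(p / 2)) := by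
        rw [Real.sqrt_div_self', one_div, Real.inv_rpow (Real.sqrt_nonneg _), Real.sqrt_eq_rpow,
          ← Real.rpow_mul hq.le, Real.rpow_neg hq.le]
        congr 2; ring
      have h4 : Q ^ (-(p / 2)) ≤ nsq ξ ^ (-(p / 2)) :=
        Real.rpow_le_rpow_of_nonpos hq hξ (by linarith)
      rw [kelvin, h3] at h1
      have h5 : 0 < Q ^ (-(p / 2)) := Real.rpow_pos_of_pos hQ0 _
      calc m * Q ^ (-(p / 2)) = Q ^ (-(p / 2)) * m := mul_comm _ _
        _ ≤ nsq ξ ^ (-(p / 2)) * U (star (√(nsq ξ)) ξ) := by gcongr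
        _ ≤ U ξ := h1
  have hN : 0 < hdim b := by linarith
  set κ := 3 / (8 * hdim b) * ((4 : ℝ) ^ p)⁻¹ with hκ
  have hκ0 : 0 < κ := by positivity
  -- Positive exactly because pα < p + 2; the bound of order Q^e by 1 fails for large Q.
  set e := 1 - p / 2 * (α - 1) with he
  have he0 : 0 < e := by nlinarith
  have hbound : ∀ Q : ℝ, 1 ≤ Q → m ^ (α - 1) * κ * Q ^ e ≤ 1 := fun Q hQ => by
    have hQ0 : 0 < Q := by linarith
    obtain ⟨ξ, hξ, hle⟩ := exists_min_bound hb hp hp2 hα hU hpos hQ0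
    refine le_trans ?_ hle
    have h1 : (m * Q ^ (-(p / 2))) ^ (α - 1) ≤ U ξ ^ (α - 1) :=
      Real.rpow_le_rpow (by positivity) (hlow Q hQ ξ hξ) (by linarith)
    rw [Real.mul_rpow hm.le (by positivity), ← Real.rpow_mul hQ0.le] at h1
    have h2 : Q ^ e = Q ^ (-(p / 2) * (α - 1)) * Q := by
      rw [← Real.rpow_add_one hQ0.ne']; congr 1; rw [he]; ring
    rw [h2]
    calc m ^ (α - 1) * κ * (Q ^ (-(p / 2) * (α - 1)) * Q)
        = (m ^ (α - 1) * Q ^ (-(p / 2) * (α - 1))) * Q * κ := by ring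
      _ ≤ U ξ ^ (α - 1) * Q * κ := by gcongr
  have hlim := (tendsto_rpow_atTop he0).const_mul_atTop
    (show 0 < m ^ (α - 1) * κ by positivity)
  obtain ⟨Q, hQ1, hQ2⟩ := ((hlim.eventually_gt_atTop 1).and (eventually_ge_atTop 1)).exists
  linarith [hbound Q hQ2]

/-- The Liouville theorem for the weighted Laplacian with subcritical exponent. -/
theorem liouville_subcritical (hb : ∀ i, 0 ≤ b i) {i₀ : ι} (hi₀ : b i₀ ≠ 0) (hp : 0 < p)
    (hp2 : 2 * p = hdim b - 2) (hα : 1 < α) (hcrit : p * α < p + 2) (hU : WSol b α U) :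
    ∀ ξ, U ξ = 0 := by
  rcases hU.eq_zero_or_pos hb with h | hpos
  · exact h
  · exfalso
    rcases moving_spheres hb hi₀ hp hp2 (by linarith) hcrit.le hU hpos with h | ⟨h, _⟩
    · exact not_subcritical_of_moving hb hp hp2 hα hcrit hU hpos h
    · linarith

lemma WSol.translate (hU : WSol b α U) {c : ι → ℝ} (hc : ∀ i, b i ≠ 0 → c i = 0) :
    WSol b α fun ξ => U (ξ - c) where
  smooth := hU.smooth.comp (contDiff_id.sub contDiff_const)
  even i hi ξ := by
    beta_reduce
    rw [← hU.even i hi (ξ - c)]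
    congr 1
    ext j
    by_cases hj : j = i
    · subst hj; simp [hc j hi]
    · simp [hj]
  nonneg ξ := hU.nonneg _
  eq ξ := by
    rw [← hU.eq]
    refine Finset.sum_congr rfl fun i _ => ?_
    by_cases hi : b i = 0
    · rw [pd_pd_comp_sub, hi]; ring
    · unfold radQ
      rw [pd_pd_comp_sub, pd_comp_sub, Pi.sub_apply, hc i hi, sub_zero]

/-- Extension by zero from the weighted coordinates. -/
def weightedExt (b : ι → ℝ) [DecidablePred fun i => b i ≠ 0] (r : {i // b i ≠ 0} → ℝ) : ι → ℝ :=
  fun i => if h : b i ≠ 0 then r ⟨i, h⟩ else 0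

lemma weightedExt_apply [DecidablePred fun i => b i ≠ 0] (r : {i // b i ≠ 0} → ℝ)
    (i : {i // b i ≠ 0}) : weightedExt b r i.1 = r i := dif_pos i.2

lemma weightedExt_update [DecidablePred fun i => b i ≠ 0] (r : {i // b i ≠ 0} → ℝ)
    (i : {i // b i ≠ 0}) (s : ℝ) :
    weightedExt b (update r i s) = update (weightedExt b r) i.1 s := by
  ext j
  unfold weightedExt
  by_cases hj : b j ≠ 0
  · by_cases hji : j = i.1
    · subst hji; rw [dif_pos hj]; simp
    · rw [update_of_ne hji, dif_pos hj, dif_pos hj, update_of_ne]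
      exact fun h => hji (congrArg Subtype.val h)
  · have hji : j ≠ i.1 := fun h => hj (h ▸ i.2)
    rw [update_of_ne hji, dif_neg hj, dif_neg hj]

/-- A solution independent of the unweighted variables restricts to a solution in the weighted
variables. -/
lemma WSol.restrict [DecidablePred fun i => b i ≠ 0] (hU : WSol b α U)
    (hind : ∀ v : ι → ℝ, (∀ i, b i ≠ 0 → v i = 0) → ∀ ξ, U (ξ + v) = U ξ) :
    WSol (fun i : {i // b i ≠ 0} => b i) α fun r => U (weightedExt b r) := by
  have hpd : ∀ (g : (ι → ℝ) → ℝ) (i : {i // b i ≠ 0}),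
      (pd i fun r => g (weightedExt b r)) = fun r => pd i.1 g (weightedExt b r) := fun g i => by
    ext r
    unfold pd
    simp only [weightedExt_update]
    congr 1
    simp [weightedExt, i.2]
  refine ⟨hU.smooth.comp ?_, fun i hi r => ?_, fun r => hU.nonneg _, fun r => ?_⟩
  · rw [contDiff_pi]
    intro i
    unfold weightedExt
    by_cases h : b i ≠ 0
    · simp only [h, ne_eq, not_false_eq_true, dite_true]; fun_prop
    · simp only [h, dite_false]; fun_prop
  · rw [weightedExt_update, ← hU.even i.1 hi (weightedExt b r)]
    congr 2
    simp [weightedExt, i.2]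
  · rw [← hU.eq]
    have hzero : ∀ i, ¬ b i ≠ 0 → pd i (pd i U) (weightedExt b r) +
        b i * radQ i U (weightedExt b r) = 0 := fun i hi => by
      have h0 : pd i (pd i U) (weightedExt b r) = 0 := by
        rw [pd_pd]
        have : (fun s : ℝ => U (update (weightedExt b r) i s)) = fun _ => U (weightedExt b r) := by
          ext s
          rw [update_line]
          refine hind _ (fun j hj => ?_) _
          have : j ≠ i := fun h => hi (h ▸ hj)
          simp [this]
        rw [this]; simp
      push Not at hi
      rw [h0, hi]; ring
    unfold Lop
    rw [← Fintype.sum_subtype_add_sum_subtype (fun i => b i ≠ 0)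
      (fun i => pd i (pd i U) (weightedExt b r) + b i * radQ i U (weightedExt b r)),
      Finset.sum_eq_zero (s := (Finset.univ : Finset {i // ¬ b i ≠ 0}))
        fun i _ => hzero i.1 i.2, add_zero]
    refine Finset.sum_congr rfl fun i _ => ?_
    unfold radQ
    simp only [hpd]
    rw [weightedExt_apply]

/-- At the critical exponent a positive solution is symmetric under some inversion. -/
theorem exists_inversion_symmetry (hb : ∀ i, b i = 0 ∨ 1 < b i) {i₀ j₀ : ι} (hi₀ : b i₀ ≠ 0)
    (hj₀ : b j₀ = 0) (hp : 0 < p) (hp2 : 2 * p = hdim b - 2) (hcrit : p * α = p + 2)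
    (hU : WSol b α U) (hpos : ∀ ξ, 0 < U ξ) :
    ∃ c : ι → ℝ, (∀ i, b i ≠ 0 → c i = 0) ∧ ∃ L > 0, ∀ ξ, ξ ≠ 0 →
      U (ξ - c) = kelvin p L (fun ξ => U (ξ - c)) ξ := by
  have hb0 : ∀ i, 0 ≤ b i := fun i => (hb i).elim (fun h => h.ge) (fun h => by linarith)
  have hα : 1 < α := by
    by_contra! h
    nlinarith
  by_contra! hcon
  have hall : ∀ c : ι → ℝ, (∀ i, b i ≠ 0 → c i = 0) → ∀ L, 0 < L → ∀ ξ, L ≤ nsq ξ →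
      kelvin p L (fun ξ => U (ξ - c)) ξ ≤ U (ξ - c) := fun c hc => by
    rcases moving_spheres hb0 hi₀ hp hp2 (by linarith) hcrit.le (hU.translate hc)
      (fun ξ => hpos _) with h | ⟨_, L, hL, h⟩
    · exact h
    · obtain ⟨ξ, hξ, hne⟩ := hcon c hc L hL
      exact absurd (h ξ hξ) hne
  have hle : ∀ v : ι → ℝ, (∀ i, b i ≠ 0 → v i = 0) → ∀ ξ, U (ξ + v) ≤ U ξ := fun v hv ξ => by
    set x : ι → ℝ := fun i => if b i = 0 then ξ i else 0 with hx
    have key : ∀ s : ℝ, 0 < s → s < 1 → s ^ p * U (s • ξ + (1 - s) • x + v) ≤ U ξ :=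
      fun s hs hs1 => by
        have h1s : 1 - s ≠ 0 := by linarith
        -- In the original coordinates the centre is −c. The sphere through squared radius s|ξ + c|²
        -- sends ξ to sξ + (1 − s)x + v. As s tends to 1 the centre recedes to infinity in direction
        -- v, and the comparison becomes U(ξ + v) ≤ U(ξ).
        set c : ι → ℝ := -(x + (1 - s)⁻¹ • v) with hc
        have hcw : ∀ i, b i ≠ 0 → c i = 0 := fun i hi => by simp [hc, hx, hi, hv i hi]
        have hζ : s • (ξ + c) - c = s • ξ + (1 - s) • x + v := by
          ext i
          simp only [hc, Pi.add_apply, Pi.sub_apply, Pi.smul_apply, Pi.neg_apply, smul_eq_mul]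
          field_simp
          ring
        by_cases h0 : ξ + c = 0
        · have h2 : s • ξ + (1 - s) • x + v = ξ := by
            rw [← hζ, h0, smul_zero, zero_sub]
            exact (eq_neg_of_add_eq_zero_left h0).symm
          rw [h2]
          have := Real.rpow_le_one hs.le hs1.le hp.le
          nlinarith [hpos ξ]
        · have hq := nsq_pos h0
          have h2 := hall c hcw (s * nsq (ξ + c)) (mul_pos hs hq) (ξ + c) (by nlinarith)
          rw [kelvin, star, mul_div_cancel_right₀ _ hq.ne', hζ, add_sub_cancel_right] at h2
          exact h2
    have hcont : ContinuousAt (fun s : ℝ => s ^ p * U (s • ξ + (1 - s) • x + v)) 1 := by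
      have hUc := hU.smooth.continuous
      refine ContinuousAt.mul (continuousAt_id.rpow_const (Or.inr hp.le)) ?_
      exact (hUc.comp (g := U) (f := fun s : ℝ => s • ξ + (1 - s) • x + v)
        (by fun_prop)).continuousAt
    have hlim := hcont.tendsto.mono_left (nhdsWithin_le_nhds (s := Iio 1))
    simp only [Real.one_rpow, one_smul, sub_self, zero_smul, add_zero, one_mul] at hlim
    refine le_of_tendsto hlim ?_
    filter_upwards [Ioo_mem_nhdsLT (zero_lt_one (α := ℝ))] with s hs using key s hs.1 hs.2
  have hind : ∀ v : ι → ℝ, (∀ i, b i ≠ 0 → v i = 0) → ∀ ξ, U (ξ + v) = U ξ := fun v hv ξ => by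
    refine le_antisymm (hle v hv ξ) ?_
    have := hle (-v) (fun i hi => by simp [hv i hi]) (ξ + v)
    simpa using this
  classical
  have hsol := hU.restrict hind
  set b' : {i // b i ≠ 0} → ℝ := fun i => b i with hb'
  have hb1 : ∀ i, 0 ≤ b' i := fun i => hb0 i
  -- Dropping the unweighted variables leaves a homogeneous dimension above 2, since one weight
  -- exceeds 1, but strictly below N, since an unweighted variable is lost. So the same α is
  -- subcritical for the restricted solution.
  have hdim2 : 2 < hdim b' := by
    have h1 : 1 < b i₀ := (hb i₀).resolve_left hi₀
    have h2 : 1 + b' ⟨i₀, hi₀⟩ ≤ hdim b' := Finset.single_le_sum (f := fun i => 1 + b' i)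
      (fun i _ => add_nonneg zero_le_one (hb1 i)) (Finset.mem_univ _)
    simp only [hb'] at h2
    linarith
  have hdimlt : hdim b' < hdim b := by
    have h1 := Fintype.sum_subtype_add_sum_subtype (fun i => b i ≠ 0) (fun i => 1 + b i)
    have h2 : 1 + b j₀ ≤ ∑ i : {i // ¬ b i ≠ 0}, (1 + b i) :=
      Finset.single_le_sum (f := fun i : {i // ¬ b i ≠ 0} => 1 + b i)
        (fun i _ => add_nonneg zero_le_one (hb0 i)) (Finset.mem_univ ⟨j₀, by simp [hj₀]⟩)
    have h3 : hdim b' = ∑ i : {i // b i ≠ 0}, (1 + b i) := rfl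
    have h4 : hdim b = ∑ i, (1 + b i) := rfl
    rw [h3, h4, ← h1]
    linarith
  have hzero := liouville_subcritical (p := (hdim b' - 2) / 2) hb1 (i₀ := ⟨i₀, hi₀⟩) hi₀
    (by linarith) (by ring) hα (by nlinarith) hsol 0
  exact (hpos _).ne' hzero

end

/-! ### Integration by parts and the weak symmetry of third derivatives. -/

section

variable {ι : Type*} [Fintype ι] [DecidableEq ι]

lemma pd_eq_zero_of_notMem_tsupport (i : ι) {g : (ι → ℝ) → ℝ} {ξ : ι → ℝ}
    (h : ξ ∉ tsupport g) : pd i g ξ = 0 := by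
  have h1 : g =ᶠ[𝓝 ξ] fun _ => 0 := notMem_tsupport_iff_eventuallyEq.1 h
  have hc : ContinuousAt (fun s : ℝ => update ξ i s) (ξ i) :=
    (contDiff_update (𝕜 := ℝ) 0 ξ i).continuous.continuousAt
  have h2 : ∀ᶠ η in 𝓝 (update ξ i (ξ i)), g η = 0 := by
    rw [update_eq_self]; exact h1
  have h3 : (fun s : ℝ => g (update ξ i s)) =ᶠ[𝓝 (ξ i)] fun _ => (0 : ℝ) := hc.eventually h2
  rw [pd, h3.deriv_eq, deriv_const]

lemma continuous_pd (i : ι) {g : (ι → ℝ) → ℝ} (hg : ContDiff ℝ 1 g) : Continuous (pd i g) :=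
  (contDiff_pd (m := 0) i hg (by norm_num)).continuous

lemma hasCompactSupport_pd (i : ι) {g : (ι → ℝ) → ℝ} (hs : HasCompactSupport g) :
    HasCompactSupport (pd i g) :=
  HasCompactSupport.intro hs fun _ h => pd_eq_zero_of_notMem_tsupport i h

lemma integral_pd_eq_zero (i : ι) {h : (ι → ℝ) → ℝ} (hc : ContDiff ℝ 1 h)
    (hs : HasCompactSupport h) : ∫ ξ, pd i h ξ = 0 := by
  have hd := hc.differentiable (by simp)
  have hpd : ∀ ξ, pd i h ξ = fderiv ℝ h ξ (Pi.single i 1) := fun ξ => pd_eq_fderiv i (hd ξ)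
  have hint : Integrable (pd i h) :=
    (continuous_pd i hc).integrable_of_hasCompactSupport (hasCompactSupport_pd i hs)
  have key := integral_mul_fderiv_eq_neg_fderiv_mul_of_integrable (μ := volume) (𝕜 := ℝ)
    (f := fun _ : ι → ℝ => (1 : ℝ)) (g := h) (v := Pi.single i 1) (by simp)
    (by simpa [← hpd] using hint)
    (by simpa using hc.continuous.integrable_of_hasCompactSupport hs)
    (fun _ _ => differentiableAt_const _) (fun ξ _ => hd ξ)
  simp only [← hpd] at key
  simpa using key

/-- Products with a compactly supported function are smooth if the other factor is smooth near
the support. -/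
lemma contDiff_mul_of_tsupport {φ k : (ι → ℝ) → ℝ} {n : WithTop ℕ∞} (hφ : ContDiff ℝ n φ)
    (hk : ∀ ξ ∈ tsupport φ, ContDiffAt ℝ n k ξ) : ContDiff ℝ n fun ξ => φ ξ * k ξ := by
  rw [contDiff_iff_contDiffAt]
  intro ξ
  by_cases h : ξ ∈ tsupport φ
  · exact hφ.contDiffAt.mul (hk ξ h)
  · have h1 : (fun ξ => φ ξ * k ξ) =ᶠ[𝓝 ξ] fun _ => 0 := by
      filter_upwards [notMem_tsupport_iff_eventuallyEq.1 h] with η hη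
      rw [hη]; simp
    exact contDiffAt_const.congr_of_eventuallyEq h1

lemma continuous_mul_of_tsupport {φ k : (ι → ℝ) → ℝ} (hφ : Continuous φ)
    (hk : ∀ ξ ∈ tsupport φ, ContinuousAt k ξ) : Continuous fun ξ => φ ξ * k ξ := by
  rw [continuous_iff_continuousAt]
  intro ξ
  by_cases h : ξ ∈ tsupport φ
  · exact hφ.continuousAt.mul (hk ξ h)
  · have h1 : (fun ξ => φ ξ * k ξ) =ᶠ[𝓝 ξ] fun _ => 0 := by
      filter_upwards [notMem_tsupport_iff_eventuallyEq.1 h] with η hη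
      rw [hη]; simp
    exact continuousAt_const.congr h1.symm

lemma tsupport_mul_subset {φ k : (ι → ℝ) → ℝ} : tsupport (fun ξ => φ ξ * k ξ) ⊆ tsupport φ :=
  closure_mono fun _ h => left_ne_zero_of_mul h

lemma pd_symm {f : (ι → ℝ) → ℝ} (hf : ContDiff ℝ 2 f) (i j : ι) (ξ : ι → ℝ) :
    pd i (pd j f) ξ = pd j (pd i f) ξ := by
  have hmix : ∀ i j : ι, pd i (pd j f) ξ =
      fderiv ℝ (fderiv ℝ f) ξ (Pi.single i 1) (Pi.single j 1) := fun i j => by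
    have hd := hf.differentiable (by simp)
    have e : pd j f = fun η => fderiv ℝ f η (Pi.single j 1) := by
      ext η; exact pd_eq_fderiv j (hd η)
    have h1 : ContDiff ℝ 1 (fderiv ℝ f) := hf.fderiv_right (by norm_num)
    have h2 : HasFDerivAt (fderiv ℝ f) (fderiv ℝ (fderiv ℝ f) ξ) (update ξ i (ξ i)) := by
      rw [update_eq_self]; exact (h1.differentiable (by simp) ξ).hasFDerivAt
    have h3 := (h2.comp_hasDerivAt (ξ i) (hasDerivAt_update ξ i (ξ i))).clm_apply
      (hasDerivAt_const (ξ i) (Pi.single j (1 : ℝ) : ι → ℝ))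
    rw [e]
    refine h3.deriv.trans ?_
    simp
  rw [hmix, hmix]
  exact (hf.contDiffAt.isSymmSndFDerivAt (by simp)) _ _

/-- Differentiating under a translation moves one derivative onto G under the integral while Ψ need
only be continuous. In `weak_curl` this replaces an integration by parts that would need third
derivatives. -/
lemma hasDerivAt_integral_shift {Ψ G : (ι → ℝ) → ℝ} (hΨ : Continuous Ψ)
    (hs : HasCompactSupport Ψ) (hG : ContDiff ℝ 1 G) (j : ι) :
    HasDerivAt (fun t : ℝ => ∫ ξ, Ψ ξ * G (ξ + t • Pi.single j 1))
      (∫ ξ, Ψ ξ * pd j G ξ) 0 := by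
  have hGc := hG.continuous
  have hpc := continuous_pd j hG
  set e : ι → ℝ := Pi.single j 1 with he
  have hK : IsCompact ((fun z : ℝ × (ι → ℝ) => z.2 + z.1 • e) '' (Icc (-1) 1 ×ˢ tsupport Ψ)) :=
    (isCompact_Icc.prod hs).image (by fun_prop)
  obtain ⟨C, hC⟩ := (hK.image hpc.abs).bddAbove
  have hint : ∀ t : ℝ, Continuous fun ξ => Ψ ξ * G (ξ + t • e) := fun t => by fun_prop
  have key := hasDerivAt_integral_of_dominated_loc_of_deriv_le (μ := volume) (𝕜 := ℝ)
    (F := fun (t : ℝ) ξ => Ψ ξ * G (ξ + t • e))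
    (F' := fun (t : ℝ) ξ => Ψ ξ * pd j G (ξ + t • e)) (x₀ := (0 : ℝ)) (s := Icc (-1) 1)
    (bound := fun ξ => |Ψ ξ| * C) (Icc_mem_nhds (by norm_num) (by norm_num))
    (Eventually.of_forall fun t => (hint t).aestronglyMeasurable)
    ((hint 0).integrable_of_hasCompactSupport hs.mul_right)
    (Continuous.aestronglyMeasurable (by fun_prop))
    (Eventually.of_forall fun ξ t ht => by
      rw [norm_mul, Real.norm_eq_abs, Real.norm_eq_abs]
      by_cases h : ξ ∈ tsupport Ψ
      · exact mul_le_mul_of_nonneg_left (hC ⟨_, ⟨(t, ξ), ⟨ht, h⟩, rfl⟩, rfl⟩) (abs_nonneg _)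
      · rw [image_eq_zero_of_notMem_tsupport h]; simp)
    ((hΨ.abs.mul continuous_const).integrable_of_hasCompactSupport
      (HasCompactSupport.intro hs fun ξ h => by
        simp [image_eq_zero_of_notMem_tsupport h]))
    (Eventually.of_forall fun ξ t _ => by
      have h1 : HasFDerivAt G (fderiv ℝ G (ξ + t • e)) (ξ + t • e) :=
        (hG.differentiable (by simp) _).hasFDerivAt
      have h2 : HasDerivAt (fun t : ℝ => ξ + t • e) e t := by
        simpa using ((hasDerivAt_id t).smul_const e).const_add ξ
      rw [pd_eq_fderiv j (hG.differentiable (by simp) _)]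
      exact (h1.comp_hasDerivAt t h2).const_mul (Ψ ξ))
  have h2 := key.2
  simp only [zero_smul, add_zero] at h2
  exact h2

lemma pd_comp_add (i : ι) (g : (ι → ℝ) → ℝ) (c ξ : ι → ℝ) :
    pd i (fun η => g (η + c)) ξ = pd i g (ξ + c) := by
  have := pd_comp_sub i g (-c) ξ
  simpa using this

/-- The weak form of the symmetry of third derivatives of a `C²` function. -/
lemma weak_curl {χ f : (ι → ℝ) → ℝ} (hχ : ContDiff ℝ 1 χ) (hs : HasCompactSupport χ)
    (hf : ContDiff ℝ 2 f) (i j : ι) :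
    ∫ ξ, pd i χ ξ * pd j (pd j f) ξ = ∫ ξ, pd j χ ξ * pd j (pd i f) ξ := by
  have hfi : ∀ i, ContDiff ℝ 1 (pd i f) := fun i => contDiff_pd i hf (by norm_num)
  -- Each translate satisfies the first order identity, by two integrations by parts and the
  -- symmetry of second derivatives. Differentiating it at t = 0 yields the claim.
  have hJ : ∀ t : ℝ, ∫ ξ, pd i χ ξ * pd j f (ξ + t • Pi.single j 1) =
      ∫ ξ, pd j χ ξ * pd i f (ξ + t • Pi.single j 1) := fun t => by
    set c : ι → ℝ := t • Pi.single j 1 with hc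
    set g : (ι → ℝ) → ℝ := fun ξ => f (ξ + c) with hg
    have hgs : ContDiff ℝ 2 g := hf.comp (contDiff_id.add contDiff_const)
    have hgi : ∀ i, ContDiff ℝ 1 (pd i g) := fun i => contDiff_pd i hgs (by norm_num)
    have hpg : ∀ i ξ, pd i f (ξ + c) = pd i g ξ := fun i ξ => (pd_comp_add i f c ξ).symm
    simp only [hpg]
    have hprod : ∀ i j : ι, ∫ ξ, (pd i χ ξ * pd j g ξ + χ ξ * pd i (pd j g) ξ) = 0 := fun i j => by
      have h1 := integral_pd_eq_zero i (hχ.mul (hgi j)) hs.mul_right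
      rw [← h1]
      refine integral_congr_ae (Eventually.of_forall fun ξ => ?_)
      exact (pd_mul i (hχ.differentiable (by simp) ξ) ((hgi j).differentiable (by simp) ξ)).symm
    have hi1 : ∀ i j : ι, Integrable fun ξ => pd i χ ξ * pd j g ξ := fun i j =>
      ((continuous_pd i hχ).mul (hgi j).continuous).integrable_of_hasCompactSupport
        (hasCompactSupport_pd i hs).mul_right
    have hi2 : ∀ i j : ι, Integrable fun ξ => χ ξ * pd i (pd j g) ξ := fun i j =>
      (hχ.continuous.mul (continuous_pd i (hgi j))).integrable_of_hasCompactSupport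
        hs.mul_right
    have e1 := hprod i j
    have e2 := hprod j i
    rw [integral_add (hi1 i j) (hi2 i j)] at e1
    rw [integral_add (hi1 j i) (hi2 j i)] at e2
    simp only [pd_symm hgs i j] at e1
    linarith
  have h1 := hasDerivAt_integral_shift (continuous_pd i hχ) (hasCompactSupport_pd i hs) (hfi j) j
  have h2 := hasDerivAt_integral_shift (continuous_pd j hχ) (hasCompactSupport_pd j hs) (hfi i) j
  rw [funext hJ] at h1
  exact h1.unique h2

end

/-! ### The Obata identity. -/

section

variable {ι : Type*} [Fintype ι] [DecidableEq ι]

/-- The pointwise algebra behind `obata_identity`: F, H, g stand for ∇f, the Hessian of f and ∇φ,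
and m for the density. The left side is a sum of terms of zero integral with all derivatives
expanded. The equation enters only through the trace `htr`, which turns (N − 1)P/2 − ∑ b_l F_l/x_l
into ∑ H_ii − P/2. -/
lemma obata_algebra (F x b g : ι → ℝ) (H : ι → ι → ℝ) (φ m f P N : ℝ)
    (htr : ∑ i, (H i i + b i * (F i / x i)) = N / 2 * P) (hN : N = ∑ i, (1 + b i)) :
    (∑ i, ∑ j, (((g j * m + φ * (m * (b j / x j + (1 - N) * F j / f))) * F i + φ * m * H i j) *
        H i j - ((g i * m + φ * (m * (b i / x i + (1 - N) * F i / f))) * F i + φ * m * H i i) *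
        H j j)) +
      ∑ i, ((g i * m + φ * (m * (b i / x i + (1 - N) * F i / f))) *
          (((N - 1) / 2 * P - ∑ l, b l * (F l / x l)) * F i) +
        φ * m * (((N - 1) / 2 * ((2 * ∑ l, H i l * F l - P * F i) / f) -
          (∑ l, b l * (H i l / x l) - b i * F i / x i ^ 2)) * F i +
          ((N - 1) / 2 * P - ∑ l, b l * (F l / x l)) * H i i)) =
    m * (φ * (∑ i, ∑ j, (H i j - if i = j then P / 2 else 0) ^ 2 +
        ∑ i, b i * (F i / x i - P / 2) ^ 2) +
      ∑ i, ∑ j, (H i j - if i = j then P / 2 else 0) * F i * g j) := by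
  set T := ∑ i, H i i with hT
  set D := ∑ l, b l * (F l / x l) with hD
  set G := ∑ i, F i * F i with hG
  set A := ∑ i, ∑ j, H i j * F i * F j with hA
  set Hn := ∑ i, ∑ j, H i j * H i j with hHn
  set gF := ∑ i, g i * F i with hgF
  set gHF := ∑ i, ∑ j, H i j * F i * g j with hgHF
  set R := ∑ i, ∑ j, H i j * F i * (b j / x j) with hR
  set D2 := ∑ i, b i * (F i / x i) ^ 2 with hD2
  set Db := ∑ i, b i with hDb
  have htr' : T + D = N / 2 * P := by rw [← htr, hT, hD, Finset.sum_add_distrib]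
  have hN' : N = (Fintype.card ι : ℝ) + Db := by
    rw [hN, Finset.sum_add_distrib]; simp [hDb]
  have s1 : ∑ i, ∑ j, ((g j * m + φ * (m * (b j / x j + (1 - N) * F j / f))) * F i +
      φ * m * H i j) * H i j = m * gHF + φ * m * R + φ * m * (1 - N) / f * A + φ * m * Hn := by
    simp only [hgHF, hR, hA, hHn, Finset.mul_sum, ← Finset.sum_add_distrib]
    refine Finset.sum_congr rfl fun i _ => Finset.sum_congr rfl fun j _ => ?_
    ring
  have s2 : ∑ i, ((g i * m + φ * (m * (b i / x i + (1 - N) * F i / f))) * F i +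
      φ * m * H i i) = m * gF + φ * m * D + φ * m * (1 - N) / f * G + φ * m * T := by
    simp only [hgF, hD, hG, hT, Finset.mul_sum, ← Finset.sum_add_distrib]
    refine Finset.sum_congr rfl fun i _ => ?_
    ring
  have s2' : ∑ i, ∑ j, ((g i * m + φ * (m * (b i / x i + (1 - N) * F i / f))) * F i +
      φ * m * H i i) * H j j =
      (m * gF + φ * m * D + φ * m * (1 - N) / f * G + φ * m * T) * T := by
    rw [← s2, Finset.sum_mul]
    refine Finset.sum_congr rfl fun i _ => ?_
    rw [← Finset.mul_sum]
  set K := (N - 1) / 2 * P - D with hK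
  have s3 : ∑ i, ((g i * m + φ * (m * (b i / x i + (1 - N) * F i / f))) * (K * F i) +
        φ * m * (((N - 1) / 2 * ((2 * ∑ l, H i l * F l - P * F i) / f) -
          (∑ l, b l * (H i l / x l) - b i * F i / x i ^ 2)) * F i + K * H i i)) =
      K * (m * gF + φ * m * D + φ * m * (1 - N) / f * G) +
      φ * m * ((N - 1) / f * A - (N - 1) / 2 * P / f * G - R + D2) + φ * m * K * T := by
    have a1 : ∀ i, (∑ l, H i l * F l) * F i = ∑ l, H i l * F i * F l := fun i => by
      rw [Finset.sum_mul]; exact Finset.sum_congr rfl fun l _ => by ring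
    have a2 : ∀ i, (∑ l, b l * (H i l / x l)) * F i = ∑ l, H i l * F i * (b l / x l) :=
      fun i => by rw [Finset.sum_mul]; exact Finset.sum_congr rfl fun l _ => by ring
    have a3 : ∀ i, (g i * m + φ * (m * (b i / x i + (1 - N) * F i / f))) * (K * F i) +
        φ * m * (((N - 1) / 2 * ((2 * ∑ l, H i l * F l - P * F i) / f) -
          (∑ l, b l * (H i l / x l) - b i * F i / x i ^ 2)) * F i + K * H i i) =
        K * m * (g i * F i) + K * φ * m * (b i * (F i / x i)) +
        K * φ * m * (1 - N) / f * (F i * F i) +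
        φ * m * (N - 1) / f * ∑ l, H i l * F i * F l +
        (-(φ * m * (N - 1) / 2 * P / f)) * (F i * F i) +
        (-(φ * m)) * ∑ l, H i l * F i * (b l / x l) + φ * m * (b i * (F i / x i) ^ 2) +
        φ * m * K * H i i := fun i => by
      rw [← a1, ← a2]; ring
    rw [Finset.sum_congr rfl fun i _ => a3 i]
    simp only [Finset.sum_add_distrib, ← Finset.mul_sum]
    rw [← hgF, ← hD, ← hG, ← hA, ← hR, ← hD2, ← hT]
    ring
  have s4 : ∑ i, ∑ j, (H i j - if i = j then P / 2 else 0) ^ 2 =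
      Hn - P * T + (Fintype.card ι : ℝ) * (P ^ 2 / 4) := by
    have a1 : ∀ i j, (H i j - if i = j then P / 2 else 0) ^ 2 = H i j * H i j +
        if i = j then P ^ 2 / 4 - P * H i j else 0 := fun i j => by
      split_ifs <;> ring
    simp only [a1, Finset.sum_add_distrib, Finset.sum_ite_eq, Finset.mem_univ, if_true,
      Finset.sum_sub_distrib, ← Finset.mul_sum, Finset.sum_const, Finset.card_univ,
      nsmul_eq_mul]
    rw [← hT, ← hHn]; ring
  have s5 : ∑ i, b i * (F i / x i - P / 2) ^ 2 = D2 - P * D + P ^ 2 / 4 * Db := by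
    simp only [hD2, hD, hDb, Finset.mul_sum, ← Finset.sum_add_distrib, ← Finset.sum_sub_distrib]
    refine Finset.sum_congr rfl fun i _ => ?_
    ring
  have s6 : ∑ i, ∑ j, (H i j - if i = j then P / 2 else 0) * F i * g j = gHF - P / 2 * gF := by
    have a1 : ∀ i j, (H i j - if i = j then P / 2 else 0) * F i * g j = H i j * F i * g j -
        if i = j then P / 2 * (g i * F i) else 0 := fun i j => by
      split_ifs with h
      · rw [h]; ring
      · ring
    simp only [a1, Finset.sum_sub_distrib, Finset.sum_ite_eq, Finset.mem_univ, if_true,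
      ← Finset.mul_sum]
    rw [← hgHF, ← hgF]
  simp only [Finset.sum_sub_distrib]
  rw [s1, s2', s3, s4, s5, s6]
  have hKT : K = T - P / 2 := by rw [hK]; linear_combination -htr'
  have hTD : T = N / 2 * P - D := by linarith
  rw [hKT, hTD]
  have hcard : (Fintype.card ι : ℝ) = N - Db := by linarith
  rw [hcard]
  ring

/-- The open orthant in the weighted coordinates. -/
def posOrth (b : ι → ℝ) : Set (ι → ℝ) := {ξ | ∀ i, b i ≠ 0 → 0 < ξ i}

/-- The weight `∏ ξᵢ ^ bᵢ`. -/
noncomputable def weight (b : ι → ℝ) (ξ : ι → ℝ) : ℝ := ∏ i, ξ i ^ b i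

/-- The Obata `P`-function. -/
noncomputable def pfun (f : (ι → ℝ) → ℝ) (k : ℝ) (ξ : ι → ℝ) : ℝ :=
  (∑ i, pd i f ξ ^ 2 + k) / f ξ

/-- The trace free Hessian. -/
noncomputable def efun (f : (ι → ℝ) → ℝ) (k : ℝ) (i j : ι) (ξ : ι → ℝ) : ℝ :=
  pd i (pd j f) ξ - if i = j then pfun f k ξ / 2 else 0

/-- The squared norm of the weighted trace free Hessian. -/
noncomputable def qfun (b : ι → ℝ) (f : (ι → ℝ) → ℝ) (k : ℝ) (ξ : ι → ℝ) : ℝ :=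
  ∑ i, ∑ j, efun f k i j ξ ^ 2 + ∑ i, b i * (pd i f ξ / ξ i - pfun f k ξ / 2) ^ 2

section

variable {b : ι → ℝ} {f : (ι → ℝ) → ℝ} {k : ℝ}

lemma contDiffAt_weight {ξ : ι → ℝ} (hξ : ξ ∈ posOrth b) {n : WithTop ℕ∞} :
    ContDiffAt ℝ n (weight b) ξ := by
  unfold weight
  refine contDiffAt_prod fun i _ => ?_
  by_cases h : b i = 0
  · simp only [h, Real.rpow_zero]; exact contDiffAt_const
  · exact (contDiff_apply ℝ ℝ i).contDiffAt.rpow_const_of_ne (hξ i h).ne'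

lemma pd_weight {ξ : ι → ℝ} (hξ : ξ ∈ posOrth b) (j : ι) :
    pd j (weight b) ξ = weight b ξ * (b j / ξ j) := by
  have hline : ∀ s : ℝ, weight b (update ξ j s) =
      s ^ b j * ∏ i ∈ Finset.univ.erase j, ξ i ^ b i := fun s => by
    unfold weight
    rw [← Finset.mul_prod_erase _ _ (Finset.mem_univ j), update_self]
    congr 1
    exact Finset.prod_congr rfl fun i hi => by rw [update_of_ne (Finset.ne_of_mem_erase hi)]
  have hw : weight b ξ = ξ j ^ b j * ∏ i ∈ Finset.univ.erase j, ξ i ^ b i := by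
    rw [← hline, update_eq_self]
  have hd : HasDerivAt (fun s : ℝ => s ^ b j) (ξ j ^ b j * (b j / ξ j)) (ξ j) := by
    by_cases h : b j = 0
    · simp only [h, Real.rpow_zero, zero_div, mul_zero]
      exact hasDerivAt_const _ _
    · have hp := hξ j h
      refine (Real.hasDerivAt_rpow_const (Or.inl hp.ne')).congr_deriv ?_
      rw [Real.rpow_sub_one hp.ne']; ring
  rw [pd]
  simp only [hline]
  rw [(hd.mul_const _).deriv, hw]
  ring

lemma contDiff_pfun (hf : ContDiff ℝ 2 f) (hf0 : ∀ ξ, 0 < f ξ) : ContDiff ℝ 1 (pfun f k) := by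
  have hfi : ∀ i, ContDiff ℝ 1 (pd i f) := fun i => contDiff_pd i hf (by norm_num)
  unfold pfun
  refine ContDiff.div ?_ (hf.of_le (by norm_num)) fun ξ => (hf0 ξ).ne'
  exact (ContDiff.sum fun i _ => (hfi i).pow 2).add contDiff_const

lemma pd_pfun (hf : ContDiff ℝ 2 f) (hf0 : ∀ ξ, 0 < f ξ) (j : ι) (ξ : ι → ℝ) :
    pd j (pfun f k) ξ =
      (2 * ∑ l, pd j (pd l f) ξ * pd l f ξ - pfun f k ξ * pd j f ξ) / f ξ := by
  have hfi : ∀ i, ContDiff ℝ 1 (pd i f) := fun i => contDiff_pd i hf (by norm_num)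
  have h1 : ∀ l, HasDerivAt (fun s : ℝ => pd l f (update ξ j s) ^ 2)
      (2 * (pd j (pd l f) ξ * pd l f ξ)) (ξ j) := fun l => by
    have := (hasDerivAt_pd j ((hfi l).differentiable (by simp) ξ)).pow 2
    refine this.congr_deriv ?_
    simp; ring
  have h2 := hasDerivAt_pd j (hf.differentiable (by simp) ξ)
  have h3 := ((HasDerivAt.fun_sum fun l (_ : l ∈ Finset.univ) => h1 l).add_const k).div h2
    (by rw [update_eq_self]; exact (hf0 ξ).ne')
  refine h3.deriv.trans ?_
  have := (hf0 ξ).ne'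
  simp only [update_eq_self, pfun, ← Finset.mul_sum]
  field_simp

lemma hasDerivAt_quot (hf : ContDiff ℝ 2 f) {ξ : ι → ℝ} (hξ : ξ ∈ posOrth b) (i l : ι) :
    HasDerivAt (fun s : ℝ => b l * (pd l f (update ξ i s) / update ξ i s l))
      (b l * (pd i (pd l f) ξ / ξ l) - if i = l then b i * pd i f ξ / ξ i ^ 2 else 0) (ξ i) := by
  by_cases h : b l = 0
  · simp only [h, zero_mul, zero_sub]
    have : (if i = l then b i * pd i f ξ / ξ i ^ 2 else 0) = 0 := by
      split_ifs with hil
      · rw [hil, h]; simp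
      · rfl
    rw [this, neg_zero]
    exact hasDerivAt_const _ _
  · have hfl : ContDiff ℝ 1 (pd l f) := contDiff_pd l hf (by norm_num)
    have hp := hξ l h
    have h1 := hasDerivAt_pd i (hfl.differentiable (by simp) ξ)
    have h2 : HasDerivAt (fun s : ℝ => update ξ i s l) ((Pi.single i (1 : ℝ) : ι → ℝ) l) (ξ i) :=
      hasDerivAt_pi.1 (hasDerivAt_update ξ i (ξ i)) l
    refine ((h1.div h2 (by rw [update_eq_self]; exact hp.ne')).const_mul (b l)).congr_deriv ?_
    rw [update_eq_self]
    split_ifs with hil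
    · subst hil
      simp only [Pi.single_eq_same]
      field_simp
    · simp only [Pi.single_apply, if_neg (Ne.symm hil)]
      field_simp
      ring

/-- The difference of the flat Laplacian and half the `P`-function, on solutions. -/
noncomputable def kfun (b : ι → ℝ) (f : (ι → ℝ) → ℝ) (k : ℝ) (ξ : ι → ℝ) : ℝ :=
  (hdim b - 1) / 2 * pfun f k ξ - ∑ l, b l * (pd l f ξ / ξ l)

lemma contDiffAt_kfun (hf : ContDiff ℝ 2 f) (hf0 : ∀ ξ, 0 < f ξ) {ξ : ι → ℝ}
    (hξ : ξ ∈ posOrth b) : ContDiffAt ℝ 1 (kfun b f k) ξ := by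
  unfold kfun
  refine (contDiffAt_const.mul (contDiff_pfun hf hf0).contDiffAt).sub
    (ContDiffAt.sum fun l _ => ?_)
  by_cases h : b l = 0
  · simp only [h, zero_mul]; exact contDiffAt_const
  · exact contDiffAt_const.mul ((contDiff_pd l hf (by norm_num)).contDiffAt.div
      (contDiff_apply ℝ ℝ l).contDiffAt (hξ l h).ne')

lemma pd_kfun (hf : ContDiff ℝ 2 f) (hf0 : ∀ ξ, 0 < f ξ) {ξ : ι → ℝ}
    (hξ : ξ ∈ posOrth b) (i : ι) :
    pd i (kfun b f k) ξ = (hdim b - 1) / 2 * pd i (pfun f k) ξ -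
      (∑ l, b l * (pd i (pd l f) ξ / ξ l) - b i * pd i f ξ / ξ i ^ 2) := by
  have h1 := hasDerivAt_pd i ((contDiff_pfun (k := k) hf hf0).differentiable (by simp) ξ)
  have h2 := (h1.const_mul ((hdim b - 1) / 2)).sub
    (HasDerivAt.fun_sum fun l (_ : l ∈ Finset.univ) => hasDerivAt_quot hf hξ i l)
  refine h2.deriv.trans ?_
  rw [Finset.sum_sub_distrib]
  simp

/-- The weighted measure density of the Obata identity. -/
noncomputable def mfun (b : ι → ℝ) (f : (ι → ℝ) → ℝ) (ξ : ι → ℝ) : ℝ :=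
  weight b ξ * f ξ ^ (1 - hdim b)

lemma contDiffAt_mfun (hf : ContDiff ℝ 2 f) (hf0 : ∀ ξ, 0 < f ξ) {ξ : ι → ℝ}
    (hξ : ξ ∈ posOrth b) : ContDiffAt ℝ 1 (mfun b f) ξ :=
  (contDiffAt_weight hξ).mul
    ((hf.of_le (by norm_num)).contDiffAt.rpow_const_of_ne (hf0 ξ).ne')

lemma pd_mfun (hf : ContDiff ℝ 2 f) (hf0 : ∀ ξ, 0 < f ξ) {ξ : ι → ℝ}
    (hξ : ξ ∈ posOrth b) (j : ι) :
    pd j (mfun b f) ξ = mfun b f ξ * (b j / ξ j + (1 - hdim b) * pd j f ξ / f ξ) := by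
  have hd := hf.differentiable (by simp) ξ
  have h1 : DifferentiableAt ℝ (fun ξ => f ξ ^ (1 - hdim b)) ξ :=
    hd.rpow_const (Or.inl (hf0 ξ).ne')
  have h2 : pd j (fun ξ => f ξ ^ (1 - hdim b)) ξ =
      (1 - hdim b) * f ξ ^ (1 - hdim b) * pd j f ξ / f ξ := by
    have h3 := (hasDerivAt_pd j hd).rpow_const (p := 1 - hdim b)
      (Or.inl (by rw [update_eq_self]; exact (hf0 ξ).ne'))
    refine h3.deriv.trans ?_
    rw [update_eq_self, Real.rpow_sub_one (hf0 ξ).ne']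
    ring
  have h4 := pd_mul j ((contDiffAt_weight (n := 1) hξ).differentiableAt (by simp)) h1
  refine h4.trans ?_
  rw [pd_weight hξ, h2, mfun]
  ring

/-- The weak Obata identity. -/
lemma obata_identity (hf : ContDiff ℝ 2 f) (hf0 : ∀ ξ, 0 < f ξ)
    (heq : ∀ ξ ∈ posOrth b, ∑ i, (pd i (pd i f) ξ + b i * (pd i f ξ / ξ i)) =
      hdim b / 2 * pfun f k ξ)
    {φ : (ι → ℝ) → ℝ} (hφ : ContDiff ℝ 1 φ) (hs : HasCompactSupport φ)
    (hsub : tsupport φ ⊆ posOrth b) :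
    ∫ ξ, mfun b f ξ * (φ ξ * qfun b f k ξ +
      ∑ i, ∑ j, efun f k i j ξ * pd i f ξ * pd j φ ξ) = 0 := by
  have hfi : ∀ i, ContDiff ℝ 1 (pd i f) := fun i => contDiff_pd i hf (by norm_num)
  set ψ : (ι → ℝ) → ℝ := fun ξ => φ ξ * mfun b f ξ with hψ
  have hψs : ContDiff ℝ 1 ψ :=
    contDiff_mul_of_tsupport hφ fun ξ hξ => contDiffAt_mfun hf hf0 (hsub hξ)
  have hψt : tsupport ψ ⊆ tsupport φ := tsupport_mul_subset
  have hψc : HasCompactSupport ψ := hs.mul_right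
  set χ : ι → (ι → ℝ) → ℝ := fun i ξ => ψ ξ * pd i f ξ with hχ
  have hχs : ∀ i, ContDiff ℝ 1 (χ i) := fun i => hψs.mul (hfi i)
  have hχc : ∀ i, HasCompactSupport (χ i) := fun i => hψc.mul_right
  have hχt : ∀ i, tsupport (χ i) ⊆ tsupport φ := fun i => tsupport_mul_subset.trans hψt
  -- On solutions `kfun` equals Δf − P/2 but contains only first derivatives of f, so κ is C¹ and
  -- its divergence integrates to zero.
  set κ : ι → (ι → ℝ) → ℝ := fun i ξ => ψ ξ * (kfun b f k ξ * pd i f ξ) with hκ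
  have hκs : ∀ i, ContDiff ℝ 1 (κ i) := fun i =>
    contDiff_mul_of_tsupport hψs fun ξ hξ =>
      (contDiffAt_kfun hf hf0 (hsub (hψt hξ))).mul (hfi i).contDiffAt
  have hκc : ∀ i, HasCompactSupport (κ i) := fun i => hψc.mul_right
  have hκt : ∀ i, tsupport (κ i) ⊆ tsupport φ := fun i => tsupport_mul_subset.trans hψt
  have hpp : ∀ i j, Continuous (pd i (pd j f)) := fun i j => continuous_pd i (hfi j)
  have hi1 : ∀ i j : ι, Integrable fun ξ => pd j (χ i) ξ * pd j (pd i f) ξ := fun i j =>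
    ((continuous_pd j (hχs i)).mul (hpp j i)).integrable_of_hasCompactSupport
      (hasCompactSupport_pd j (hχc i)).mul_right
  have hi2 : ∀ i j : ι, Integrable fun ξ => pd i (χ i) ξ * pd j (pd j f) ξ := fun i j =>
    ((continuous_pd i (hχs i)).mul (hpp j j)).integrable_of_hasCompactSupport
      (hasCompactSupport_pd i (hχc i)).mul_right
  have hi3 : ∀ i : ι, Integrable (pd i (κ i)) := fun i =>
    (continuous_pd i (hκs i)).integrable_of_hasCompactSupport (hasCompactSupport_pd i (hκc i))
  have hint : ∫ ξ, (∑ i, ∑ j, (pd j (χ i) ξ * pd j (pd i f) ξ -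
      pd i (χ i) ξ * pd j (pd j f) ξ) + ∑ i, pd i (κ i) ξ) = 0 := by
    have hi12 : ∀ i j : ι, Integrable fun ξ => pd j (χ i) ξ * pd j (pd i f) ξ -
        pd i (χ i) ξ * pd j (pd j f) ξ := fun i j => (hi1 i j).sub (hi2 i j)
    have hi12' : ∀ i : ι, Integrable fun ξ => ∑ j, (pd j (χ i) ξ * pd j (pd i f) ξ -
        pd i (χ i) ξ * pd j (pd j f) ξ) := fun i => integrable_finsetSum _ fun j _ => hi12 i j
    rw [integral_add (integrable_finsetSum _ fun i _ => hi12' i)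
      (integrable_finsetSum _ fun i _ => hi3 i), integral_finsetSum _ fun i _ => hi12' i,
      integral_finsetSum _ fun i _ => hi3 i, Finset.sum_eq_zero, Finset.sum_eq_zero, add_zero]
    · exact fun i _ => integral_pd_eq_zero i (hκs i) (hκc i)
    · intro i _
      rw [integral_finsetSum _ fun j _ => hi12 i j, Finset.sum_eq_zero]
      intro j _
      rw [integral_sub (hi1 i j) (hi2 i j), weak_curl (hχs i) (hχc i) hf i j, sub_self]
  rw [← hint]
  refine integral_congr_ae (Eventually.of_forall fun ξ => ?_)
  beta_reduce
  by_cases hξ : ξ ∈ tsupport φ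
  · have hξo := hsub hξ
    have dψ : ∀ j, pd j ψ ξ = pd j φ ξ * mfun b f ξ + φ ξ * (mfun b f ξ *
        (b j / ξ j + (1 - hdim b) * pd j f ξ / f ξ)) := fun j => by
      rw [hψ, pd_mul j (hφ.differentiable (by simp) ξ)
        ((contDiffAt_mfun hf hf0 hξo).differentiableAt (by simp)), pd_mfun hf hf0 hξo]
    have dχ : ∀ i j, pd j (χ i) ξ = pd j ψ ξ * pd i f ξ + ψ ξ * pd j (pd i f) ξ := fun i j =>
      pd_mul j (hψs.differentiable (by simp) ξ) ((hfi i).differentiable (by simp) ξ)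
    have dκ : ∀ i, pd i (κ i) ξ = pd i ψ ξ * (kfun b f k ξ * pd i f ξ) + ψ ξ *
        (pd i (kfun b f k) ξ * pd i f ξ + kfun b f k ξ * pd i (pd i f) ξ) := fun i => by
      have hk := (contDiffAt_kfun (k := k) hf hf0 hξo).differentiableAt (by simp)
      have hd := (hfi i).differentiable (by simp) ξ
      have h12 : DifferentiableAt ℝ (fun ξ => kfun b f k ξ * pd i f ξ) ξ := hk.mul hd
      refine (pd_mul i (hψs.differentiable (by simp) ξ) h12).trans ?_
      rw [pd_mul i hk hd]
    have halg := obata_algebra (fun i => pd i f ξ) ξ b (fun j => pd j φ ξ)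
      (fun i j => pd i (pd j f) ξ) (φ ξ) (mfun b f ξ) (f ξ) (pfun f k ξ) (hdim b)
      (heq ξ hξo) rfl
    unfold qfun efun
    rw [← halg]
    simp only [dχ, dκ, dψ, pd_kfun hf hf0 hξo, pd_pfun hf hf0]
    have hψξ : ψ ξ = φ ξ * mfun b f ξ := rfl
    simp only [hψξ]
    unfold kfun
    congr 1
    refine Finset.sum_congr rfl fun i _ => Finset.sum_congr rfl fun j _ => ?_
    rw [pd_symm hf j i]
  · have z1 : φ ξ = 0 := image_eq_zero_of_notMem_tsupport hξ
    have z2 : ∀ j, pd j φ ξ = 0 := fun j => pd_eq_zero_of_notMem_tsupport j hξ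
    have z3 : ∀ i j, pd j (χ i) ξ = 0 := fun i j =>
      pd_eq_zero_of_notMem_tsupport j fun h => hξ (hχt i h)
    have z4 : ∀ i, pd i (κ i) ξ = 0 := fun i =>
      pd_eq_zero_of_notMem_tsupport i fun h => hξ (hκt i h)
    simp [z1, z2, z3, z4]

end

end

/-! ### The Caccioppoli estimate and cutoff functions. -/

section

variable {ι : Type*} [Fintype ι] [DecidableEq ι] {b : ι → ℝ} {f : (ι → ℝ) → ℝ} {k : ℝ}

lemma continuous_efun (hf : ContDiff ℝ 2 f) (hf0 : ∀ ξ, 0 < f ξ) (i j : ι) :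
    Continuous (efun f k i j) := by
  unfold efun
  refine (continuous_pd i (contDiff_pd j hf (by norm_num))).sub ?_
  split_ifs
  · exact (contDiff_pfun hf hf0).continuous.div_const 2
  · exact continuous_const

lemma continuousAt_qfun (hf : ContDiff ℝ 2 f) (hf0 : ∀ ξ, 0 < f ξ) {ξ : ι → ℝ}
    (hξ : ξ ∈ posOrth b) : ContinuousAt (qfun b f k) ξ := by
  unfold qfun
  refine ContinuousAt.add ?_ ?_
  · exact (continuous_finsetSum _ fun i _ => continuous_finsetSum _ fun j _ =>
      (continuous_efun hf hf0 i j).pow 2).continuousAt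
  · refine tendsto_finsetSum _ fun i _ => ?_
    by_cases h : b i = 0
    · simp only [h, zero_mul]; exact tendsto_const_nhds
    · exact continuousAt_const.mul
        (((((contDiff_pd (m := 0) i hf (by norm_num)).continuous).continuousAt.div
          (continuous_apply i).continuousAt (hξ i h).ne').sub
          ((contDiff_pfun hf hf0).continuous.continuousAt.div_const 2)).pow 2)

lemma sum_efun_le_qfun (hb : ∀ i, 0 ≤ b i) (ξ : ι → ℝ) :
    ∑ i, ∑ j, efun f k i j ξ ^ 2 ≤ qfun b f k ξ :=
  le_add_of_nonneg_right (Finset.sum_nonneg fun i _ => mul_nonneg (hb i) (sq_nonneg _))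

lemma qfun_nonneg (hb : ∀ i, 0 ≤ b i) (ξ : ι → ℝ) : 0 ≤ qfun b f k ξ :=
  le_trans (Finset.sum_nonneg fun _ _ => Finset.sum_nonneg fun _ _ => sq_nonneg _)
    (sum_efun_le_qfun hb ξ)

lemma weight_nonneg {ξ : ι → ℝ} (hξ : ξ ∈ posOrth b) : 0 ≤ weight b ξ :=
  Finset.prod_nonneg fun i _ => by
    by_cases h : b i = 0
    · simp [h]
    · exact Real.rpow_nonneg (hξ i h).le _

lemma mfun_nonneg (hf0 : ∀ ξ, 0 < f ξ) {ξ : ι → ℝ} (hξ : ξ ∈ posOrth b) : 0 ≤ mfun b f ξ :=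
  mul_nonneg (weight_nonneg hξ) (Real.rpow_nonneg (hf0 ξ).le _)

lemma integrable_mul_of_tsupport {φ h : (ι → ℝ) → ℝ} (hφ : Continuous φ)
    (hs : HasCompactSupport φ) (hh : ∀ ξ ∈ tsupport φ, ContinuousAt h ξ) :
    Integrable fun ξ => φ ξ * h ξ :=
  (continuous_mul_of_tsupport hφ hh).integrable_of_hasCompactSupport hs.mul_right

lemma tsupport_pd_subset (j : ι) (g : (ι → ℝ) → ℝ) : tsupport (pd j g) ⊆ tsupport g :=
  closure_minimal (fun _ h => by
    by_contra h'
    exact h (pd_eq_zero_of_notMem_tsupport j h')) (isClosed_tsupport g)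

section CutoffEstimate

variable (hb : ∀ i, 0 ≤ b i) (hf : ContDiff ℝ 2 f) (hf0 : ∀ ξ, 0 < f ξ)
  (heq : ∀ ξ ∈ posOrth b, ∑ i, (pd i (pd i f) ξ + b i * (pd i f ξ / ξ i)) =
      hdim b / 2 * pfun f k ξ)
  {ζ : (ι → ℝ) → ℝ} (hζ : ContDiff ℝ 1 ζ) (hs : HasCompactSupport ζ)
  (hsub : tsupport ζ ⊆ posOrth b)

include hf hf0 hζ hs hsub in
lemma integrable_cutoff_qfun : Integrable fun ξ => ζ ξ * (ζ ξ * mfun b f ξ * qfun b f k ξ) :=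
  integrable_mul_of_tsupport hζ.continuous hs fun _ hξ =>
    (hζ.continuous.continuousAt.mul (contDiffAt_mfun hf hf0 (hsub hξ)).continuousAt).mul
      (continuousAt_qfun hf hf0 (hsub hξ))

include hf hf0 hζ hs hsub in
lemma integrable_cutoff_grad (j : ι) :
    Integrable fun ξ => pd j ζ ξ * (mfun b f ξ * (∑ i, pd i f ξ ^ 2) * pd j ζ ξ) := by
  have hp : ∀ i, Continuous (pd i f) := fun i => (contDiff_pd (m := 0) i hf (by norm_num)).continuous
  refine integrable_mul_of_tsupport (continuous_pd j hζ) (hasCompactSupport_pd j hs)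
    fun ξ hξ => ?_
  have h1 := hsub (tsupport_pd_subset j ζ hξ)
  exact ((contDiffAt_mfun hf hf0 h1).continuousAt.mul
    (continuous_finsetSum _ fun i _ => (hp i).pow 2).continuousAt).mul
    (continuous_pd j hζ).continuousAt

include hb hf hf0 heq hζ hs hsub in
/-- The Caccioppoli type estimate for the trace free Hessian. -/
lemma cutoff_estimate :
    ∫ ξ, ζ ξ * (ζ ξ * mfun b f ξ * qfun b f k ξ) ≤
      4 * ∑ j, ∫ ξ, pd j ζ ξ * (mfun b f ξ * (∑ i, pd i f ξ ^ 2) * pd j ζ ξ) := by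
  have hφ : ContDiff ℝ 1 fun ξ => ζ ξ * ζ ξ := hζ.mul hζ
  have hφt : tsupport (fun ξ => ζ ξ * ζ ξ) ⊆ posOrth b := tsupport_mul_subset.trans hsub
  have hid := obata_identity hf hf0 heq hφ hs.mul_right hφt
  have hpd : ∀ j ξ, pd j (fun ξ => ζ ξ * ζ ξ) ξ = 2 * ζ ξ * pd j ζ ξ := fun j ξ => by
    have hd := hζ.differentiable (by simp) ξ
    rw [pd_mul j hd hd]; ring
  have h1 := integrable_cutoff_qfun (k := k) hf hf0 hζ hs hsub
  have h2 := fun j => integrable_cutoff_grad hf hf0 hζ hs hsub j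
  have hle : ∫ ξ, ((1 / 2) * (ζ ξ * (ζ ξ * mfun b f ξ * qfun b f k ξ)) -
      2 * ∑ j, pd j ζ ξ * (mfun b f ξ * (∑ i, pd i f ξ ^ 2) * pd j ζ ξ)) ≤ 0 := by
    rw [← hid]
    refine integral_mono_ae ((h1.const_mul _).sub
      ((integrable_finsetSum _ fun j _ => h2 j).const_mul _)) ?_
      (Eventually.of_forall fun ξ => ?_)
    · have e1 : Integrable fun ξ => ζ ξ * (mfun b f ξ * (ζ ξ * qfun b f k ξ +
          ∑ i, ∑ j, efun f k i j ξ * pd i f ξ * (2 * pd j ζ ξ))) := by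
        refine integrable_mul_of_tsupport hζ.continuous hs fun ξ hξ => ?_
        have hp : ∀ i, Continuous (pd i f) := fun i =>
          (contDiff_pd (m := 0) i hf (by norm_num)).continuous
        refine (contDiffAt_mfun hf hf0 (hsub hξ)).continuousAt.mul
          ((hζ.continuous.continuousAt.mul (continuousAt_qfun hf hf0 (hsub hξ))).add ?_)
        exact (continuous_finsetSum _ fun i _ => continuous_finsetSum _ fun j _ =>
          ((continuous_efun hf hf0 i j).mul (hp i)).mul
            (continuous_const.mul (continuous_pd j hζ))).continuousAt
      refine e1.congr (Eventually.of_forall fun ξ => ?_)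
      beta_reduce
      simp only [hpd, mul_add, Finset.mul_sum]
      congr 1
      · ring
      · refine Finset.sum_congr rfl fun i _ => Finset.sum_congr rfl fun j _ => ?_
        ring
    · beta_reduce
      by_cases hξ : ξ ∈ tsupport ζ
      · have hm := mfun_nonneg hf0 (hsub hξ)
        have hq := sum_efun_le_qfun (f := f) (k := k) hb ξ
        -- Young's inequality for the flux term with φ = ζ²: half of the Hessian term is given up
        -- and the rest is 2|∇f|²|∇ζ|².
        have hterm : ∀ i j, -((1 / 2) * (ζ ξ ^ 2 * efun f k i j ξ ^ 2)) -
            2 * (pd i f ξ ^ 2 * pd j ζ ξ ^ 2) ≤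
            efun f k i j ξ * pd i f ξ * (2 * ζ ξ * pd j ζ ξ) := fun i j => by
          nlinarith [sq_nonneg (ζ ξ * efun f k i j ξ + 2 * (pd i f ξ * pd j ζ ξ))]
        have hsum := Finset.sum_le_sum fun i (_ : i ∈ Finset.univ) =>
          Finset.sum_le_sum fun j (_ : j ∈ Finset.univ) => hterm i j
        simp only [Finset.sum_sub_distrib, Finset.sum_neg_distrib, ← Finset.mul_sum] at hsum
        have e2 : ∑ i, pd i f ξ ^ 2 * ∑ j, pd j ζ ξ ^ 2 =
            (∑ i, pd i f ξ ^ 2) * ∑ j, pd j ζ ξ ^ 2 := by rw [Finset.sum_mul]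
        rw [e2] at hsum
        have e3 : ∑ j, pd j ζ ξ * (mfun b f ξ * (∑ i, pd i f ξ ^ 2) * pd j ζ ξ) =
            mfun b f ξ * ((∑ i, pd i f ξ ^ 2) * ∑ j, pd j ζ ξ ^ 2) := by
          simp only [Finset.mul_sum]
          exact Finset.sum_congr rfl fun j _ => by
            rw [← Finset.mul_sum]; simp only [Finset.sum_mul, Finset.mul_sum]
            exact Finset.sum_congr rfl fun i _ => by ring
        rw [e3]
        simp only [hpd]
        have h5 : (1 / 2) * (ζ ξ ^ 2 * qfun b f k ξ) -
            2 * ((∑ i, pd i f ξ ^ 2) * ∑ j, pd j ζ ξ ^ 2) ≤ ζ ξ * ζ ξ * qfun b f k ξ +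
            ∑ i, ∑ j, efun f k i j ξ * pd i f ξ * (2 * ζ ξ * pd j ζ ξ) := by
          have h6 := mul_le_mul_of_nonneg_left hq (sq_nonneg (ζ ξ))
          nlinarith
        have h7 := mul_le_mul_of_nonneg_left h5 hm
        linarith
      · have z1 : ζ ξ = 0 := image_eq_zero_of_notMem_tsupport hξ
        have z2 : ∀ j, pd j ζ ξ = 0 := fun j => pd_eq_zero_of_notMem_tsupport j hξ
        simp [z1, z2, hpd]
  rw [integral_sub (h1.const_mul _) ((integrable_finsetSum _ fun j _ => h2 j).const_mul _),
    integral_const_mul, integral_const_mul, integral_finsetSum _ fun j _ => h2 j] at hle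
  linarith

end CutoffEstimate

lemma exists_deriv_smoothTransition_bound :
    ∃ C > 0, ∀ x, |deriv Real.smoothTransition x| ≤ C ∧
      (x < 0 ∨ 1 < x → deriv Real.smoothTransition x = 0) := by
  have hcont : Continuous (deriv Real.smoothTransition) :=
    (Real.smoothTransition.contDiff (n := 1)).continuous_deriv (by norm_num)
  obtain ⟨C, hC⟩ := (isCompact_Icc.image (f := fun x => |deriv Real.smoothTransition x|)
    (s := Icc 0 1) hcont.abs).bddAbove
  have hz : ∀ x, x < 0 ∨ 1 < x → deriv Real.smoothTransition x = 0 := fun x hx => by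
    rcases hx with hx | hx
    · have : Real.smoothTransition =ᶠ[𝓝 x] fun _ => 0 := by
        filter_upwards [gt_mem_nhds hx] with y hy
          using Real.smoothTransition.zero_of_nonpos (le_of_lt hy)
      rw [this.deriv_eq, deriv_const]
    · have : Real.smoothTransition =ᶠ[𝓝 x] fun _ => 1 := by
        filter_upwards [lt_mem_nhds hx] with y hy
          using Real.smoothTransition.one_of_one_le (le_of_lt hy)
      rw [this.deriv_eq, deriv_const]
  refine ⟨max C 1, by positivity, fun x => ⟨?_, hz x⟩⟩
  by_cases hx : x < 0 ∨ 1 < x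
  · rw [hz x hx]; simp
  · push Not at hx
    exact le_max_of_le_left (hC ⟨x, hx, rfl⟩)

/-- One dimensional cutoff to `|s| ≤ 2R`, and to `s ≥ ε` if `w` holds. -/
noncomputable def cutoff₁ (R ε : ℝ) (w : Prop) [Decidable w] (s : ℝ) : ℝ :=
  Real.smoothTransition (2 - s / R) * Real.smoothTransition (2 + s / R) *
    if w then Real.smoothTransition (s / ε - 1) else 1

section Cutoff₁

variable {R ε : ℝ} (w : Prop) [Decidable w]

lemma contDiff_cutoff₁ {n : ℕ∞} : ContDiff ℝ n (cutoff₁ R ε w) := by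
  unfold cutoff₁
  refine ContDiff.mul (ContDiff.mul ?_ ?_) ?_
  · exact Real.smoothTransition.contDiff.comp (by fun_prop)
  · exact Real.smoothTransition.contDiff.comp (by fun_prop)
  · split_ifs
    · exact Real.smoothTransition.contDiff.comp (by fun_prop)
    · exact contDiff_const

lemma cutoff₁_nonneg (s : ℝ) : 0 ≤ cutoff₁ R ε w s := by
  unfold cutoff₁
  refine mul_nonneg (mul_nonneg (Real.smoothTransition.nonneg _)
    (Real.smoothTransition.nonneg _)) ?_
  split_ifs
  · exact Real.smoothTransition.nonneg _
  · exact zero_le_one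

lemma cutoff₁_le_one (s : ℝ) : cutoff₁ R ε w s ≤ 1 := by
  unfold cutoff₁
  refine mul_le_one₀ (mul_le_one₀ (Real.smoothTransition.le_one _)
    (Real.smoothTransition.nonneg _) (Real.smoothTransition.le_one _)) ?_ ?_
  · split_ifs
    · exact Real.smoothTransition.nonneg _
    · exact zero_le_one
  · split_ifs
    · exact Real.smoothTransition.le_one _
    · exact le_rfl

lemma cutoff₁_support (hR : 0 < R) (hε : 0 < ε) {s : ℝ} (h : cutoff₁ R ε w s ≠ 0) :
    |s| ≤ 2 * R ∧ (w → ε ≤ s) := by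
  unfold cutoff₁ at h
  have h1 := left_ne_zero_of_mul (left_ne_zero_of_mul h)
  have h2 := right_ne_zero_of_mul (left_ne_zero_of_mul h)
  have h3 := right_ne_zero_of_mul h
  refine ⟨abs_le.2 ⟨?_, ?_⟩, fun hw => ?_⟩
  · by_contra! hlt
    refine h2 (Real.smoothTransition.zero_of_nonpos ?_)
    have : s / R < -2 := by rw [div_lt_iff₀ hR]; linarith
    linarith
  · by_contra! hlt
    refine h1 (Real.smoothTransition.zero_of_nonpos ?_)
    have : 2 < s / R := by rw [lt_div_iff₀ hR]; linarith
    linarith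
  · by_contra! hlt
    rw [if_pos hw] at h3
    refine h3 (Real.smoothTransition.zero_of_nonpos ?_)
    have : s / ε < 1 := by rw [div_lt_one hε]; exact hlt
    linarith

lemma cutoff₁_eq_one (hR : 0 < R) (hε : 0 < ε) {s : ℝ} (h1 : |s| ≤ R) (h2 : w → 2 * ε ≤ s) :
    cutoff₁ R ε w s = 1 := by
  obtain ⟨h3, h4⟩ := abs_le.1 h1
  have h5 : -1 ≤ s / R := by rw [le_div_iff₀ hR]; linarith
  have h6 : s / R ≤ 1 := by rw [div_le_iff₀ hR]; linarith
  unfold cutoff₁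
  rw [Real.smoothTransition.one_of_one_le (by linarith),
    Real.smoothTransition.one_of_one_le (by linarith)]
  split_ifs with hw
  · have h7 : 2 ≤ s / ε := by rw [le_div_iff₀ hε]; linarith [h2 hw]
    rw [Real.smoothTransition.one_of_one_le (by linarith)]; norm_num
  · norm_num

lemma deriv_cutoff₁_bound {C : ℝ} (hC : 0 < C)
    (hC' : ∀ x, |deriv Real.smoothTransition x| ≤ C ∧
      (x < 0 ∨ 1 < x → deriv Real.smoothTransition x = 0)) (hR : 0 < R) (hε : 0 < ε) (s : ℝ) :
    |deriv (cutoff₁ R ε w) s| ≤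
      (if R ≤ |s| then 2 * C / R else 0) + if w ∧ s ≤ 2 * ε then C / ε else 0 := by
  have hst : ∀ x, HasDerivAt Real.smoothTransition (deriv Real.smoothTransition x) x := fun x =>
    ((Real.smoothTransition.contDiff (n := 1)).differentiable (by simp) x).hasDerivAt
  have d1 : HasDerivAt (fun s : ℝ => Real.smoothTransition (2 - s / R))
      (deriv Real.smoothTransition (2 - s / R) * (-(1 / R))) s :=
    (hst _).comp s (((hasDerivAt_id s).div_const R).const_sub 2)
  have d2 : HasDerivAt (fun s : ℝ => Real.smoothTransition (2 + s / R))
      (deriv Real.smoothTransition (2 + s / R) * (1 / R)) s :=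
    (hst _).comp s (((hasDerivAt_id s).div_const R).const_add 2)
  have d3 : HasDerivAt (fun s : ℝ => if w then Real.smoothTransition (s / ε - 1) else 1)
      (if w then deriv Real.smoothTransition (s / ε - 1) * (1 / ε) else 0) s := by
    split_ifs
    · exact (hst _).comp s (((hasDerivAt_id s).div_const ε).sub_const 1)
    · exact hasDerivAt_const _ _
  have hd := ((d1.mul d2).mul d3).deriv
  have hd' : deriv (cutoff₁ R ε w) s = _ := hd
  rw [hd']
  simp only [Pi.mul_apply]
  set a := Real.smoothTransition (2 - s / R)
  set a' := deriv Real.smoothTransition (2 - s / R) with ha'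
  set c := Real.smoothTransition (2 + s / R)
  set c' := deriv Real.smoothTransition (2 + s / R) with hc'
  set e := (if w then Real.smoothTransition (s / ε - 1) else 1) with he
  set e' := (if w then deriv Real.smoothTransition (s / ε - 1) * (1 / ε) else 0) with he'
  have ha1 : |a| ≤ 1 := by
    rw [abs_of_nonneg (Real.smoothTransition.nonneg _)]; exact Real.smoothTransition.le_one _
  have hc1 : |c| ≤ 1 := by
    rw [abs_of_nonneg (Real.smoothTransition.nonneg _)]; exact Real.smoothTransition.le_one _
  have he1 : |e| ≤ 1 := by
    rw [he]; split_ifs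
    · rw [abs_of_nonneg (Real.smoothTransition.nonneg _)]; exact Real.smoothTransition.le_one _
    · simp
  have hRi : 0 < 1 / R := by positivity
  have b1 : |a' * (-(1 / R)) * c + a * (c' * (1 / R))| ≤ if R ≤ |s| then 2 * C / R else 0 := by
    split_ifs with hs
    · calc |a' * (-(1 / R)) * c + a * (c' * (1 / R))|
          ≤ |a' * (-(1 / R)) * c| + |a * (c' * (1 / R))| := abs_add_le _ _
        _ = |a'| * (1 / R) * |c| + |a| * (|c'| * (1 / R)) := by
          simp only [abs_mul, abs_neg, abs_of_pos hRi]
        _ ≤ C * (1 / R) * 1 + 1 * (C * (1 / R)) := by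
          have := (hC' (2 - s / R)).1
          have := (hC' (2 + s / R)).1
          gcongr
        _ = 2 * C / R := by ring
    · push Not at hs
      obtain ⟨h3, h4⟩ := abs_lt.1 hs
      have h5 : -1 < s / R := by rw [lt_div_iff₀ hR]; linarith
      have h6 : s / R < 1 := by rw [div_lt_iff₀ hR]; linarith
      have e1 : a' = 0 := (hC' _).2 (Or.inr (by linarith))
      have e2 : c' = 0 := (hC' _).2 (Or.inr (by linarith))
      rw [e1, e2]; simp
  have b2 : |e'| ≤ if w ∧ s ≤ 2 * ε then C / ε else 0 := by
    rw [he']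
    by_cases hw : w
    · rw [if_pos hw]
      split_ifs with hs
      · rw [abs_mul, abs_of_pos (show 0 < 1 / ε by positivity), div_eq_mul_one_div C]
        have := (hC' (s / ε - 1)).1
        gcongr
      · have h7 : 2 < s / ε := by
          rw [lt_div_iff₀ hε]
          by_contra! h
          exact hs ⟨hw, by linarith⟩
        rw [(hC' _).2 (Or.inr (by linarith))]; simp
    · simp [hw]
  calc |(a' * (-(1 / R)) * c + a * (c' * (1 / R))) * e + a * c * e'|
      ≤ |(a' * (-(1 / R)) * c + a * (c' * (1 / R))) * e| + |a * c * e'| := abs_add_le _ _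
    _ = |a' * (-(1 / R)) * c + a * (c' * (1 / R))| * |e| + |a| * |c| * |e'| := by
      simp only [abs_mul]
    _ ≤ |a' * (-(1 / R)) * c + a * (c' * (1 / R))| * 1 + 1 * 1 * |e'| := by gcongr
    _ ≤ _ := by linarith

end Cutoff₁

/-- The cutoff to a large box away from the coordinate hyperplanes. -/
noncomputable def cutoff (b : ι → ℝ) [∀ i, Decidable (b i ≠ 0)] (R ε : ℝ) (ξ : ι → ℝ) : ℝ :=
  ∏ i, cutoff₁ R ε (b i ≠ 0) (ξ i)

section Cutoff

variable [∀ i, Decidable (b i ≠ 0)] {R ε : ℝ}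

lemma contDiff_cutoff {n : ℕ∞} : ContDiff ℝ n (cutoff b R ε) := by
  unfold cutoff
  exact contDiff_prod fun i _ => (contDiff_cutoff₁ _).comp (contDiff_apply ℝ ℝ i)

lemma tsupport_cutoff (hR : 0 < R) (hε : 0 < ε) :
    tsupport (cutoff b R ε) ⊆ {ξ | ∀ i, |ξ i| ≤ 2 * R ∧ (b i ≠ 0 → ε ≤ ξ i)} := by
  have hcl : IsClosed {ξ : ι → ℝ | ∀ i, |ξ i| ≤ 2 * R ∧ (b i ≠ 0 → ε ≤ ξ i)} := by
    have : {ξ : ι → ℝ | ∀ i, |ξ i| ≤ 2 * R ∧ (b i ≠ 0 → ε ≤ ξ i)} =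
        ⋂ i, ({ξ : ι → ℝ | |ξ i| ≤ 2 * R} ∩ ⋂ (_ : b i ≠ 0), {ξ : ι → ℝ | ε ≤ ξ i}) := by
      ext; simp
    rw [this]
    exact isClosed_iInter fun i =>
      (isClosed_le (continuous_apply i).abs continuous_const).inter
        (isClosed_iInter fun _ => isClosed_le continuous_const (continuous_apply i))
  refine closure_minimal (fun ξ h i => ?_) hcl
  exact cutoff₁_support _ hR hε (Finset.prod_ne_zero_iff.1 h i (Finset.mem_univ i))

lemma hasCompactSupport_cutoff (hR : 0 < R) (hε : 0 < ε) :
    HasCompactSupport (cutoff b R ε) := by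
  refine (isCompact_Icc (a := fun _ : ι => -(2 * R)) (b := fun _ => 2 * R)).of_isClosed_subset
    (isClosed_tsupport _) fun ξ h => ?_
  have h1 := tsupport_cutoff hR hε h
  exact ⟨fun i => (abs_le.1 (h1 i).1).1, fun i => (abs_le.1 (h1 i).1).2⟩

lemma tsupport_cutoff_posOrth (hR : 0 < R) (hε : 0 < ε) :
    tsupport (cutoff b R ε) ⊆ posOrth b := fun _ h i hi =>
  hε.trans_le ((tsupport_cutoff hR hε h i).2 hi)

lemma abs_pd_cutoff_le (j : ι) (ξ : ι → ℝ) :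
    |pd j (cutoff b R ε) ξ| ≤ |deriv (cutoff₁ R ε (b j ≠ 0)) (ξ j)| := by
  have hline : ∀ s : ℝ, cutoff b R ε (update ξ j s) = cutoff₁ R ε (b j ≠ 0) s *
      ∏ i ∈ Finset.univ.erase j, cutoff₁ R ε (b i ≠ 0) (ξ i) := fun s => by
    unfold cutoff
    rw [← Finset.mul_prod_erase _ _ (Finset.mem_univ j), update_self]
    congr 1
    exact Finset.prod_congr rfl fun i hi => by rw [update_of_ne (Finset.ne_of_mem_erase hi)]
  rw [pd]
  simp only [hline]
  have hd : DifferentiableAt ℝ (cutoff₁ R ε (b j ≠ 0)) (ξ j) :=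
    (contDiff_cutoff₁ (n := 1) (b j ≠ 0)).differentiable (by simp) _
  rw [deriv_mul_const hd, abs_mul]
  refine mul_le_of_le_one_right (abs_nonneg _) ?_
  rw [Finset.abs_prod]
  refine Finset.prod_le_one (fun i _ => abs_nonneg _) fun i _ => ?_
  rw [abs_of_nonneg (cutoff₁_nonneg _ _)]
  exact cutoff₁_le_one _ _

lemma cutoff_eq_one (hR : 0 < R) (hε : 0 < ε) {ξ : ι → ℝ} (h1 : ∀ i, |ξ i| ≤ R)
    (h2 : ∀ i, b i ≠ 0 → 2 * ε ≤ ξ i) : cutoff b R ε ξ = 1 :=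
  Finset.prod_eq_one fun i _ => cutoff₁_eq_one _ hR hε (h1 i) (h2 i)

end Cutoff

end

/-! ### Vanishing of the trace free Hessian under quadratic growth. -/

section

variable {ι : Type*} [Fintype ι] [DecidableEq ι] {b : ι → ℝ} {f : (ι → ℝ) → ℝ} {k : ℝ}

lemma integral_le_of_le_indicator {g : (ι → ℝ) → ℝ} (hg : Integrable g) {a₁ b₁ a₂ b₂ : ι → ℝ}
    {c₁ c₂ : ℝ} (h₁ : a₁ ≤ b₁) (h₂ : a₂ ≤ b₂)
    (h : ∀ ξ, g ξ ≤ (Icc a₁ b₁).indicator (fun _ => c₁) ξ + (Icc a₂ b₂).indicator (fun _ => c₂) ξ) :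
    ∫ ξ, g ξ ≤ (∏ i, (b₁ i - a₁ i)) * c₁ + (∏ i, (b₂ i - a₂ i)) * c₂ := by
  have hint : ∀ (a b : ι → ℝ) (c : ℝ), Integrable ((Icc a b).indicator fun _ => c) :=
    fun a b c => (integrable_indicator_iff measurableSet_Icc).2
      (integrableOn_const (isCompact_Icc.measure_lt_top.ne))
  refine (integral_mono hg ((hint _ _ _).add (hint _ _ _)) h).trans_eq ?_
  simp only [Pi.add_apply]
  rw [integral_add (hint _ _ _) (hint _ _ _), integral_indicator_const _ measurableSet_Icc,
    integral_indicator_const _ measurableSet_Icc, measureReal_def, measureReal_def,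
    Real.volume_Icc_pi_toReal h₁, Real.volume_Icc_pi_toReal h₂, smul_eq_mul, smul_eq_mul]

lemma rpow_mul_grad_le {N c₁ C₁ φ G s : ℝ} (hN : 2 < N) (hc₁ : 0 < c₁)
    (hs : 0 < s) (hφ : c₁ * s ≤ φ) (hG0 : 0 ≤ G) (hG : G ≤ C₁ * s) :
    φ ^ (1 - N) * G ≤ c₁ ^ (1 - N) * C₁ * s ^ (2 - N) := by
  have h1 : φ ^ (1 - N) ≤ c₁ ^ (1 - N) * s ^ (1 - N) := by
    rw [← Real.mul_rpow hc₁.le hs.le]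
    exact Real.rpow_le_rpow_of_nonpos (by positivity) hφ (by linarith)
  calc φ ^ (1 - N) * G ≤ c₁ ^ (1 - N) * s ^ (1 - N) * (C₁ * s) :=
        mul_le_mul h1 hG hG0 (by positivity)
    _ = c₁ ^ (1 - N) * C₁ * (s ^ (1 - N) * s) := by ring
    _ = _ := by
      rw [← Real.rpow_add_one hs.ne']; congr 2; ring

lemma weight_le {R : ℝ} (hb : ∀ i, 0 ≤ b i) {ξ : ι → ℝ} (hξ : ξ ∈ posOrth b) (h : ∀ i, |ξ i| ≤ 2 * R) :
    weight b ξ ≤ ∏ i, (2 * R) ^ b i := by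
  refine Finset.prod_le_prod (fun i _ => ?_) fun i _ => ?_
  · by_cases hi : b i = 0
    · simp [hi]
    · exact Real.rpow_nonneg (hξ i hi).le _
  · by_cases hi : b i = 0
    · simp [hi]
    · exact Real.rpow_le_rpow (hξ i hi).le ((le_abs_self _).trans (h i)) (hb i)

lemma weight_le_slab {R ε : ℝ} (hb : ∀ i, 0 ≤ b i) {ξ : ι → ℝ} (hξ : ξ ∈ posOrth b)
    (h : ∀ i, |ξ i| ≤ 2 * R) {j : ι} (hj : b j ≠ 0) (hjε : ξ j ≤ 2 * ε) :
    weight b ξ ≤ (2 * ε) ^ b j * ∏ i ∈ Finset.univ.erase j, (2 * R) ^ b i := by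
  unfold weight
  rw [← Finset.mul_prod_erase _ _ (Finset.mem_univ j)]
  have h0 : ∀ i, 0 ≤ ξ i ^ b i := fun i => by
    by_cases hi : b i = 0
    · simp [hi]
    · exact Real.rpow_nonneg (hξ i hi).le _
  refine mul_le_mul (Real.rpow_le_rpow (hξ j hj).le hjε (hb j))
    (Finset.prod_le_prod (fun i _ => h0 i) fun i _ => ?_) (Finset.prod_nonneg fun i _ => h0 i)
    (Real.rpow_nonneg ((hξ j hj).le.trans hjε) _)
  by_cases hi : b i = 0
  · simp [hi]
  · exact Real.rpow_le_rpow (hξ i hi).le ((le_abs_self _).trans (h i)) (hb i)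

section Rigidity

variable (hb : ∀ i, 0 ≤ b i) (hb1 : ∀ i, b i = 0 ∨ 1 < b i) (hN : 2 < hdim b)
  (hf : ContDiff ℝ 2 f) (hf0 : ∀ ξ, 0 < f ξ)
  (heq : ∀ ξ ∈ posOrth b, ∑ i, (pd i (pd i f) ξ + b i * (pd i f ξ / ξ i)) =
      hdim b / 2 * pfun f k ξ)
  {c₁ C₁ : ℝ} (hc₁ : 0 < c₁) (hlow : ∀ ξ, c₁ * (1 + nsq ξ) ≤ f ξ)
  (hgrad : ∀ ξ, ∑ i, pd i f ξ ^ 2 ≤ C₁ * (1 + nsq ξ))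

-- The derivative of the cutoff lives in two regions. Where |ξ_j| ≥ R it is of size 1/R and
-- f^(1−N)|∇f|² is of order (R²)^(2−N); in the slab 0 < ξ_j ≤ 2ε of a weighted coordinate it is of
-- size 1/ε and the weight contributes (2ε)^(b_j). Each region lies in a box whose volume is
-- explicit.
include hb hN hf hf0 hc₁ hlow hgrad in
lemma integral_grad_cutoff_le [∀ i, Decidable (b i ≠ 0)] {C : ℝ} (hC : 0 < C)
    (hC' : ∀ x, |deriv Real.smoothTransition x| ≤ C ∧
      (x < 0 ∨ 1 < x → deriv Real.smoothTransition x = 0))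
    {R ε : ℝ} (hR : 1 ≤ R) (hε : 0 < ε) (j : ι) :
    ∫ ξ, pd j (cutoff b R ε) ξ * (mfun b f ξ * (∑ i, pd i f ξ ^ 2) * pd j (cutoff b R ε) ξ) ≤
      (4 * R) ^ Fintype.card ι * ((∏ i, (2 * R) ^ b i) * (c₁ ^ (1 - hdim b) * C₁ *
        (R ^ 2) ^ (2 - hdim b)) * (2 * (2 * C / R) ^ 2)) +
      (2 * ε * ∏ _i ∈ Finset.univ.erase j, (4 * R)) * if b j ≠ 0 then
        ((2 * ε) ^ b j * ∏ i ∈ Finset.univ.erase j, (2 * R) ^ b i) *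
          (c₁ ^ (1 - hdim b) * C₁) * (2 * (C / ε) ^ 2) else 0 := by
  have hR0 : 0 < R := by linarith
  have hC₁ : 0 ≤ C₁ := by
    have := (Finset.sum_nonneg fun i _ => sq_nonneg (pd i f 0)).trans (hgrad 0)
    rw [nsq_zero] at this; linarith
  have hint := integrable_cutoff_grad (b := b) hf hf0 (contDiff_cutoff (R := R) (ε := ε) (n := 1))
    (hasCompactSupport_cutoff hR0 hε) (tsupport_cutoff_posOrth hR0 hε) j
  have hle1 : (fun _ : ι => -(2 * R)) ≤ fun _ => 2 * R := fun _ => by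
    show -(2 * R) ≤ 2 * R
    linarith
  have hle2 : update (fun _ : ι => -(2 * R)) j 0 ≤ update (fun _ => 2 * R) j (2 * ε) := by
    intro i
    by_cases hi : i = j
    · subst hi; simp; linarith
    · simp [update_of_ne hi]; linarith
  refine (integral_le_of_le_indicator hint hle1 hle2
    (c₁ := (∏ i, (2 * R) ^ b i) * (c₁ ^ (1 - hdim b) * C₁ *
        (R ^ 2) ^ (2 - hdim b)) * (2 * (2 * C / R) ^ 2))
    (c₂ := if b j ≠ 0 then ((2 * ε) ^ b j * ∏ i ∈ Finset.univ.erase j, (2 * R) ^ b i) *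
          (c₁ ^ (1 - hdim b) * C₁) * (2 * (C / ε) ^ 2) else 0) fun ξ => ?_).trans_eq ?_
  · have hW : 0 ≤ ∏ i, (2 * R) ^ b i := Finset.prod_nonneg fun i _ => by positivity
    have hWj : 0 ≤ ∏ i ∈ Finset.univ.erase j, (2 * R) ^ b i :=
      Finset.prod_nonneg fun i _ => by positivity
    have hn1 : 0 ≤ (∏ i, (2 * R) ^ b i) * (c₁ ^ (1 - hdim b) * C₁ *
        (R ^ 2) ^ (2 - hdim b)) * (2 * (2 * C / R) ^ 2) := by positivity
    have hn2 : 0 ≤ if b j ≠ 0 then ((2 * ε) ^ b j * ∏ i ∈ Finset.univ.erase j, (2 * R) ^ b i) *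
          (c₁ ^ (1 - hdim b) * C₁) * (2 * (C / ε) ^ 2) else 0 := by
      split_ifs <;> positivity
    have hr : 0 ≤ (Icc (fun _ : ι => -(2 * R)) fun _ => 2 * R).indicator (fun _ =>
        (∏ i, (2 * R) ^ b i) * (c₁ ^ (1 - hdim b) * C₁ *
        (R ^ 2) ^ (2 - hdim b)) * (2 * (2 * C / R) ^ 2)) ξ := indicator_nonneg (fun _ _ => hn1) _
    have hr2 := indicator_nonneg (s := Icc (update (fun _ : ι => -(2 * R)) j 0)
      (update (fun _ => 2 * R) j (2 * ε))) (fun _ _ => hn2) ξ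
    by_cases hξ : ξ ∈ tsupport (cutoff b R ε)
    · have hp := tsupport_cutoff_posOrth hR0 hε hξ
      have hbox := tsupport_cutoff hR0 hε hξ
      have hd := (abs_pd_cutoff_le (b := b) (R := R) (ε := ε) j ξ).trans
        (deriv_cutoff₁_bound (b j ≠ 0) hC hC' hR0 hε (ξ j))
      have hmem : ξ ∈ Icc (fun _ : ι => -(2 * R)) fun _ => 2 * R :=
        ⟨fun i => (abs_le.1 (hbox i).1).1, fun i => (abs_le.1 (hbox i).1).2⟩
      have hs1 : 1 ≤ 1 + nsq ξ := by linarith [nsq_nonneg ξ]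
      have hs0 : 0 < 1 + nsq ξ := by linarith
      have hG0 : 0 ≤ ∑ i, pd i f ξ ^ 2 := Finset.sum_nonneg fun i _ => sq_nonneg _
      have hG := rpow_mul_grad_le hN hc₁ hs0 (hlow ξ) hG0 (hgrad ξ)
      set A := if R ≤ |ξ j| then 2 * C / R else 0 with hA
      set B := if b j ≠ 0 ∧ ξ j ≤ 2 * ε then C / ε else 0 with hB
      have hA0 : 0 ≤ A := by rw [hA]; split_ifs <;> positivity
      have hB0 : 0 ≤ B := by rw [hB]; split_ifs <;> positivity
      have hsq : pd j (cutoff b R ε) ξ ^ 2 ≤ 2 * A ^ 2 + 2 * B ^ 2 := by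
        rw [← sq_abs]
        nlinarith [abs_nonneg (pd j (cutoff b R ε) ξ), sq_nonneg (A - B)]
      have hw0 := weight_nonneg hp
      have hX0 : 0 ≤ f ξ ^ (1 - hdim b) * ∑ i, pd i f ξ ^ 2 :=
        mul_nonneg (Real.rpow_nonneg (hf0 ξ).le _) hG0
      have hcC : 0 ≤ c₁ ^ (1 - hdim b) * C₁ := by positivity
      have t1 : weight b ξ * (f ξ ^ (1 - hdim b) * ∑ i, pd i f ξ ^ 2) * (2 * A ^ 2) ≤
          (Icc (fun _ : ι => -(2 * R)) fun _ => 2 * R).indicator (fun _ =>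
          (∏ i, (2 * R) ^ b i) * (c₁ ^ (1 - hdim b) * C₁ *
          (R ^ 2) ^ (2 - hdim b)) * (2 * (2 * C / R) ^ 2)) ξ := by
        by_cases hRj : R ≤ |ξ j|
        · rw [indicator_of_mem hmem, hA, if_pos hRj]
          refine mul_le_mul_of_nonneg_right (mul_le_mul (weight_le hb hp fun i => (hbox i).1)
            (hG.trans (mul_le_mul_of_nonneg_left ?_ hcC)) hX0 hW) (by positivity)
          refine Real.rpow_le_rpow_of_nonpos (by positivity) ?_ (by linarith)
          have h1 : R ^ 2 ≤ ξ j ^ 2 := by rw [← sq_abs (ξ j)]; gcongr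
          linarith [sq_le_nsq ξ j]
        · rw [hA, if_neg hRj]; simpa using hr
      have t2 : weight b ξ * (f ξ ^ (1 - hdim b) * ∑ i, pd i f ξ ^ 2) * (2 * B ^ 2) ≤
          (Icc (update (fun _ : ι => -(2 * R)) j 0)
          (update (fun _ => 2 * R) j (2 * ε))).indicator (fun _ => if b j ≠ 0 then
          ((2 * ε) ^ b j * ∏ i ∈ Finset.univ.erase j, (2 * R) ^ b i) *
          (c₁ ^ (1 - hdim b) * C₁) * (2 * (C / ε) ^ 2) else 0) ξ := by
        by_cases hbj : b j ≠ 0 ∧ ξ j ≤ 2 * ε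
        · have hmem2 : ξ ∈ Icc (update (fun _ : ι => -(2 * R)) j 0)
              (update (fun _ => 2 * R) j (2 * ε)) := by
            refine ⟨fun i => ?_, fun i => ?_⟩ <;> by_cases hi : i = j
            · subst hi; simpa using (hp i hbj.1).le
            · simpa [update_of_ne hi] using (abs_le.1 (hbox i).1).1
            · subst hi; simpa using hbj.2
            · simpa [update_of_ne hi] using (abs_le.1 (hbox i).1).2
          rw [indicator_of_mem hmem2, if_pos hbj.1, hB, if_pos hbj]
          refine mul_le_mul_of_nonneg_right (mul_le_mul
            (weight_le_slab hb hp (fun i => (hbox i).1) hbj.1 hbj.2)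
            (hG.trans (mul_le_of_le_one_right hcC ?_)) hX0 (by positivity)) (by positivity)
          exact Real.rpow_le_one_of_one_le_of_nonpos hs1 (by linarith)
        · rw [hB, if_neg hbj]; simpa using hr2
      have e1 : pd j (cutoff b R ε) ξ * (mfun b f ξ * (∑ i, pd i f ξ ^ 2) *
          pd j (cutoff b R ε) ξ) = weight b ξ * (f ξ ^ (1 - hdim b) * ∑ i, pd i f ξ ^ 2) *
          pd j (cutoff b R ε) ξ ^ 2 := by
        rw [mfun]; ring
      rw [e1]
      have := mul_le_mul_of_nonneg_left hsq (mul_nonneg hw0 hX0)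
      linarith
    · rw [pd_eq_zero_of_notMem_tsupport j hξ, zero_mul]
      exact add_nonneg hr hr2
  · have e1 : ∏ i, ((fun _ : ι => 2 * R) i - (fun _ : ι => -(2 * R)) i) =
        (4 * R) ^ Fintype.card ι := by
      simp only [Finset.prod_const, Finset.card_univ]; congr 1; ring
    have e2 : ∏ i, (update (fun _ : ι => 2 * R) j (2 * ε) i -
        update (fun _ : ι => -(2 * R)) j 0 i) =
        2 * ε * ∏ _i ∈ Finset.univ.erase j, (4 * R) := by
      rw [← Finset.mul_prod_erase _ _ (Finset.mem_univ j), update_self, update_self, sub_zero]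
      congr 1
      refine Finset.prod_congr rfl fun i hi => ?_
      rw [update_of_ne (Finset.ne_of_mem_erase hi), update_of_ne (Finset.ne_of_mem_erase hi)]
      ring
    rw [e1, e2]

/-- Counting powers of R: the volume and the weight give N, the growth of f gives 2(2 − N), and the
cutoff gives −2. The total 2 − N is negative when N > 2. -/
lemma box_term_eq {C c R : ℝ} (hR : 0 < R) :
    (4 * R) ^ Fintype.card ι * ((∏ i, (2 * R) ^ b i) * (c * (R ^ 2) ^ (2 - hdim b)) *
      (2 * (2 * C / R) ^ 2)) =
    (4 ^ Fintype.card ι * (∏ i, (2 : ℝ) ^ b i) * c * (8 * C ^ 2)) * R ^ (-(hdim b - 2)) := by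
  have e1 : ∏ i, (2 * R) ^ b i = (∏ i, (2 : ℝ) ^ b i) * R ^ (∑ i, b i) := by
    rw [Real.rpow_sum_of_pos hR, ← Finset.prod_mul_distrib]
    exact Finset.prod_congr rfl fun i _ => Real.mul_rpow (by norm_num) hR.le
  have e2 : (R ^ 2) ^ (2 - hdim b) = R ^ (2 * (2 - hdim b)) := by
    rw [← Real.rpow_natCast, ← Real.rpow_mul hR.le]; norm_num
  have e3 : R ^ Fintype.card ι * R ^ (∑ i, b i) * R ^ (2 * (2 - hdim b)) * (R ^ 2)⁻¹ =
      R ^ (-(hdim b - 2)) := by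
    rw [← Real.rpow_natCast R (Fintype.card ι), ← Real.rpow_natCast R 2, ← Real.rpow_neg hR.le,
      ← Real.rpow_add hR, ← Real.rpow_add hR, ← Real.rpow_add hR]
    congr 1
    simp only [hdim, Finset.sum_add_distrib, Finset.sum_const, Finset.card_univ, nsmul_eq_mul]
    push_cast; ring
  rw [e1, e2, ← e3, mul_pow, div_pow]
  field_simp
  ring

/-- Slab width ε, weight ε^(b_j) and squared gradient ε^(−2) combine to ε^(b_j − 1), which tends to
0 because b_j > 1. This is where a_j > 1 is needed in the cutoff argument. -/
lemma tendsto_slab_term (hb1 : ∀ i, b i = 0 ∨ 1 < b i) (j : ι) (V W c C : ℝ)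
    [Decidable (b j ≠ 0)] :
    Tendsto (fun ε : ℝ => (2 * ε * V) * if b j ≠ 0 then
      ((2 * ε) ^ b j * W) * c * (2 * (C / ε) ^ 2) else 0) (𝓝[>] 0) (𝓝 0) := by
  split_ifs with hj
  · have h1 : 1 < b j := (hb1 j).resolve_left hj
    have h2 : Tendsto (fun ε : ℝ => 4 * V * W * c * C ^ 2 * 2 ^ b j * ε ^ (b j - 1)) (𝓝[>] 0)
        (𝓝 (4 * V * W * c * C ^ 2 * 2 ^ b j * (0 : ℝ) ^ (b j - 1))) :=
      ((Real.continuousAt_rpow_const 0 _ (Or.inr (by linarith))).tendsto.mono_left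
        nhdsWithin_le_nhds).const_mul _
    rw [Real.zero_rpow (by linarith), mul_zero] at h2
    refine h2.congr' ?_
    filter_upwards [self_mem_nhdsWithin] with ε hε
    have hε : 0 < ε := hε
    rw [Real.mul_rpow (by norm_num) hε.le, Real.rpow_sub_one hε.ne']
    field_simp
    ring
  · simp

include hb hb1 hN hf hf0 heq hc₁ hlow hgrad in
/-- Under quadratic growth the weighted trace free Hessian vanishes. -/
lemma qfun_eq_zero {ξ₀ : ι → ℝ} (hξ₀ : ξ₀ ∈ posOrth b) : qfun b f k ξ₀ = 0 := by
  classical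
  by_contra hne
  have hq : 0 < qfun b f k ξ₀ := lt_of_le_of_ne (qfun_nonneg hb ξ₀) (Ne.symm hne)
  have hm : 0 < mfun b f ξ₀ := by
    refine mul_pos (Finset.prod_pos fun i _ => ?_) (Real.rpow_pos_of_pos (hf0 _) _)
    by_cases h : b i = 0
    · simp [h]
    · exact Real.rpow_pos_of_pos (hξ₀ i h) _
  obtain ⟨C, hC, hC'⟩ := exists_deriv_smoothTransition_bound
  -- If `qfun` were positive at ξ₀, the left side of the Caccioppoli estimate would be at least a
  -- constant I > 0 for all large R and small ε.
  set κ := mfun b f ξ₀ * qfun b f k ξ₀ / 2 with hκ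
  have hκ0 : 0 < κ := by positivity
  have hcont : ContinuousAt (fun ξ => mfun b f ξ * qfun b f k ξ) ξ₀ :=
    (contDiffAt_mfun hf hf0 hξ₀).continuousAt.mul (continuousAt_qfun hf hf0 hξ₀)
  have hev1 : ∀ᶠ ξ in 𝓝 ξ₀, κ < mfun b f ξ * qfun b f k ξ :=
    hcont.eventually (lt_mem_nhds (by show κ < mfun b f ξ₀ * qfun b f k ξ₀; rw [hκ]; linarith [mul_pos hm hq]))
  obtain ⟨δ, hδ, hδξ⟩ : ∃ δ > 0, ∀ i, b i ≠ 0 → δ < ξ₀ i := by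
    have : ∀ᶠ δ in 𝓝[>] (0 : ℝ), ∀ i, b i ≠ 0 → δ < ξ₀ i := by
      rw [eventually_all]
      intro i
      by_cases hi : b i = 0
      · simp [hi]
      · filter_upwards [nhdsWithin_le_nhds (gt_mem_nhds (hξ₀ i hi))] with δ h _ using h
    obtain ⟨δ, h1, h2⟩ := (this.and self_mem_nhdsWithin).exists
    exact ⟨δ, h2, h1⟩
  have hev2 : ∀ᶠ ξ in 𝓝 ξ₀, ∀ i, b i ≠ 0 → δ < ξ i := by
    rw [eventually_all]
    intro i
    by_cases hi : b i = 0
    · simp [hi]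
    · filter_upwards [(continuous_apply i).continuousAt.eventually (lt_mem_nhds (hδξ i hi))]
        with ξ h _ using h
  obtain ⟨r, hr, hball⟩ := Metric.nhds_basis_closedBall.mem_iff.1 (hev1.and hev2)
  set I := κ * volume.real (Metric.closedBall ξ₀ r) with hI
  have hI0 : 0 < I := by
    refine mul_pos hκ0 ?_
    rw [measureReal_def]
    exact ENNReal.toReal_pos (Metric.measure_closedBall_pos volume ξ₀ hr).ne'
      (isCompact_closedBall ξ₀ r).measure_lt_top.ne
  set R₀ := max 1 (‖ξ₀‖ + r) with hR₀
  have key : ∀ R ≥ R₀, ∀ ε, 0 < ε → 2 * ε ≤ δ → I ≤ 4 * ∑ j, ((4 * R) ^ Fintype.card ι *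
      ((∏ i, (2 * R) ^ b i) * (c₁ ^ (1 - hdim b) * C₁ *
        (R ^ 2) ^ (2 - hdim b)) * (2 * (2 * C / R) ^ 2)) +
      (2 * ε * ∏ _i ∈ Finset.univ.erase j, (4 * R)) * if b j ≠ 0 then
        ((2 * ε) ^ b j * ∏ i ∈ Finset.univ.erase j, (2 * R) ^ b i) *
          (c₁ ^ (1 - hdim b) * C₁) * (2 * (C / ε) ^ 2) else 0) := by
    intro R hR ε hε hεδ
    have hR1 : 1 ≤ R := (le_max_left _ _).trans hR
    have hRp : 0 < R := by linarith
    have hsm := contDiff_cutoff (b := b) (R := R) (ε := ε) (n := 1)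
    have hcs := hasCompactSupport_cutoff (b := b) hRp hε
    have hts := tsupport_cutoff_posOrth (b := b) hRp hε
    refine le_trans ?_ ((cutoff_estimate hb hf hf0 heq hsm hcs hts).trans
      (mul_le_mul_of_nonneg_left (Finset.sum_le_sum fun j _ =>
        integral_grad_cutoff_le hb hN hf hf0 hc₁ hlow hgrad hC hC' hR1 hε j) (by norm_num)))
    have hIe : I = ∫ ξ, (Metric.closedBall ξ₀ r).indicator (fun _ => κ) ξ := by
      rw [integral_indicator_const _ measurableSet_closedBall, smul_eq_mul, hI, mul_comm]
    rw [hIe]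
    refine integral_mono ((integrable_indicator_iff measurableSet_closedBall).2
      (integrableOn_const (isCompact_closedBall ξ₀ r).measure_lt_top.ne))
      (integrable_cutoff_qfun hf hf0 hsm hcs hts) fun ξ => ?_
    by_cases hξ : ξ ∈ Metric.closedBall ξ₀ r
    · rw [indicator_of_mem hξ]
      obtain ⟨h1, h2⟩ := hball hξ
      have hone : cutoff b R ε ξ = 1 := by
        refine cutoff_eq_one hRp hε (fun i => ?_) fun i hi => hεδ.trans (h2 i hi).le
        calc |ξ i| ≤ ‖ξ‖ := norm_le_pi_norm ξ i
          _ = ‖ξ₀ + (ξ - ξ₀)‖ := by rw [add_sub_cancel]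
          _ ≤ ‖ξ₀‖ + ‖ξ - ξ₀‖ := norm_add_le _ _
          _ ≤ ‖ξ₀‖ + r := by gcongr; exact mem_closedBall_iff_norm.1 hξ
          _ ≤ R := (le_max_right _ _).trans hR
      rw [hone, one_mul, one_mul]
      exact h1.le
    · rw [indicator_of_notMem hξ]
      by_cases ht : ξ ∈ tsupport (cutoff b R ε)
      · have e : cutoff b R ε ξ * (cutoff b R ε ξ * mfun b f ξ * qfun b f k ξ) =
            cutoff b R ε ξ ^ 2 * (mfun b f ξ * qfun b f k ξ) := by ring
        show 0 ≤ cutoff b R ε ξ * (cutoff b R ε ξ * mfun b f ξ * qfun b f k ξ)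
        rw [e]
        exact mul_nonneg (sq_nonneg _) (mul_nonneg (mfun_nonneg hf0 (hts ht)) (qfun_nonneg hb ξ))
      · show 0 ≤ cutoff b R ε ξ * (cutoff b R ε ξ * mfun b f ξ * qfun b f k ξ)
        rw [image_eq_zero_of_notMem_tsupport ht, zero_mul]
  -- The limit ε → 0 is taken first, at fixed R, since the slab terms contain powers of R;
  -- afterwards R tends to infinity.
  have key2 : ∀ R ≥ R₀, I ≤ 4 * ∑ _j : ι, (4 ^ Fintype.card ι * (∏ i, (2 : ℝ) ^ b i) *
      (c₁ ^ (1 - hdim b) * C₁) * (8 * C ^ 2)) * R ^ (-(hdim b - 2)) := by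
    intro R hR
    have hRp : 0 < R := lt_of_lt_of_le zero_lt_one ((le_max_left _ _).trans hR)
    have hlim := (tendsto_finsetSum Finset.univ fun j (_ : j ∈ Finset.univ) =>
      (tendsto_slab_term hb1 j (∏ _i ∈ Finset.univ.erase j, (4 * R))
        (∏ i ∈ Finset.univ.erase j, (2 * R) ^ b i) (c₁ ^ (1 - hdim b) * C₁) C).const_add
        ((4 * R) ^ Fintype.card ι * ((∏ i, (2 * R) ^ b i) * (c₁ ^ (1 - hdim b) * C₁ *
        (R ^ 2) ^ (2 - hdim b)) * (2 * (2 * C / R) ^ 2)))).const_mul 4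
    have hle := ge_of_tendsto hlim (b := I) ?_
    · simpa only [add_zero, box_term_eq hRp] using hle
    · filter_upwards [self_mem_nhdsWithin,
        nhdsWithin_le_nhds (gt_mem_nhds (show (0 : ℝ) < δ / 2 by positivity))] with ε h1 h2
      exact key R hR ε h1 (by linarith)
  have hlim := (tendsto_finsetSum Finset.univ fun j (_ : j ∈ (Finset.univ : Finset ι)) =>
    ((tendsto_rpow_neg_atTop (show 0 < hdim b - 2 by linarith)).const_mul
      (4 ^ Fintype.card ι * (∏ i, (2 : ℝ) ^ b i) *
      (c₁ ^ (1 - hdim b) * C₁) * (8 * C ^ 2)))).const_mul 4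
  have := ge_of_tendsto hlim (b := I) (by
    filter_upwards [eventually_ge_atTop R₀] with R hR using key2 R hR)
  simp at this
  linarith

end Rigidity

end

/-! ### Classification of positive critical solutions. -/

section

variable {ι : Type*} [Fintype ι] [DecidableEq ι] {b : ι → ℝ} {p α : ℝ}

lemma pd_rpow {U : (ι → ℝ) → ℝ} (q : ℝ) (hU : ContDiff ℝ 1 U) (hpos : ∀ ξ, 0 < U ξ) (i : ι) :
    pd i (fun ξ => U ξ ^ q) = fun ξ => q * U ξ ^ (q - 1) * pd i U ξ := by
  ext ξ
  have h := (hasDerivAt_pd i (hU.differentiable (by simp) ξ)).rpow_const (p := q)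
    (Or.inl (hpos _).ne')
  refine h.deriv.trans ?_
  rw [update_eq_self]; ring

lemma pd_pd_rpow {U : (ι → ℝ) → ℝ} (q : ℝ) (hU : ContDiff ℝ 2 U) (hpos : ∀ ξ, 0 < U ξ) (i : ι)
    (ξ : ι → ℝ) :
    pd i (pd i fun ξ => U ξ ^ q) ξ =
      q * (q - 1) * U ξ ^ (q - 2) * pd i U ξ ^ 2 + q * U ξ ^ (q - 1) * pd i (pd i U) ξ := by
  have hU1 : ContDiff ℝ 1 U := hU.of_le (by norm_num)
  have hc : ContDiff ℝ 1 (fun ξ => q * U ξ ^ (q - 1)) :=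
    contDiff_const.mul (hU1.rpow_const_of_ne fun ξ => (hpos ξ).ne')
  have hd : ContDiff ℝ 1 (pd i U) := contDiff_pd i hU (by norm_num)
  rw [pd_rpow q hU1 hpos i, pd_mul i (hc.differentiable (by simp) ξ)
    (hd.differentiable (by simp) ξ)]
  have h := ((hasDerivAt_pd i (hU1.differentiable (by simp) ξ)).rpow_const (p := q - 1)
    (Or.inl (hpos _).ne')).const_mul q
  have h' : pd i (fun ξ => q * U ξ ^ (q - 1)) ξ = q * (q - 1) * U ξ ^ (q - 2) * pd i U ξ := by
    refine h.deriv.trans ?_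
    rw [update_eq_self, show q - 1 - 1 = q - 2 by ring]; ring
  rw [h']; ring

/-- The equation satisfied by `f = U ^ (-1/p)` for a critical solution `U`. -/
lemma WSol.rpow_equation {U : (ι → ℝ) → ℝ} (hp : 0 < p) (hp2 : 2 * p = hdim b - 2)
    (hcrit : p * α = p + 2) (hU : WSol b α U) (hpos : ∀ ξ, 0 < U ξ) {ξ : ι → ℝ}
    (hξ : ξ ∈ posOrth b) :
    ∑ i, (pd i (pd i fun ξ => U ξ ^ (-1 / p)) ξ + b i * (pd i (fun ξ => U ξ ^ (-1 / p)) ξ / ξ i)) =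
      hdim b / 2 * pfun (fun ξ => U ξ ^ (-1 / p)) (1 / (p * (p + 1))) ξ := by
  have hU1 : ContDiff ℝ 1 U := hU.smooth.of_le (by norm_num)
  set q := -1 / p with hq
  have hu := hpos ξ
  have heq := hU.eq ξ
  have hL : Lop b U ξ = ∑ i, (pd i (pd i U) ξ + b i * (pd i U ξ / ξ i)) := by
    refine Finset.sum_congr rfl fun i _ => ?_
    by_cases hi : b i = 0
    · simp [hi]
    · rw [radQ, if_neg (hξ i hi).ne']
  rw [hL] at heq
  have e1 : ∀ i, pd i (pd i fun ξ => U ξ ^ q) ξ + b i * (pd i (fun ξ => U ξ ^ q) ξ / ξ i) =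
      q * (q - 1) * U ξ ^ (q - 2) * pd i U ξ ^ 2 +
        q * U ξ ^ (q - 1) * (pd i (pd i U) ξ + b i * (pd i U ξ / ξ i)) := fun i => by
    rw [pd_pd_rpow q hU.smooth hpos, pd_rpow q hU1 hpos]; ring
  rw [Finset.sum_congr rfl fun i _ => e1 i, Finset.sum_add_distrib, ← Finset.mul_sum,
    ← Finset.mul_sum, heq, pfun]
  simp only [pd_rpow q hU1 hpos, mul_pow]
  rw [← Finset.mul_sum]
  have r1 : U ξ ^ (q - 2) = U ξ ^ q / U ξ ^ 2 := by
    rw [Real.rpow_sub hu, show (2 : ℝ) = (2 : ℕ) by norm_num, Real.rpow_natCast]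
  have r2 : U ξ ^ (q - 1) = U ξ ^ q / U ξ := by rw [Real.rpow_sub_one hu.ne']
  -- Criticality gives α + 2q = 1, which turns the nonlinearity into a multiple of 1/f; its
  -- coefficient 1/p equals (N/2)k for k = 1/(p(p + 1)).
  have r3 : U ξ ^ α = U ξ / (U ξ ^ q * U ξ ^ q) := by
    rw [← Real.rpow_add hu, eq_div_iff (Real.rpow_pos_of_pos hu _).ne', ← Real.rpow_add hu]
    have : α + (q + q) = 1 := by
      rw [hq]; field_simp; linarith
    rw [this, Real.rpow_one]
  have hv : 0 < U ξ ^ q := Real.rpow_pos_of_pos hu _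
  rw [r1, r2, r3, show hdim b = 2 * p + 2 by linarith, hq]
  rw [← hq]
  set v := U ξ ^ q
  set S := ∑ i, pd i U ξ ^ 2
  rw [hq]
  field_simp
  ring

/-- Bounds for f and ∇f on the compact ball |ξ|² ≤ L are carried to its exterior by the inversion.
-/
lemma quadratic_growth_of_inversion {f : (ι → ℝ) → ℝ} (hf : ContDiff ℝ 2 f)
    (hf0 : ∀ ξ, 0 < f ξ) {L : ℝ} (hL : 0 < L)
    (hinv : ∀ ξ ≠ 0, f ξ = nsq ξ / L * f (star L ξ)) :
    ∃ c₁ > 0, ∃ C₁, (∀ ξ, c₁ * (1 + nsq ξ) ≤ f ξ) ∧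
      ∀ ξ, ∑ i, pd i f ξ ^ 2 ≤ C₁ * (1 + nsq ξ) := by
  have hK := isCompact_nsq_le (ι := ι) L
  have hK0 : ({ξ : ι → ℝ | nsq ξ ≤ L}).Nonempty := ⟨0, show nsq 0 ≤ L by rw [nsq_zero]; exact hL.le⟩
  obtain ⟨z, -, hz⟩ := hK.exists_isMinOn hK0 hf.continuous.continuousOn
  obtain ⟨M, hM⟩ := (hK.image hf.continuous).bddAbove
  have hp : ∀ i, Continuous (pd i f) := fun i => (contDiff_pd (m := 0) i hf (by norm_num)).continuous
  obtain ⟨D, hD⟩ := (hK.image (f := fun ξ => ∑ l, |pd l f ξ|)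
    (continuous_finsetSum _ fun l _ => (hp l).abs)).bddAbove
  have hM' : ∀ ξ : ι → ℝ, nsq ξ ≤ L → f ξ ≤ M := fun ξ h => hM ⟨ξ, h, rfl⟩
  have hD' : ∀ ξ : ι → ℝ, nsq ξ ≤ L → ∑ l, |pd l f ξ| ≤ D := fun ξ h => hD ⟨ξ, h, rfl⟩
  have hm' : ∀ ξ : ι → ℝ, nsq ξ ≤ L → f z ≤ f ξ := fun ξ h => hz h
  have hD0 : 0 ≤ D := (Finset.sum_nonneg fun _ _ => abs_nonneg _).trans
    (hD' 0 (by rw [nsq_zero]; exact hL.le))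
  have hM0 : 0 ≤ M := (hf0 0).le.trans (hM' 0 (by rw [nsq_zero]; exact hL.le))
  have hstar : ∀ ξ : ι → ℝ, L ≤ nsq ξ → ξ ≠ 0 ∧ nsq (star L ξ) ≤ L := fun ξ h => by
    have h0 : ξ ≠ 0 := by rintro rfl; rw [nsq_zero] at h; linarith
    refine ⟨h0, ?_⟩
    rw [nsq_star h0, div_le_iff₀ (nsq_pos h0)]; nlinarith
  -- The upper constant comes from (X + Y)² ≤ 2X² + 2Y² applied to the two terms of ∂_j f outside
  -- the ball, bounded by 2M|ξ_j|/L and 3D.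
  refine ⟨f z / (1 + L), div_pos (hf0 z) (by linarith),
    8 * M ^ 2 / L ^ 2 + Fintype.card ι * (18 * D ^ 2), fun ξ => ?_, fun ξ => ?_⟩
  · rw [div_mul_eq_mul_div, div_le_iff₀ (by linarith)]
    rcases le_total (nsq ξ) L with h | h
    · have := hm' ξ h
      nlinarith [nsq_nonneg ξ, hf0 z]
    · obtain ⟨h0, h1⟩ := hstar ξ h
      rw [hinv ξ h0]
      have h2 := hm' _ h1
      have h3 : f z * (1 + nsq ξ) ≤ nsq ξ / L * f z * (1 + L) := by
        have : 1 + nsq ξ ≤ nsq ξ / L * (1 + L) := by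
          rw [div_mul_eq_mul_div, le_div_iff₀ hL]; nlinarith
        nlinarith [hf0 z]
      refine h3.trans ?_
      have : 0 ≤ nsq ξ / L := by positivity [nsq_nonneg ξ]
      gcongr
  · have hn := nsq_nonneg ξ
    have key : ∀ j, pd j f ξ ^ 2 ≤ 8 * M ^ 2 / L ^ 2 * ξ j ^ 2 + 18 * D ^ 2 := by
      intro j
      rcases le_total (nsq ξ) L with h | h
      · have h1 : |pd j f ξ| ≤ D := (Finset.single_le_sum (f := fun l => |pd l f ξ|)
          (fun _ _ => abs_nonneg _) (Finset.mem_univ j)).trans (hD' ξ h)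
        have h2 : pd j f ξ ^ 2 ≤ D ^ 2 := by rw [← sq_abs]; gcongr
        have h3 : 0 ≤ 8 * M ^ 2 / L ^ 2 * ξ j ^ 2 := by positivity
        nlinarith [sq_nonneg D]
      · obtain ⟨h0, h1⟩ := hstar ξ h
        have hnp := nsq_pos h0
        have hev : f =ᶠ[𝓝 ξ] fun η => nsq η / L * f (star L η) := by
          filter_upwards [isOpen_ne.mem_nhds h0] with η hη using hinv η hη
        have hline : ContinuousAt (fun s : ℝ => update ξ j s) (ξ j) :=
          (hasDerivAt_update ξ j (ξ j)).continuousAt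
        have hpd : pd j f ξ = pd j (fun η => nsq η / L * f (star L η)) ξ := by
          refine Filter.EventuallyEq.deriv_eq ?_
          have ht : Tendsto (fun s : ℝ => update ξ j s) (𝓝 (ξ j)) (𝓝 ξ) := by
            have := hline.tendsto; rwa [update_eq_self] at this
          exact ht.eventually hev
        have hd1 : DifferentiableAt ℝ (fun η : ι → ℝ => nsq η / L) ξ :=
          ((contDiff_nsq (ι := ι) (n := 1)).div_const L).differentiable (by simp) ξ
        have hd2 : DifferentiableAt ℝ (fun η => f (star L η)) ξ :=
          ((hf.differentiable (by simp)) _).comp ξ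
            ((contDiffAt_star h0 (n := 1)).differentiableAt (by simp))
        have hdn : pd j (fun η : ι → ℝ => nsq η / L) ξ = 2 * ξ j / L := by
          have : ∀ s : ℝ, nsq (update ξ j s) / L = (s ^ 2 + (nsq ξ - ξ j ^ 2)) / L := fun s => by
            rw [nsq_update]; ring
          rw [pd]; simp only [this]
          have := (((hasDerivAt_pow 2 (ξ j)).add_const (nsq ξ - ξ j ^ 2)).div_const L).deriv
          rw [this]; norm_num
        rw [hpd, pd_mul j hd1 hd2, hdn, (pd_comp_star hf h0 j).1,
          fderiv_apply_eq_sum_pd (hf.differentiable (by simp) _)]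
        -- The prefactor |ξ|²/L cancels the conformal factor of the inversion, leaving coefficients
        -- bounded by 3.
        have e1 : nsq ξ / L * ∑ i, ((-(2 * (L / nsq ξ) * ξ j / nsq ξ)) • ξ +
            (L / nsq ξ) • (Pi.single j 1 : ι → ℝ)) i * pd i f (star L ξ) =
            ∑ i, (-(2 * ξ j * ξ i / nsq ξ) + (Pi.single j 1 : ι → ℝ) i) * pd i f (star L ξ) := by
          rw [Finset.mul_sum]
          refine Finset.sum_congr rfl fun i _ => ?_
          simp only [Pi.add_apply, Pi.smul_apply, smul_eq_mul]
          field_simp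
        rw [e1]
        have e2 : |∑ i, (-(2 * ξ j * ξ i / nsq ξ) + (Pi.single j 1 : ι → ℝ) i) *
            pd i f (star L ξ)| ≤ 3 * D := by
          refine (Finset.abs_sum_le_sum_abs _ _).trans ?_
          refine le_trans (Finset.sum_le_sum (g := fun i => 3 * |pd i f (star L ξ)|)
            fun i _ => ?_) ?_
          · rw [abs_mul]
            refine mul_le_mul_of_nonneg_right ?_ (abs_nonneg _)
            have a1 : |2 * ξ j * ξ i / nsq ξ| ≤ 2 := by
              rw [abs_div, abs_of_pos hnp, div_le_iff₀ hnp]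
              have := sq_le_nsq ξ i
              have := sq_le_nsq ξ j
              rw [abs_le]; constructor <;>
                nlinarith [sq_nonneg (ξ i - ξ j), sq_nonneg (ξ i + ξ j)]
            have a2 : |(Pi.single j 1 : ι → ℝ) i| ≤ 1 := by
              by_cases hij : i = j
              · subst hij; simp
              · simp [hij]
            calc _ ≤ |-(2 * ξ j * ξ i / nsq ξ)| + |(Pi.single j 1 : ι → ℝ) i| := abs_add_le _ _
              _ ≤ 2 + 1 := by rw [abs_neg]; gcongr
              _ = 3 := by norm_num
          · rw [← Finset.mul_sum]; have := hD' _ h1; linarith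
        set X := ∑ i, (-(2 * ξ j * ξ i / nsq ξ) + (Pi.single j 1 : ι → ℝ) i) * pd i f (star L ξ)
        have e3 : X ^ 2 ≤ (3 * D) ^ 2 := by rw [← sq_abs]; gcongr
        have e4 : (2 * ξ j / L * f (star L ξ)) ^ 2 ≤ 4 * M ^ 2 / L ^ 2 * ξ j ^ 2 := by
          have a1 : f (star L ξ) ^ 2 ≤ M ^ 2 := by
            have := hM' _ h1; have := (hf0 (star L ξ)).le; gcongr
          calc (2 * ξ j / L * f (star L ξ)) ^ 2 = (4 * ξ j ^ 2 / L ^ 2) * f (star L ξ) ^ 2 := by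
                ring
            _ ≤ (4 * ξ j ^ 2 / L ^ 2) * M ^ 2 := by gcongr
            _ = _ := by ring
        have e5 : 8 * M ^ 2 / L ^ 2 * ξ j ^ 2 = 2 * (4 * M ^ 2 / L ^ 2 * ξ j ^ 2) := by ring
        rw [e5]
        nlinarith [sq_nonneg (2 * ξ j / L * f (star L ξ) - X)]
    refine (Finset.sum_le_sum fun j _ => key j).trans ?_
    rw [Finset.sum_add_distrib, ← Finset.mul_sum, Finset.sum_const, Finset.card_univ,
      nsmul_eq_mul]
    have h1 : 0 ≤ 8 * M ^ 2 / L ^ 2 := by positivity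
    have h2 : 0 ≤ (Fintype.card ι : ℝ) * (18 * D ^ 2) := by positivity
    have h3 : ∑ i, ξ i ^ 2 = nsq ξ := rfl
    rw [h3]
    nlinarith [mul_nonneg h2 hn]

lemma isOpen_posOrth : IsOpen (posOrth b) := by
  have : posOrth b = ⋂ i, {ξ : ι → ℝ | b i ≠ 0 → 0 < ξ i} := by ext; simp [posOrth]
  rw [this]
  refine isOpen_iInter_of_finite fun i => ?_
  by_cases hi : b i = 0
  · simp [hi]
  · simpa [hi] using isOpen_lt continuous_const (continuous_apply i)

lemma convex_posOrth : Convex ℝ (posOrth b) := by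
  intro x hx y hy s t hs ht hst i hi
  have h1 := hx i hi
  have h2 := hy i hi
  simp only [Pi.add_apply, Pi.smul_apply, smul_eq_mul]
  rcases hs.lt_or_eq with h | h
  · have := mul_pos h h1; have := mul_nonneg ht h2.le; linarith
  · have : t = 1 := by linarith
    subst this; rw [← h]; simpa using h2

lemma eq_of_pd_eq_zero {g : (ι → ℝ) → ℝ} (hg : ContDiff ℝ 1 g)
    (h : ∀ ξ ∈ posOrth b, ∀ j, pd j g ξ = 0) {ξ η : ι → ℝ} (hξ : ξ ∈ posOrth b)
    (hη : η ∈ posOrth b) : g ξ = g η := by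
  have hd := hg.differentiable (by simp)
  refine isOpen_posOrth.is_const_of_fderiv_eq_zero convex_posOrth.isPreconnected
    hd.differentiableOn (fun x hx => ?_) hξ hη
  ext v
  rw [fderiv_apply_eq_sum_pd (hd x)]
  simp [h x hx]

/-- Vanishing of the trace free Hessian forces `f` to be a round paraboloid. -/
lemma eq_paraboloid_of_qfun_eq_zero {f : (ι → ℝ) → ℝ} {k : ℝ} (hb : ∀ i, 0 ≤ b i)
    (hf : ContDiff ℝ 2 f) (hf0 : ∀ ξ, 0 < f ξ) (hk : 0 < k)
    (hq : ∀ ξ ∈ posOrth b, qfun b f k ξ = 0) :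
    ∃ c : ι → ℝ, (∀ i, b i ≠ 0 → c i = 0) ∧ ∃ A > 0, ∀ ξ ∈ orth b,
      f ξ = A * nsq (ξ - c) + k / (4 * A) := by
  have hone : (1 : ι → ℝ) ∈ posOrth b := fun i _ => by simp
  have hE : ∀ ξ ∈ posOrth b, ∀ i j, efun f k i j ξ = 0 := fun ξ hξ i j => by
    have h := hq ξ hξ
    have h1 : ∑ i, ∑ j, efun f k i j ξ ^ 2 = 0 :=
      le_antisymm ((sum_efun_le_qfun hb ξ).trans h.le)
        (Finset.sum_nonneg fun _ _ => Finset.sum_nonneg fun _ _ => sq_nonneg _)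
    have h2 := (Finset.sum_eq_zero_iff_of_nonneg fun _ _ =>
      Finset.sum_nonneg fun _ _ => sq_nonneg _).1 h1 i (Finset.mem_univ i)
    exact pow_eq_zero_iff two_ne_zero |>.1
      ((Finset.sum_eq_zero_iff_of_nonneg fun _ _ => sq_nonneg _).1 h2 j (Finset.mem_univ j))
  have hB : ∀ ξ ∈ posOrth b, ∀ i, b i ≠ 0 → pd i f ξ / ξ i = pfun f k ξ / 2 := fun ξ hξ i hi => by
    have h := hq ξ hξ
    have h0 : 0 ≤ ∑ i, b i * (pd i f ξ / ξ i - pfun f k ξ / 2) ^ 2 :=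
      Finset.sum_nonneg fun i _ => mul_nonneg (hb i) (sq_nonneg _)
    have h1 : ∑ i, b i * (pd i f ξ / ξ i - pfun f k ξ / 2) ^ 2 = 0 := by
      refine le_antisymm ?_ h0
      rw [qfun] at h
      have : 0 ≤ ∑ i, ∑ j, efun f k i j ξ ^ 2 :=
        Finset.sum_nonneg fun _ _ => Finset.sum_nonneg fun _ _ => sq_nonneg _
      linarith
    have h2 := (Finset.sum_eq_zero_iff_of_nonneg fun i _ =>
      mul_nonneg (hb i) (sq_nonneg _)).1 h1 i (Finset.mem_univ i)
    have h3 := pow_eq_zero_iff two_ne_zero |>.1 ((mul_eq_zero.1 h2).resolve_left hi)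
    linarith
  have hH : ∀ ξ ∈ posOrth b, ∀ i j, pd i (pd j f) ξ = if i = j then pfun f k ξ / 2 else 0 :=
    fun ξ hξ i j => sub_eq_zero.1 (hE ξ hξ i j)
  have hfi : ∀ i, ContDiff ℝ 1 (pd i f) := fun i => contDiff_pd i hf (by norm_num)
  have hP : ContDiff ℝ 1 (pfun f k) := contDiff_pfun hf hf0
  set P := pfun f k 1 with hPdef
  have hPpos : 0 < P := div_pos (by
    have : 0 ≤ ∑ i, pd i f 1 ^ 2 := Finset.sum_nonneg fun _ _ => sq_nonneg _
    linarith) (hf0 _)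
  -- With the Hessian equal to (P/2) times the identity, the two terms of ∂_j P cancel.
  have hPc : ∀ ξ ∈ posOrth b, pfun f k ξ = P := fun ξ hξ => by
    refine eq_of_pd_eq_zero hP (fun η hη j => ?_) hξ hone
    rw [pd_pfun hf hf0]
    simp only [hH η hη, ite_mul, zero_mul, Finset.sum_ite_eq, Finset.mem_univ, if_true]
    rw [div_eq_zero_iff]; left; ring
  set B : ι → ℝ := fun i => pd i f 1 - P / 2 with hBdef
  have hgrad : ∀ ξ ∈ posOrth b, ∀ i, pd i f ξ = P / 2 * ξ i + B i := fun ξ hξ i => by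
    have hg : ContDiff ℝ 1 fun η : ι → ℝ => pd i f η - P / 2 * η i :=
      (hfi i).sub (contDiff_const.mul (contDiff_apply ℝ ℝ i))
    have := eq_of_pd_eq_zero (b := b) hg (fun η hη j => ?_) hξ hone
    · simp only [Pi.one_apply, mul_one] at this
      rw [hBdef]; linarith
    · have h1 := hasDerivAt_pd j ((hfi i).differentiable (by simp) η)
      have h2 : HasDerivAt (fun s : ℝ => P / 2 * update η j s i)
          (P / 2 * (Pi.single j (1 : ℝ) : ι → ℝ) i) (η j) :=
        ((hasDerivAt_pi.1 (hasDerivAt_update η j (η j))) i).const_mul _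
      have h3 := (h1.sub h2).deriv
      refine h3.trans ?_
      rw [hH η hη, hPc η hη, Pi.single_apply]
      by_cases hij : j = i
      · subst hij; simp
      · rw [if_neg hij, if_neg (Ne.symm hij)]; simp
  -- The weighted part of `qfun` gives ∂_i f = (P/2) ξ_i in weighted directions, so the centre lies
  -- in x-space.
  have hB0 : ∀ i, b i ≠ 0 → B i = 0 := fun i hi => by
    have h1 := hB 1 hone i hi
    rw [hBdef]; simp only [Pi.one_apply, div_one] at h1
    show pd i f 1 - P / 2 = 0
    linarith
  refine ⟨fun i => -(2 * B i / P), fun i hi => by simp [hB0 i hi], P / 4, by positivity, ?_⟩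
  have hform : ∀ ξ ∈ posOrth b, f ξ =
      P / 4 * nsq (ξ - fun i => -(2 * B i / P)) + k / (4 * (P / 4)) := fun ξ hξ => by
    have h1 := hPc ξ hξ
    rw [pfun, div_eq_iff (hf0 ξ).ne'] at h1
    have h2 : ∑ i, pd i f ξ ^ 2 = (P / 2) ^ 2 * nsq (ξ - fun i => -(2 * B i / P)) := by
      rw [nsq, Finset.mul_sum]
      refine Finset.sum_congr rfl fun i _ => ?_
      rw [hgrad ξ hξ, Pi.sub_apply, ← mul_pow]
      congr 1
      field_simp
      ring
    rw [h2] at h1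
    field_simp
    field_simp at h1
    linarith
  intro ξ hξ
  -- The formula passes from the open to the closed orthant by approaching along (1, …, 1).
  have hc1 : Tendsto (fun ε : ℝ => ξ + ε • (1 : ι → ℝ)) (𝓝[>] 0) (𝓝 ξ) := by
    have : Continuous fun ε : ℝ => ξ + ε • (1 : ι → ℝ) := by fun_prop
    have h := this.tendsto 0
    simp only [zero_smul, add_zero] at h
    exact h.mono_left nhdsWithin_le_nhds
  have l1 := (hf.continuous.tendsto ξ).comp hc1
  have l2 := (((continuous_const.mul (continuous_nsq.comp (continuous_id.sub
    continuous_const))).add continuous_const : Continuous fun ξ : ι → ℝ =>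
      P / 4 * nsq (ξ - fun i => -(2 * B i / P)) + k / (4 * (P / 4))).tendsto ξ).comp hc1
  refine tendsto_nhds_unique (l1.congr' ?_) l2
  filter_upwards [self_mem_nhdsWithin] with ε hε
  refine hform _ fun i hi => ?_
  have := hξ i hi
  have hε : 0 < ε := hε
  simp; linarith

/-- Positive solutions of the critical equation are bubbles. -/
theorem WSol.eq_bubble {U : (ι → ℝ) → ℝ} (hb : ∀ i, b i = 0 ∨ 1 < b i) {i₀ j₀ : ι}
    (hi₀ : b i₀ ≠ 0) (hj₀ : b j₀ = 0) (hp : 0 < p) (hp2 : 2 * p = hdim b - 2)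
    (hcrit : p * α = p + 2) (hU : WSol b α U) (hpos : ∀ ξ, 0 < U ξ) :
    ∃ c : ι → ℝ, (∀ i, b i ≠ 0 → c i = 0) ∧ ∃ t > 0, ∀ ξ ∈ orth b,
      U ξ = (t * √(hdim b * (hdim b - 2)) / (t ^ 2 + nsq (ξ - c))) ^ p := by
  have hb0 : ∀ i, 0 ≤ b i := fun i => by rcases hb i with h | h <;> linarith
  obtain ⟨c, hc, L, hL, hinv⟩ := exists_inversion_symmetry hb hi₀ hj₀ hp hp2 hcrit hU hpos
  have hV := hU.translate hc
  set V : (ι → ℝ) → ℝ := fun ξ => U (ξ - c) with hVdef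
  have hVpos : ∀ ξ, 0 < V ξ := fun ξ => hpos _
  set f : (ι → ℝ) → ℝ := fun ξ => V ξ ^ (-1 / p) with hf
  have hfC : ContDiff ℝ 2 f := hV.smooth.rpow_const_of_ne fun ξ => (hVpos ξ).ne'
  have hf0 : ∀ ξ, 0 < f ξ := fun ξ => Real.rpow_pos_of_pos (hVpos ξ) _
  have hfinv : ∀ ξ ≠ 0, f ξ = nsq ξ / L * f (star L ξ) := fun ξ hξ => by
    have hn := nsq_pos hξ
    have h1 : V ξ = (L / nsq ξ) ^ p * V (star L ξ) := hinv ξ hξ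
    have h2 : 0 < L / nsq ξ := by positivity
    show V ξ ^ (-1 / p) = nsq ξ / L * V (star L ξ) ^ (-1 / p)
    rw [h1, Real.mul_rpow (by positivity) (hVpos _).le, ← Real.rpow_mul h2.le,
      show p * (-1 / p) = -1 by field_simp, Real.rpow_neg_one, inv_div]
  obtain ⟨c₁, hc₁, C₁, hlow, hgrad⟩ := quadratic_growth_of_inversion hfC hf0 hL hfinv
  have hk : 0 < 1 / (p * (p + 1)) := by positivity
  obtain ⟨d, hd, A, hA, hform⟩ := eq_paraboloid_of_qfun_eq_zero hb0 hfC hf0 hk fun ξ hξ =>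
    qfun_eq_zero hb0 hb (by linarith) hfC hf0
      (fun η hη => hV.rpow_equation hp hp2 hcrit hVpos hη) hc₁ hlow hgrad hξ
  have hN : hdim b * (hdim b - 2) = 4 * (p * (p + 1)) := by
    rw [show hdim b = 2 * p + 2 by linarith]; ring
  set s := √(hdim b * (hdim b - 2)) with hs
  have hs2 : s ^ 2 = 4 * (p * (p + 1)) := by rw [hs, Real.sq_sqrt (by rw [hN]; positivity), hN]
  have hs0 : 0 < s := Real.sqrt_pos.2 (by rw [hN]; positivity)
  -- Matching A|ξ|² + k/(4A) with (t² + |ξ|²)/(ts) requires 1/(ts) = A; then t/s = 1/(As²) = k/(4A)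
  -- because s² = 4/k.
  refine ⟨d - c, fun i hi => by simp [hc i hi, hd i hi], 1 / (A * s), by positivity,
    fun ξ hξ => ?_⟩
  have hmem : ξ + c ∈ orth b := fun i hi => by
    have := hξ i hi
    simp [hc i hi, this]
  have h1 := hform _ hmem
  have h2 : V (ξ + c) = U ξ := by simp [hVdef]
  have h3 : U ξ = f (ξ + c) ^ (-p) := by
    show U ξ = (V (ξ + c) ^ (-1 / p)) ^ (-p)
    rw [h2, ← Real.rpow_mul (hpos ξ).le, show -1 / p * -p = 1 by field_simp, Real.rpow_one]
  rw [h3, Real.rpow_neg (hf0 _).le, ← Real.inv_rpow (hf0 _).le, h1,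
    show ξ + c - d = ξ - (d - c) by abel]
  congr 1
  have hn := nsq_nonneg (ξ - (d - c))
  have e1 : 1 / (p * (p + 1)) / (4 * A) = 1 / (A * s ^ 2) := by
    rw [hs2]; field_simp
  rw [e1]
  field_simp
  ring

end

/-! ### Continuity across the hyperplanes, the bubbles, and the change of variables y = ξ²/4. -/

section

section Continuity

variable {ι : Type*} [Fintype ι] [DecidableEq ι] {b : ι → ℝ}

/-- As ∂_i U vanishes on ξ_i = 0, the quotient is an average of ∂_i² U along the coordinate line.
This representation covers both branches of `radQ` and makes `Lop` continuous across the
hyperplanes. -/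
lemma radQ_eq_integral {U : (ι → ℝ) → ℝ} (hU : ContDiff ℝ 2 U) {i : ι}
    (h : ∀ ξ : ι → ℝ, ξ i = 0 → pd i U ξ = 0) (ξ : ι → ℝ) :
    radQ i U ξ = ∫ t in (0 : ℝ)..1, pd i (pd i U) (update ξ i (t * ξ i)) := by
  have hd : ContDiff ℝ 1 (pd i U) := contDiff_pd i hU (by norm_num)
  have hdd : Continuous (pd i (pd i U)) := continuous_pd i hd
  unfold radQ
  split_ifs with h0
  · have : ∀ t : ℝ, update ξ i (t * ξ i) = ξ := fun t => by
      rw [h0, mul_zero, ← h0, update_eq_self]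
    simp [this]
  · have hline : Continuous fun t : ℝ => update ξ i (t * ξ i) :=
      continuous_const.update i (continuous_id.mul continuous_const)
    have hder : ∀ t : ℝ, HasDerivAt (fun t : ℝ => pd i U (update ξ i (t * ξ i)))
        (pd i (pd i U) (update ξ i (t * ξ i)) * ξ i) t := fun t => by
      have h1 := hasDerivAt_pd i (hd.differentiable (by simp) (update ξ i (t * ξ i)))
      simp only [update_idem, update_self] at h1
      have h2 : HasDerivAt (fun t : ℝ => t * ξ i) (ξ i) t := by
        simpa using (hasDerivAt_id t).mul_const (ξ i)
      exact h1.comp t h2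
    have := intervalIntegral.integral_eq_sub_of_hasDerivAt (a := (0 : ℝ)) (b := 1)
      (fun t _ => hder t) (((hdd.comp hline).mul (continuous_const (y := ξ i))).intervalIntegrable
        (μ := volume) 0 1)
    rw [intervalIntegral.integral_mul_const, h (update ξ i (0 * ξ i)) (by simp), one_mul,
      update_eq_self, sub_zero] at this
    rw [← this, mul_div_cancel_right₀ _ h0]

lemma continuous_Lop {U : (ι → ℝ) → ℝ} (hU : ContDiff ℝ 2 U) (he : EvenIn b U) :
    Continuous (Lop b U) := by
  refine continuous_finsetSum _ fun i _ => ?_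
  have hdd : Continuous (pd i (pd i U)) := continuous_pd i (contDiff_pd i hU (by norm_num))
  refine hdd.add ?_
  by_cases hi : b i = 0
  · simp only [hi, zero_mul]; exact continuous_const
  · simp only [radQ_eq_integral hU fun ξ hξ => he.pd_eq_zero hi hξ]
    refine continuous_const.mul
      (intervalIntegral.continuous_parametric_intervalIntegral_of_continuous' ?_ _ _)
    exact hdd.comp (continuous_fst.update i (continuous_snd.mul
      ((continuous_apply i).comp continuous_fst)))

lemma dense_forall_ne_zero : Dense {ξ : ι → ℝ | ∀ i, ξ i ≠ 0} := by
  have := dense_pi (s := fun _ : ι => ({0}ᶜ : Set ℝ)) univ fun _ _ => dense_compl_singleton 0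
  convert this using 1
  ext; simp

/-- The equation extends from the complement of the coordinate hyperplanes. -/
lemma WSol.of_forall_ne_zero {α : ℝ} (hα : 0 < α) {U : (ι → ℝ) → ℝ} (hU : ContDiff ℝ 2 U)
    (he : EvenIn b U) (h0 : ∀ ξ : ι → ℝ, (∀ i, ξ i ≠ 0) → 0 ≤ U ξ)
    (h : ∀ ξ : ι → ℝ, (∀ i, ξ i ≠ 0) → Lop b U ξ = -U ξ ^ α) : WSol b α U where
  smooth := hU
  even := he
  nonneg ξ := by
    have hcl : IsClosed {ξ | 0 ≤ U ξ} := isClosed_le continuous_const hU.continuous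
    exact hcl.closure_subset_iff.2 h0 (dense_forall_ne_zero ξ)
  eq ξ := by
    have hc : Continuous fun ξ => -U ξ ^ α :=
      (hU.continuous.rpow_const fun ξ => Or.inr hα.le).neg
    exact congrFun ((continuous_Lop hU he).ext_on dense_forall_ne_zero hc h) ξ

/-- The bubbles solve the critical equation. -/
lemma bubble_WSol {p α t : ℝ} (hp : 0 < p) (hp2 : 2 * p = hdim b - 2) (hcrit : p * α = p + 2)
    (ht : 0 < t) {c : ι → ℝ} (hc : ∀ i, b i ≠ 0 → c i = 0) :
    WSol b α fun ξ => (t * √(hdim b * (hdim b - 2)) / (t ^ 2 + nsq (ξ - c))) ^ p := by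
  have hN : hdim b * (hdim b - 2) = 4 * (p * (p + 1)) := by
    rw [show hdim b = 2 * p + 2 by linarith]; ring
  have hNp : 0 < hdim b * (hdim b - 2) := by rw [hN]; positivity
  set K := t * √(hdim b * (hdim b - 2)) with hK
  have hK0 : 0 < K := mul_pos ht (Real.sqrt_pos.2 hNp)
  have hK2 : K ^ 2 = 4 * (p * (p + 1)) * t ^ 2 := by
    rw [hK, mul_pow, Real.sq_sqrt hNp.le, hN]; ring
  have hD : ∀ ξ : ι → ℝ, 0 < t ^ 2 + nsq ξ := fun ξ => by
    have := nsq_nonneg ξ; positivity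
  refine WSol.translate (U := fun ξ => (K / (t ^ 2 + nsq ξ)) ^ p) ⟨?_, fun i _ ξ => ?_,
    fun ξ => ?_, fun ξ => ?_⟩ hc
  · exact (contDiff_const.div (contDiff_const.add contDiff_nsq) fun ξ => (hD ξ).ne').rpow_const_of_ne
      fun ξ => (div_pos hK0 (hD ξ)).ne'
  · rw [nsq_update, neg_sq, sub_add_cancel]
  · exact Real.rpow_nonneg (div_pos hK0 (hD ξ)).le _
  · have h1 : ∀ s : ℝ, 0 < t ^ 2 + s → HasDerivAt (fun s : ℝ => K ^ p * (t ^ 2 + s) ^ (-p))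
        (K ^ p * (-p * (t ^ 2 + s) ^ (-p - 1))) s := fun s hs => by
      have := ((hasDerivAt_id s).const_add (t ^ 2)).rpow_const (p := -p) (Or.inl hs.ne')
      refine (this.const_mul (K ^ p)).congr_deriv ?_
      simp
    have h2 : HasDerivAt (fun s : ℝ => K ^ p * (-p * (t ^ 2 + s) ^ (-p - 1)))
        (K ^ p * (-p * ((-p - 1) * (t ^ 2 + nsq ξ) ^ (-p - 1 - 1)))) (nsq ξ) := by
      have := ((hasDerivAt_id (nsq ξ)).const_add (t ^ 2)).rpow_const (p := -p - 1)
        (Or.inl (hD ξ).ne')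
      refine ((this.const_mul (-p)).const_mul (K ^ p)).congr_deriv ?_
      simp
    have hfun : (fun ξ : ι → ℝ => (K / (t ^ 2 + nsq ξ)) ^ p) =
        fun ξ => K ^ p * (t ^ 2 + nsq ξ) ^ (-p) := by
      ext η
      rw [Real.div_rpow hK0.le (hD η).le, Real.rpow_neg (hD η).le, div_eq_mul_inv]
    have hev : ∀ᶠ s in 𝓝 (nsq ξ), 0 < t ^ 2 + s :=
      (continuous_const.add continuous_id).continuousAt.eventually (lt_mem_nhds (hD ξ))
    rw [hfun]
    have := Lop_radial b (hev.mono h1) h2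
    rw [this]
    have hfun' := congrFun hfun ξ
    beta_reduce at hfun'
    rw [hfun']
    set D := t ^ 2 + nsq ξ with hDdef
    have hDp := hD ξ
    rw [← hDdef] at hDp
    have hα : α = (p + 2) / p := by field_simp; linarith
    have e1 : (K ^ p * D ^ (-p)) ^ α = K ^ p * K ^ 2 * (D ^ (-p) / D ^ 2) := by
      rw [Real.mul_rpow (by positivity) (by positivity), ← Real.rpow_mul hK0.le,
        ← Real.rpow_mul hDp.le, hcrit, show -p * α = -p - 2 by linarith,
        Real.rpow_add hK0, Real.rpow_sub hDp]
      norm_num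
    have e2 : D ^ (-p - 1) = D ^ (-p) / D := Real.rpow_sub_one hDp.ne' _
    have e3 : D ^ (-p - 1 - 1) = D ^ (-p) / D / D := by
      rw [Real.rpow_sub_one hDp.ne', e2]
    -- With D = t² + |ξ|² the linear part becomes 4p(p + 1)((D − t²) − D) D^(−p−2) K^p, and K² =
    -- 4p(p + 1)t² identifies it with the nonlinearity.
    rw [e1, e2, e3, hK2, show hdim b = 2 * p + 2 by linarith,
      show nsq ξ = D - t ^ 2 by rw [hDdef]; ring]
    field_simp
    ring

end Continuity

section Lift

variable {n m : ℕ}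

/-- The point with `y` coordinates `ξ² / 4`. -/
noncomputable def toPoint (ξ : Fin n ⊕ Fin m → ℝ) : EuclideanSpace ℝ (Fin n) × (Fin m → ℝ) :=
  (WithLp.toLp 2 fun i => ξ (Sum.inl i), fun j => ξ (Sum.inr j) ^ 2 / 4)

/-- The weight exponents in the radial coordinates. -/
def radialWeight (n : ℕ) {m : ℕ} (a : Fin m → ℝ) : Fin n ⊕ Fin m → ℝ :=
  Sum.elim (fun _ => 0) fun j => 2 * a j - 1

lemma toPoint_update_inl (ξ : Fin n ⊕ Fin m → ℝ) (i : Fin n) (s : ℝ) :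
    toPoint (update ξ (Sum.inl i) s) =
      (WithLp.toLp 2 (update (fun i => ξ (Sum.inl i)) i s), (toPoint ξ).2) := by
  unfold toPoint
  refine Prod.ext ?_ ?_
  · refine congrArg (WithLp.toLp 2) (funext fun k => ?_)
    by_cases h : k = i
    · subst h; simp
    · simp [h]
  · funext k
    simp

lemma toPoint_update_inr (ξ : Fin n ⊕ Fin m → ℝ) (j : Fin m) (s : ℝ) :
    toPoint (update ξ (Sum.inr j) s) = ((toPoint ξ).1, update (toPoint ξ).2 j (s ^ 2 / 4)) := by
  unfold toPoint
  refine Prod.ext ?_ ?_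
  · refine congrArg (WithLp.toLp 2) (funext fun k => ?_)
    simp
  · funext k
    by_cases h : k = j
    · subst h; simp
    · simp [h]

lemma contDiff_toPoint {k : WithTop ℕ∞} :
    ContDiff ℝ k (toPoint : (Fin n ⊕ Fin m → ℝ) → _) := by
  unfold toPoint
  refine ContDiff.prodMk ?_ ?_
  · exact (PiLp.contDiff_toLp).comp (contDiff_pi.2 fun i => contDiff_apply ℝ ℝ _)
  · exact contDiff_pi.2 fun j => ((contDiff_apply ℝ ℝ _).pow 2).div_const 4

lemma toPoint_mem_closedRegion (ξ : Fin n ⊕ Fin m → ℝ) : toPoint ξ ∈ closedRegion n m :=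
  fun j => by simp only [toPoint]; positivity

lemma toPoint_mem_openRegion {ξ : Fin n ⊕ Fin m → ℝ} (h : ∀ j, ξ (Sum.inr j) ≠ 0) :
    toPoint ξ ∈ openRegion n m :=
  fun j => by have := h j; simp only [toPoint]; positivity

lemma isOpen_openRegion : IsOpen (openRegion n m) := by
  have : openRegion n m = ⋂ i, {p : EuclideanSpace ℝ (Fin n) × (Fin m → ℝ) | 0 < p.2 i} := by
    ext; simp [openRegion]
  rw [this]
  exact isOpen_iInter_of_finite fun i =>
    isOpen_lt continuous_const ((continuous_apply i).comp continuous_snd)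

lemma openRegion_subset : openRegion n m ⊆ closedRegion n m := fun _ h i => (h i).le

/-- A preimage of a point of the closed region under `toPoint`. -/
noncomputable def ofPoint (q : EuclideanSpace ℝ (Fin n) × (Fin m → ℝ)) : Fin n ⊕ Fin m → ℝ :=
  Sum.elim (fun i => q.1 i) fun j => 2 * √(q.2 j)

lemma toPoint_ofPoint {q : EuclideanSpace ℝ (Fin n) × (Fin m → ℝ)} (h : q ∈ closedRegion n m) :
    toPoint (ofPoint q) = q := by
  refine Prod.ext ?_ ?_
  · ext i; simp [toPoint, ofPoint]
  · ext j
    simp only [toPoint, ofPoint, Sum.elim_inr, mul_pow, Real.sq_sqrt (h j)]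
    ring

lemma hasDerivAt_clm_apply_const {E : Type*} [NormedAddCommGroup E] [NormedSpace ℝ E]
    {G : ℝ → E →L[ℝ] ℝ} {G' : E →L[ℝ] ℝ} {s : ℝ} (h : HasDerivAt G G' s) (e : E) :
    HasDerivAt (fun s => G s e) (G' e) s := by
  simpa using h.clm_apply (hasDerivAt_const s e)

lemma deriv_deriv_line {E : Type*} [NormedAddCommGroup E] [NormedSpace ℝ E] {g : E → ℝ} {x : E}
    (hg : ContDiffAt ℝ 2 g x) (e : E) (s₀ : ℝ) :
    deriv (deriv fun s : ℝ => g (x + (s - s₀) • e)) s₀ = iteratedFDeriv ℝ 2 g x ![e, e] := by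
  have hl : ∀ s : ℝ, HasDerivAt (fun s : ℝ => x + (s - s₀) • e) e s := fun s => by
    simpa using (((hasDerivAt_id s).sub_const s₀).smul_const e).const_add x
  have hx : x + (s₀ - s₀) • e = x := by simp
  have hc : Tendsto (fun s : ℝ => x + (s - s₀) • e) (𝓝 s₀) (𝓝 x) := by
    have := (hl s₀).continuousAt.tendsto
    rwa [hx] at this
  have hev : (deriv fun s : ℝ => g (x + (s - s₀) • e)) =ᶠ[𝓝 s₀]
      fun s => fderiv ℝ g (x + (s - s₀) • e) e := by
    filter_upwards [hc.eventually (hg.eventually (by simp))] with s hs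
    exact ((hs.differentiableAt (by simp)).hasFDerivAt.comp_hasDerivAt s (hl s)).deriv
  have h1 : ContDiffAt ℝ 1 (fderiv ℝ g) x := hg.fderiv_right (by norm_num)
  have h2 : HasFDerivAt (fderiv ℝ g) (fderiv ℝ (fderiv ℝ g) x) x :=
    (h1.differentiableAt (by simp)).hasFDerivAt
  rw [hev.deriv_eq, iteratedFDeriv_two_apply]
  have h3 : HasDerivAt (fun s : ℝ => fderiv ℝ g (x + (s - s₀) • e))
      (fderiv ℝ (fderiv ℝ g) (x + (s₀ - s₀) • e) e) s₀ :=
    (show HasFDerivAt (fderiv ℝ g) (fderiv ℝ (fderiv ℝ g) (x + (s₀ - s₀) • e))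
      (x + (s₀ - s₀) • e) by rw [hx]; exact h2).comp_hasDerivAt s₀ (hl s₀)
  rw [hx] at h3
  exact (hasDerivAt_clm_apply_const h3 e).deriv

lemma toLp_update_eq (x : Fin n → ℝ) (i : Fin n) (s : ℝ) :
    WithLp.toLp 2 (update x i s) =
      WithLp.toLp 2 x + (s - x i) • (EuclideanSpace.single i 1 : EuclideanSpace ℝ (Fin n)) := by
  ext k
  by_cases h : k = i
  · subst h; simp
  · simp [h]

lemma laplacian_eq_sum_deriv {g : EuclideanSpace ℝ (Fin n) → ℝ} {x : Fin n → ℝ}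
    (hg : ContDiffAt ℝ 2 g (WithLp.toLp 2 x)) :
    Laplacian.laplacian g (WithLp.toLp 2 x) =
      ∑ i, deriv (deriv fun s : ℝ => g (WithLp.toLp 2 (update x i s))) (x i) := by
  rw [InnerProductSpace.laplacian_eq_iteratedFDeriv_orthonormalBasis g
    (EuclideanSpace.basisFun (Fin n) ℝ)]
  refine Finset.sum_congr rfl fun i _ => ?_
  simp only [toLp_update_eq]
  rw [deriv_deriv_line hg, EuclideanSpace.basisFun_apply]

lemma deriv_comp_sq_div {h : ℝ → ℝ} {r : ℝ} (hh : ContDiffAt ℝ 2 h (r ^ 2 / 4)) :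
    deriv (fun s : ℝ => h (s ^ 2 / 4)) r = deriv h (r ^ 2 / 4) * (r / 2) ∧
    deriv (deriv fun s : ℝ => h (s ^ 2 / 4)) r =
      r ^ 2 / 4 * deriv (deriv h) (r ^ 2 / 4) + deriv h (r ^ 2 / 4) / 2 := by
  have hq : ∀ s : ℝ, HasDerivAt (fun s : ℝ => s ^ 2 / 4) (s / 2) s := fun s => by
    refine ((hasDerivAt_pow 2 s).div_const 4).congr_deriv ?_
    norm_num; ring
  have hev : (deriv fun s : ℝ => h (s ^ 2 / 4)) =ᶠ[𝓝 r]
      fun s => deriv h (s ^ 2 / 4) * (s / 2) := by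
    filter_upwards [(hq r).continuousAt.eventually (hh.eventually (by simp))] with s hs
    exact ((hs.differentiableAt (by simp)).hasDerivAt.comp s (hq s)).deriv
  refine ⟨hev.eq_of_nhds, ?_⟩
  rw [hev.deriv_eq]
  have h4 := ((deriv_eventually hh).2.hasDerivAt.comp r (hq r)).mul ((hasDerivAt_id r).div_const 2)
  refine h4.deriv.trans ?_
  simp; ring

/-- The equation in the radial coordinates. -/
lemma Lop_comp_toPoint (a : Fin m → ℝ) {u : EuclideanSpace ℝ (Fin n) × (Fin m → ℝ) → ℝ}
    {ξ : Fin n ⊕ Fin m → ℝ} (hu : ContDiffAt ℝ 2 u (toPoint ξ)) (hξ : ∀ j, ξ (Sum.inr j) ≠ 0) :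
    Lop (radialWeight n a) (fun η => u (toPoint η)) ξ =
      (∑ i, (toPoint ξ).2 i * partialYY u i (toPoint ξ)) + (∑ i, a i * partialY u i (toPoint ξ)) +
        laplacianX u (toPoint ξ) := by
  unfold Lop
  rw [Fintype.sum_sum_type]
  have e1 : laplacianX u (toPoint ξ) = ∑ i, (pd (Sum.inl i) (pd (Sum.inl i)
      fun η => u (toPoint η)) ξ + radialWeight n a (Sum.inl i) *
      radQ (Sum.inl i) (fun η => u (toPoint η)) ξ) := by
    have hg : ContDiffAt ℝ 2 (fun x => u (x, (toPoint ξ).2)) (toPoint ξ).1 :=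
      hu.comp (toPoint ξ).1 (contDiffAt_id.prodMk contDiffAt_const)
    rw [laplacianX]
    refine (laplacian_eq_sum_deriv hg).trans (Finset.sum_congr rfl fun i _ => ?_)
    rw [pd_pd]
    simp only [toPoint_update_inl]
    simp [radialWeight]
  have e2 : ∀ j, pd (Sum.inr j) (pd (Sum.inr j) fun η => u (toPoint η)) ξ +
      radialWeight n a (Sum.inr j) * radQ (Sum.inr j) (fun η => u (toPoint η)) ξ =
      (toPoint ξ).2 j * partialYY u j (toPoint ξ) + a j * partialY u j (toPoint ξ) := fun j => by
    have hh : ContDiffAt ℝ 2 (fun s : ℝ => u ((toPoint ξ).1, update (toPoint ξ).2 j s))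
        ((toPoint ξ).2 j) := by
      refine ContDiffAt.comp (g := u) _ ?_ (contDiffAt_const.prodMk
        (contDiff_update (𝕜 := ℝ) 2 (toPoint ξ).2 j).contDiffAt)
      rwa [update_eq_self]
    have hy : (toPoint ξ).2 j = ξ (Sum.inr j) ^ 2 / 4 := rfl
    have h := deriv_comp_sq_div (h := fun s : ℝ => u ((toPoint ξ).1, update (toPoint ξ).2 j s))
      (r := ξ (Sum.inr j)) (by rw [← hy]; exact hh)
    rw [radQ, if_neg (hξ j), pd_pd, pd]
    simp only [toPoint_update_inr]
    rw [h.1, h.2, partialYY, partialY, iteratedDeriv_succ, iteratedDeriv_one, hy]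
    have := hξ j
    simp only [radialWeight, Sum.elim_inr]
    field_simp
    ring
  rw [← e1, Finset.sum_congr rfl fun j _ => e2 j, Finset.sum_add_distrib]
  ring

end Lift

end

/-! ### Transfer between the original problem and the weighted equation. -/

section

variable {n m : ℕ} {a : Fin m → ℝ}

lemma hdim_radialWeight : hdim (radialWeight n a) = n + 2 * ∑ i, a i := by
  unfold hdim radialWeight
  rw [Fintype.sum_sum_type]
  simp [Finset.mul_sum]

lemma radialWeight_eq_zero_or (ha : ∀ i, 1 < a i) (i : Fin n ⊕ Fin m) :
    radialWeight n a i = 0 ∨ 1 < radialWeight n a i := by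
  rcases i with i | j
  · exact Or.inl rfl
  · right
    show 1 < 2 * a j - 1
    linarith [ha j]

lemma radialWeight_inr_ne_zero (ha : ∀ i, 1 < a i) (j : Fin m) :
    radialWeight n a (Sum.inr j) ≠ 0 := by
  show 2 * a j - 1 ≠ 0
  linarith [ha j]

lemma contDiffAt_of_mem_openRegion {u : EuclideanSpace ℝ (Fin n) × (Fin m → ℝ) → ℝ}
    (hu : ContDiffOn ℝ 2 u (closedRegion n m)) {q : EuclideanSpace ℝ (Fin n) × (Fin m → ℝ)}
    (hq : q ∈ openRegion n m) : ContDiffAt ℝ 2 u q :=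
  hu.contDiffAt (mem_of_superset (isOpen_openRegion.mem_nhds hq) openRegion_subset)

/-- A solution becomes a solution of the weighted equation in the radial coordinates. -/
lemma wsol_of_isNonnegSolution {α : ℝ} (hα : 0 < α)
    {u : EuclideanSpace ℝ (Fin n) × (Fin m → ℝ) → ℝ} (hu : IsNonnegSolution a α u) :
    WSol (radialWeight n a) α fun ξ => u (toPoint ξ) := by
  refine WSol.of_forall_ne_zero hα
    (hu.contDiffOn.comp_contDiff contDiff_toPoint toPoint_mem_closedRegion) ?_
    (fun ξ hξ => hu.nonneg _ (toPoint_mem_openRegion fun j => hξ _)) fun ξ hξ => ?_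
  · rintro (i | j) hi ξ
    · exact absurd rfl hi
    · beta_reduce
      rw [toPoint_update_inr, neg_sq, ← toPoint_update_inr, update_eq_self]
  · have hq := toPoint_mem_openRegion (ξ := ξ) fun j => hξ _
    rw [Lop_comp_toPoint a (contDiffAt_of_mem_openRegion hu.contDiffOn hq) fun j => hξ _]
    linarith [hu.equation _ hq]

lemma dimension_pos (hn : 1 ≤ n) (hm : 1 ≤ m) (ha : ∀ i, 1 < a i) :
    0 < (n : ℝ) + 2 * (∑ i, a i) - 2 := by
  have h1 : (1 : ℝ) ≤ n := by exact_mod_cast hn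
  have h2 : a ⟨0, hm⟩ ≤ ∑ i, a i :=
    Finset.single_le_sum (fun i _ => by linarith [ha i]) (Finset.mem_univ _)
  linarith [ha ⟨0, hm⟩]

/-- Since 4y_j = ξ_j², the denominator of a bubble becomes t² plus a squared Euclidean distance to a
centre with zero weighted coordinates. -/
lemma bubble_toPoint (a : Fin m → ℝ) (t : ℝ) (c ξ : Fin n ⊕ Fin m → ℝ)
    (hc : ∀ j, c (Sum.inr j) = 0) :
    bubble a t (WithLp.toLp 2 fun i => c (Sum.inl i)) (toPoint ξ) =
      (t * √(hdim (radialWeight n a) * (hdim (radialWeight n a) - 2)) /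
        (t ^ 2 + nsq (ξ - c))) ^ (((n : ℝ) + 2 * (∑ i, a i) - 2) / 2) := by
  rw [bubble, hdim_radialWeight, EuclideanSpace.real_norm_sq_eq, nsq, Fintype.sum_sum_type]
  have e1 : 4 * ∑ j, (toPoint ξ).2 j = ∑ j, (ξ - c) (Sum.inr j) ^ 2 := by
    rw [Finset.mul_sum]
    refine Finset.sum_congr rfl fun j _ => ?_
    simp only [toPoint, Pi.sub_apply, hc j]; ring
  have e2 : ∀ i, ((toPoint ξ).1 - WithLp.toLp 2 fun i => c (Sum.inl i)) i ^ 2 =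
      (ξ - c) (Sum.inl i) ^ 2 := fun i => by simp [toPoint]
  simp only [e1, e2]
  congr 2
  ring

lemma contDiffOn_bubble {t : ℝ} (ht : 0 < t) (hd : 0 < (n : ℝ) + 2 * (∑ i, a i) - 2)
    (x₀ : EuclideanSpace ℝ (Fin n)) : ContDiffOn ℝ 2 (bubble a t x₀) (closedRegion n m) := by
  intro q hq
  have hK : 0 < t * √(((n : ℝ) + 2 * (∑ i, a i)) * ((n : ℝ) + 2 * (∑ i, a i) - 2)) :=
    mul_pos ht (Real.sqrt_pos.2 (mul_pos (by linarith) hd))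
  have hD : 0 < t ^ 2 + 4 * (∑ i, q.2 i) + ‖q.1 - x₀‖ ^ 2 := by
    have h1 : 0 ≤ ∑ i, q.2 i := Finset.sum_nonneg fun i _ => hq i
    positivity
  have h2 : ContDiff ℝ 2 fun q : EuclideanSpace ℝ (Fin n) × (Fin m → ℝ) =>
      t ^ 2 + 4 * (∑ i, q.2 i) + ‖q.1 - x₀‖ ^ 2 :=
    (contDiff_const.add (contDiff_const.mul (ContDiff.sum fun i _ =>
      (contDiff_apply ℝ ℝ i).comp contDiff_snd))).add
      ((contDiff_norm_sq ℝ).comp (contDiff_fst.sub contDiff_const))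
  exact ((contDiffAt_const.div h2.contDiffAt hD.ne').rpow_const_of_ne
    (div_pos hK hD).ne').contDiffWithinAt

lemma bubble_zero (hd : 0 < (n : ℝ) + 2 * (∑ i, a i) - 2) (x₀ : EuclideanSpace ℝ (Fin n))
    (q : EuclideanSpace ℝ (Fin n) × (Fin m → ℝ)) : bubble a 0 x₀ q = 0 := by
  rw [bubble, zero_mul, zero_div, Real.zero_rpow (by positivity)]

/-- The equation for `u` only depends on the composition with `toPoint`. -/
lemma isNonnegSolution_of_wsol {α : ℝ} {u : EuclideanSpace ℝ (Fin n) × (Fin m → ℝ) → ℝ}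
    (hu : ContDiffOn ℝ 2 u (closedRegion n m))
    (h : WSol (radialWeight n a) α fun ξ => u (toPoint ξ)) : IsNonnegSolution a α u where
  contDiffOn := hu
  nonneg q hq := by
    have := h.nonneg (ofPoint q)
    rwa [toPoint_ofPoint (openRegion_subset hq)] at this
  equation q hq := by
    have hq' := openRegion_subset hq
    have hne : ∀ j, ofPoint q (Sum.inr j) ≠ 0 := fun j =>
      (mul_pos two_pos (Real.sqrt_pos.2 (hq j))).ne'
    have h1 := h.eq (ofPoint q)
    have h2 := Lop_comp_toPoint (ξ := ofPoint q) a (u := u)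
      (by rw [toPoint_ofPoint hq']; exact contDiffAt_of_mem_openRegion hu hq) hne
    rw [h1] at h2
    simp only [toPoint_ofPoint hq'] at h2
    linarith

lemma zero_WSol {ι : Type*} [Fintype ι] [DecidableEq ι] {b : ι → ℝ} {α : ℝ} (hα : 0 < α) :
    WSol b α fun _ => 0 where
  smooth := contDiff_const
  even _ _ _ := rfl
  nonneg _ := le_rfl
  eq ξ := by
    have h := Lop_radial b (φ := fun _ => 0) (φ' := fun _ => 0) (φ'' := 0) (ξ := ξ)
      (Eventually.of_forall fun _ => hasDerivAt_const _ _) (hasDerivAt_const _ _)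
    rw [h, Real.zero_rpow hα.ne']; simp

end

end WeightedLaplacian

/-! ### The main theorem. -/

open WeightedLaplacian

theorem mainTheorem3 (n m : ℕ) (hn : 1 ≤ n) (hm : 1 ≤ m) (a : Fin m → ℝ) (ha : ∀ i, 1 < a i)
    (u : EuclideanSpace ℝ (Fin n) × (Fin m → ℝ) → ℝ) :
    (∀ α : ℝ, 1 < α → α < criticalExponent n a → IsNonnegSolution a α u →
      ∀ p ∈ closedRegion n m, u p = 0) ∧
    (IsNonnegSolution a (criticalExponent n a) u ↔
      ∃ (x₀ : EuclideanSpace ℝ (Fin n)) (t : ℝ), 0 ≤ t ∧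
        ∀ p ∈ closedRegion n m, u p = bubble a t x₀ p) := by
  have hd := dimension_pos hn hm ha
  set p : ℝ := ((n : ℝ) + 2 * (∑ i, a i) - 2) / 2 with hp
  have hp0 : 0 < p := by positivity
  have hp2 : 2 * p = hdim (radialWeight n a) - 2 := by rw [hdim_radialWeight, hp]; ring
  have hcrit : p * criticalExponent n a = p + 2 := by
    rw [criticalExponent, hp]; field_simp; ring
  have hb := radialWeight_eq_zero_or (n := n) ha
  have hb0 : ∀ i, 0 ≤ radialWeight n a i := fun i => by rcases hb i with h | h <;> linarith
  have hi₀ := radialWeight_inr_ne_zero (n := n) ha ⟨0, hm⟩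
  have hα0 : 0 < criticalExponent n a := by
    have : 0 < p * criticalExponent n a := by rw [hcrit]; linarith
    exact (pos_iff_pos_of_mul_pos this).1 hp0
  refine ⟨fun α hα hαc hu q hq => ?_, fun hu => ?_, ?_⟩
  · have hW := wsol_of_isNonnegSolution (by linarith) hu
    have hlt : p * α < p + 2 := by rw [← hcrit]; gcongr
    have := liouville_subcritical hb0 hi₀ hp0 hp2 hα hlt hW (ofPoint q)
    rwa [toPoint_ofPoint hq] at this
  · have hW := wsol_of_isNonnegSolution hα0 hu
    rcases hW.eq_zero_or_pos hb0 with h0 | hpos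
    · refine ⟨0, 0, le_rfl, fun q hq => ?_⟩
      have := h0 (ofPoint q)
      rw [toPoint_ofPoint hq] at this
      rw [this, bubble_zero hd]
    -- The condition n ≥ 1 provides an unweighted direction, along which the centres move; m ≥ 1 has
    -- provided the weighted direction.
    · obtain ⟨c, hc, t, ht, h⟩ := hW.eq_bubble hb hi₀ (j₀ := Sum.inl ⟨0, hn⟩) rfl hp0 hp2
        hcrit hpos
      have hc' : ∀ j, c (Sum.inr j) = 0 := fun j => hc _ (radialWeight_inr_ne_zero ha j)
      refine ⟨WithLp.toLp 2 fun i => c (Sum.inl i), t, ht.le, fun q hq => ?_⟩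
      have hmem : ofPoint q ∈ orth (radialWeight n a) := by
        rintro (i | j) hi
        · exact absurd rfl hi
        · exact mul_nonneg zero_le_two (Real.sqrt_nonneg _)
      have h1 := h _ hmem
      rw [← bubble_toPoint a t c _ hc', toPoint_ofPoint hq] at h1
      exact h1
  · rintro ⟨x₀, t, ht, h⟩
    rcases ht.eq_or_lt with rfl | ht
    · refine isNonnegSolution_of_wsol (contDiffOn_const.congr fun q hq =>
        (h q hq).trans (bubble_zero hd _ _)) ?_
      simpa only [h _ (toPoint_mem_closedRegion _), bubble_zero hd] using zero_WSol hα0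
    · refine isNonnegSolution_of_wsol ((contDiffOn_bubble ht hd x₀).congr h) ?_
      set c : Fin n ⊕ Fin m → ℝ := Sum.elim (fun i => x₀ i) 0 with hcdef
      have hB := bubble_WSol (c := c) hp0 hp2 hcrit ht (by
        rintro (i | j) hi
        · exact absurd rfl hi
        · rfl)
      have e : ∀ ξ, u (toPoint ξ) = _ := fun ξ =>
        (h _ (toPoint_mem_closedRegion ξ)).trans (bubble_toPoint a t c ξ fun j => rfl)
      simpa only [e] using hB
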